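/- **Theorem 3.2.** Let $n=2m\ge 2$ and let $\lambda=(n-k,k)$ with $n-k\ge k\ge 1$ be a partition such that either $n-k=k$, or $n-k$ and $k$ are both odd. Let $V_\lambda$ be the complex vector space with basis $e_1,\dots,e_{n-k},f_1,\dots,f_k$, let $x$ be the nilpotent endomorphism $e_i\mapsto e_{i-1}$, $f_i\mapsto f_{i-1}$ (with $e_0=f_0=0$), and let $\beta$ be the nondegenerate symmetric bilinear form whose Gram matrix in this basis is $$\begin{pmatrix}0&J_m\\ J_m^t&0\end{pmatrix}\ \text{ if } n-k=k,\qquad \begin{pmatrix}J_{n-k}&0\\ 0&(-1)^mJ_k\end{pmatrix}\ \text{ if } n-k>k,$$ where $J_r$ is the $r\times r$ antidiagonal matrix with entries $1,-1,\dots,(-1)^{r-1}$ from the top row down. Let $\mathcal B^{\mathrm D}_{n-k,k}$ be the Springer fiber of all complete flags $0=F_0\subsetneq F_1\subsetneq\dots\subsetneq F_n=V_\lambda$ with $F_{n-i}=F_i^\perp$ for $0\le i\le n$ and $xF_i\subseteq F_{i-1}$ for $1\le i\le n$, inside the variety of complete flags of $V_\lambda$. A marked cup diagram on vertices $1,\dots,m$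 is a non-intersecting arrangement of cups and vertical rays below a horizontal line in a rectangle, each vertex being an endpoint of exactly one cup or ray, in which every cup or ray accessible from the right edge of the rectangle (no ray to its right, and not nested under a cup) may carry a marker. Let $I^{\mathrm D}_{n-k,k}$ be the set of those with $\lfloor k/2\rfloor$ cups. For $a\in I^{\mathrm D}_{n-k,k}$ let $K_a\subseteq\mathcal B^{\mathrm D}_{n-k,k}$ be the set of flags such that: * for each unmarked cup $i<j$: $F_j=x^{-\frac12(j-i+1)}F_{i-1}$; * for each marked cup $i<j$: $F_{i-1}+x^{\frac12(j-i+1)}F_j=F_i$ and $F_j^\perp=x^{-\frac12(n-2j)}F_j$; * if $n-k=k$ and $i$ is on a ray: $F_i=\langle e_1,\dots,e_{\frac12(i-1)},f_1,\dots,f_{\frac12(i+1)}\rangle$ if the ray is marked, and $F_i=\langle e_1,\dots,e_{\frac12(i+1)},f_1,\dots,f_{\frac12(i-1)}\rangle$ if it is unmarked; * if $n-k>k$ and $i$ is on a ray with $c$ cups to its left: $F_i=\langle e_1,\dots,e_{i-c-1},f_1,\dots,f_c,f_{c+1}+e_{i-c}\rangle$ if the ray is marked; $F_i=\langle e_1,\dots,e_{i-c-1},f_1,\dots,f_c,f_{c+1}-e_{i-c}\rangle$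 if it is unmarked and is the rightmost ray; $F_i=\langle e_1,\dots,e_{i-c},f_1,\dots,f_c\rangle$ if it is unmarked and not the rightmost ray. (Here $x^{-s}U$ is the preimage of $U$ under $x^s$.) A variety is an iterated fiber bundle over $\mathbb{CP}^1$ of length $0$ if it is a point, and of length $\ell+1$ if it is the total space of a (Zariski locally trivial) fiber bundle over $\mathbb{CP}^1$ whose typical fiber is an iterated fiber bundle over $\mathbb{CP}^1$ of length $\ell$. Then for every $a\in I^{\mathrm D}_{n-k,k}$ with $\ell$ cups, $K_a$ is a closed subvariety of the flag variety, and it is an iterated fiber bundle over $\mathbb{CP}^1$ of length $\ell$. In particular, it is irreducible and smooth. -/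

import Mathlib

open scoped LinearAlgebra.Projectivization Topology

/-! ### Complex varieties as spaces with functions -/

/-- A *space with functions* over `ℂ` on a set `X`: a topology together with a sheaf of `ℂ`-valued
functions. `reg U f` says that `U` is open and that the restriction of `f` to `U` is a regular
function on `U` (the values of `f` off `U` are irrelevant, see `congr`). The regular functions on
an open set form a `ℂ`-algebra, nonvanishing loci are open and regular functions without zeros
are invertible. Classical complex algebraic varieties are such spaces. -/
structure FunSpace (X : Type*) where
  top : TopologicalSpace X
  reg : Set X → (X → ℂ) → Prop
  isOpen_of_reg : ∀ {U f}, reg U f → IsOpen[top] U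
  congr : ∀ {U f g}, reg U f → Set.EqOn f g U → reg U g
  restrict : ∀ {U W f}, reg U f → IsOpen[top] W → W ⊆ U → reg W f
  glue : ∀ {U f}, (∀ x ∈ U, ∃ W ⊆ U, x ∈ W ∧ reg W f) → reg U f
  const : ∀ {U} (c : ℂ), IsOpen[top] U → reg U (fun _ => c)
  add : ∀ {U f g}, reg U f → reg U g → reg U (fun x => f x + g x)
  mul : ∀ {U f g}, reg U f → reg U g → reg U (fun x => f x * g x)
  isOpen_ne : ∀ {U f}, reg U f → IsOpen[top] (U ∩ {x | f x ≠ 0})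
  inv : ∀ {U f}, reg U f → (∀ x ∈ U, f x ≠ 0) → reg U (fun x => (f x)⁻¹)

namespace FunSpace

/-- Sheafification of a presheaf of functions `P`: the regular functions on an open set `U` are
the functions that locally on `U` belong to `P`. -/
def ofLocal {X : Type*} (T : TopologicalSpace X) (P : Set X → (X → ℂ) → Prop)
    (hopen : ∀ {U f}, P U f → IsOpen[T] U)
    (hcongr : ∀ {U f g}, P U f → Set.EqOn f g U → P U g)
    (hrestrict : ∀ {U W f}, P U f → IsOpen[T] W → W ⊆ U → P W f)
    (hconst : ∀ {U} (c : ℂ), IsOpen[T] U → P U (fun _ => c))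
    (hadd : ∀ {U f g}, P U f → P U g → P U (fun x => f x + g x))
    (hmul : ∀ {U f g}, P U f → P U g → P U (fun x => f x * g x))
    (hne : ∀ {U f}, P U f → IsOpen[T] (U ∩ {x | f x ≠ 0}))
    (hinv : ∀ {U f}, P U f → (∀ x ∈ U, f x ≠ 0) → P U (fun x => (f x)⁻¹)) : FunSpace X where
  top := T
  reg U f := ∀ x ∈ U, ∃ W ⊆ U, x ∈ W ∧ P W f
  isOpen_of_reg {U f} h := by
    refine (@isOpen_iff_forall_mem_open X T _).2 fun x hx => ?_
    obtain ⟨W, hWU, hxW, hW⟩ := h x hx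
    exact ⟨W, hWU, hopen hW, hxW⟩
  congr {U f g} h hfg x hx := by
    obtain ⟨W, hWU, hxW, hW⟩ := h x hx
    exact ⟨W, hWU, hxW, hcongr hW (hfg.mono hWU)⟩
  restrict {U W f} h hW hWU x hx := by
    obtain ⟨W', _, hxW', hW'⟩ := h x (hWU hx)
    exact ⟨W ∩ W', Set.inter_subset_left, ⟨hx, hxW'⟩,
      hrestrict hW' (T.isOpen_inter _ _ hW (hopen hW')) Set.inter_subset_right⟩
  glue {U f} h x hx := by
    obtain ⟨W, hWU, hxW, hW⟩ := h x hx
    obtain ⟨W', hW'W, hxW', hW'⟩ := hW x hxW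
    exact ⟨W', hW'W.trans hWU, hxW', hW'⟩
  const {U} c hU x hx := ⟨U, subset_rfl, hx, hconst c hU⟩
  add {U f g} hf hg x hx := by
    obtain ⟨W, hWU, hxW, hW⟩ := hf x hx
    obtain ⟨W', hW'U, hxW', hW'⟩ := hg x hx
    have ho := T.isOpen_inter _ _ (hopen hW) (hopen hW')
    exact ⟨W ∩ W', Set.inter_subset_left.trans hWU, ⟨hxW, hxW'⟩,
      hadd (hrestrict hW ho Set.inter_subset_left) (hrestrict hW' ho Set.inter_subset_right)⟩
  mul {U f g} hf hg x hx := by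
    obtain ⟨W, hWU, hxW, hW⟩ := hf x hx
    obtain ⟨W', hW'U, hxW', hW'⟩ := hg x hx
    have ho := T.isOpen_inter _ _ (hopen hW) (hopen hW')
    exact ⟨W ∩ W', Set.inter_subset_left.trans hWU, ⟨hxW, hxW'⟩,
      hmul (hrestrict hW ho Set.inter_subset_left) (hrestrict hW' ho Set.inter_subset_right)⟩
  isOpen_ne {U f} h := by
    refine (@isOpen_iff_forall_mem_open X T _).2 fun x hx => ?_
    obtain ⟨W, hWU, hxW, hW⟩ := h x hx.1
    exact ⟨_, Set.inter_subset_inter_left _ hWU, hne hW, hxW, hx.2⟩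
  inv {U f} h h0 x hx := by
    obtain ⟨W, hWU, hxW, hW⟩ := h x hx
    exact ⟨W, hWU, hxW, hinv hW fun y hy => h0 y (hWU hy)⟩

/-- The Zariski topology on `ℂ^ι`; its basic open sets are the nonvanishing loci of polynomials. -/
@[reducible] def zariski (ι : Type*) : TopologicalSpace (ι → ℂ) :=
  TopologicalSpace.generateFrom
    (Set.range fun a : MvPolynomial ι ℂ => {x : ι → ℂ | MvPolynomial.eval x a ≠ 0})

theorem zariski_isOpen_ne {ι : Type*} (a : MvPolynomial ι ℂ) :
    IsOpen[zariski ι] {x : ι → ℂ | MvPolynomial.eval x a ≠ 0} :=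
  TopologicalSpace.isOpen_generateFrom_of_mem ⟨a, rfl⟩

/-- Affine space `ℂ^ι`: the Zariski topology, with the functions that are locally quotients of
polynomials. -/
def affine (ι : Type*) : FunSpace (ι → ℂ) :=
  ofLocal (zariski ι)
    (fun U f => IsOpen[zariski ι] U ∧ ∃ a b : MvPolynomial ι ℂ, ∀ x ∈ U,
      MvPolynomial.eval x b ≠ 0 ∧ f x = MvPolynomial.eval x a / MvPolynomial.eval x b)
    (fun h => h.1)
    (fun {_ _ _} h hfg => by
      obtain ⟨hU, a, b, hab⟩ := h
      exact ⟨hU, a, b, fun x hx => ⟨(hab x hx).1, (hfg hx).symm.trans (hab x hx).2⟩⟩)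
    (fun {_ _ _} h hW hWU => by
      obtain ⟨_, a, b, hab⟩ := h
      exact ⟨hW, a, b, fun x hx => hab x (hWU hx)⟩)
    (fun c hU => ⟨hU, MvPolynomial.C c, 1, fun x _ => by simp⟩)
    (fun {_ _ _} h h' => by
      obtain ⟨hU, a, b, hab⟩ := h
      obtain ⟨_, a', b', hab'⟩ := h'
      refine ⟨hU, a * b' + b * a', b * b', fun x hx => ?_⟩
      obtain ⟨h1, h2⟩ := hab x hx
      obtain ⟨h3, h4⟩ := hab' x hx
      simp only [map_mul, map_add, h2, h4]
      exact ⟨mul_ne_zero h1 h3, div_add_div _ _ h1 h3⟩)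
    (fun {_ _ _} h h' => by
      obtain ⟨hU, a, b, hab⟩ := h
      obtain ⟨_, a', b', hab'⟩ := h'
      refine ⟨hU, a * a', b * b', fun x hx => ?_⟩
      obtain ⟨h1, h2⟩ := hab x hx
      obtain ⟨h3, h4⟩ := hab' x hx
      simp only [map_mul, h2, h4]
      exact ⟨mul_ne_zero h1 h3, div_mul_div_comm _ _ _ _⟩)
    (fun {U f} h => by
      obtain ⟨hU, a, b, hab⟩ := h
      have : U ∩ {x | f x ≠ 0} = U ∩ {x | MvPolynomial.eval x a ≠ 0} := by
        ext x
        refine and_congr_right fun hx => ?_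
        obtain ⟨h1, h2⟩ := hab x hx
        simp [h2, h1]
      rw [this]
      exact (zariski ι).isOpen_inter _ _ hU (zariski_isOpen_ne a))
    (fun {_ _} h h0 => by
      obtain ⟨hU, a, b, hab⟩ := h
      refine ⟨hU, b, a, fun x hx => ?_⟩
      obtain ⟨h1, h2⟩ := hab x hx
      refine ⟨fun ha => h0 x hx (by rw [h2, ha, zero_div]), ?_⟩
      simp only [h2, inv_div])

/-- The structure induced along a map `i : Y → X` (used for inclusions of subsets): the induced
topology, with the functions that are locally restrictions of regular functions of `X`. -/
def induced {X Y : Type*} (S : FunSpace X) (i : Y → X) : FunSpace Y :=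
  ofLocal (S.top.induced i)
    (fun U f => IsOpen[S.top.induced i] U ∧
      ∃ V g, S.reg V g ∧ U ⊆ i ⁻¹' V ∧ ∀ y ∈ U, f y = g (i y))
    (fun h => h.1)
    (fun {_ _ _} h hfg => by
      obtain ⟨hU, V, g, hg, hUV, hfgi⟩ := h
      exact ⟨hU, V, g, hg, hUV, fun y hy => (hfg hy).symm.trans (hfgi y hy)⟩)
    (fun {_ _ _} h hW hWU => by
      obtain ⟨_, V, g, hg, hUV, hfgi⟩ := h
      exact ⟨hW, V, g, hg, hWU.trans hUV, fun y hy => hfgi y (hWU hy)⟩)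
    (fun c hU => ⟨hU, Set.univ, fun _ => c, S.const c (S.top.isOpen_univ),
      fun _ _ => trivial, fun _ _ => rfl⟩)
    (fun {_ _ _} h h' => by
      obtain ⟨hU, V, g, hg, hUV, hfg⟩ := h
      obtain ⟨_, V', g', hg', hUV', hfg'⟩ := h'
      have ho := S.top.isOpen_inter _ _ (S.isOpen_of_reg hg) (S.isOpen_of_reg hg')
      exact ⟨hU, V ∩ V', _, S.add (S.restrict hg ho Set.inter_subset_left)
        (S.restrict hg' ho Set.inter_subset_right), fun y hy => ⟨hUV hy, hUV' hy⟩,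
        fun y hy => by simp only [hfg y hy, hfg' y hy]⟩)
    (fun {_ _ _} h h' => by
      obtain ⟨hU, V, g, hg, hUV, hfg⟩ := h
      obtain ⟨_, V', g', hg', hUV', hfg'⟩ := h'
      have ho := S.top.isOpen_inter _ _ (S.isOpen_of_reg hg) (S.isOpen_of_reg hg')
      exact ⟨hU, V ∩ V', _, S.mul (S.restrict hg ho Set.inter_subset_left)
        (S.restrict hg' ho Set.inter_subset_right), fun y hy => ⟨hUV hy, hUV' hy⟩,
        fun y hy => by simp only [hfg y hy, hfg' y hy]⟩)
    (fun {U f} h => by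
      obtain ⟨hU, V, g, hg, hUV, hfg⟩ := h
      have : U ∩ {y | f y ≠ 0} = U ∩ i ⁻¹' (V ∩ {x | g x ≠ 0}) := by
        ext y
        refine and_congr_right fun hy => ?_
        simp only [Set.mem_ofPred_eq, hfg y hy]
        exact ⟨fun h => ⟨hUV hy, h⟩, fun h => h.2⟩
      rw [this]
      exact (S.top.induced i).isOpen_inter _ _ hU ⟨_, S.isOpen_ne hg, rfl⟩)
    (fun {_ _} h h0 => by
      obtain ⟨hU, V, g, hg, hUV, hfg⟩ := h
      refine ⟨hU, V ∩ {x | g x ≠ 0}, _, S.inv (S.restrict hg (S.isOpen_ne hg)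
        Set.inter_subset_left) (fun x hx => hx.2), fun y hy => ⟨hUV hy, ?_⟩,
        fun y hy => by simp only [hfg y hy]⟩
      have := h0 y hy
      rwa [hfg y hy] at this)

/-- The quotient structure along a map `p : X → Y` (used for surjections): `U ⊆ Y` is open, and
`f` is regular on `U`, if and only if this holds for their pullbacks to `X`. -/
def coinduced {X Y : Type*} (S : FunSpace X) (p : X → Y) : FunSpace Y where
  top := S.top.coinduced p
  reg U f := S.reg (p ⁻¹' U) (f ∘ p)
  isOpen_of_reg h := S.isOpen_of_reg h
  congr h hfg := S.congr h fun _ hx => hfg hx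
  restrict h hW hWU := S.restrict h hW (Set.preimage_mono hWU)
  glue h := S.glue fun x hx => by
    obtain ⟨W, hWU, hxW, hW⟩ := h (p x) hx
    exact ⟨p ⁻¹' W, Set.preimage_mono hWU, hxW, hW⟩
  const c hU := S.const c hU
  add hf hg := S.add hf hg
  mul hf hg := S.mul hf hg
  isOpen_ne h := S.isOpen_ne h
  inv h h0 := S.inv h fun x hx => h0 (p x) hx

/-- The algebra of functions on `X × Y` generated by the regular functions on `U ⊆ X` and on
`V ⊆ Y`: the finite sums `∑ aᵢ(x) bᵢ(y)` on `U × V`. -/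
def tensor {X Y : Type*} (S : FunSpace X) (T : FunSpace Y) (U : Set X) (V : Set Y) :
    Subalgebra ℂ (X × Y → ℂ) :=
  Algebra.adjoin ℂ ({h | ∃ a, S.reg U a ∧ h = fun z => a z.1} ∪
    {h | ∃ b, T.reg V b ∧ h = fun z => b z.2})

/-- The topology of the product variety (finer than the product topology in general): basic open
sets are the nonvanishing loci in `U × V` of the functions `∑ aᵢ(x) bᵢ(y)`. -/
@[reducible] def prodTop {X Y : Type*} (S : FunSpace X) (T : FunSpace Y) : TopologicalSpace (X × Y) :=
  TopologicalSpace.generateFrom {D | ∃ U V, IsOpen[S.top] U ∧ IsOpen[T.top] V ∧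
    ∃ h ∈ tensor S T U V, D = (U ×ˢ V) ∩ {z | h z ≠ 0}}

theorem tensor_mono {X Y : Type*} (S : FunSpace X) (T : FunSpace Y) {U U' : Set X} {V V' : Set Y}
    (hU : IsOpen[S.top] U') (hV : IsOpen[T.top] V') (hUU : U' ⊆ U) (hVV : V' ⊆ V) :
    tensor S T U V ≤ tensor S T U' V' := by
  refine Algebra.adjoin_mono ?_
  rintro h (⟨a, ha, rfl⟩ | ⟨b, hb, rfl⟩)
  · exact Or.inl ⟨a, S.restrict ha hU hUU, rfl⟩
  · exact Or.inr ⟨b, T.restrict hb hV hVV, rfl⟩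

/-- The presheaf of functions on the product: quotients of functions `∑ aᵢ(x) bᵢ(y)`. -/
def ProdFrac {X Y : Type*} (S : FunSpace X) (T : FunSpace Y) (W : Set (X × Y))
    (f : X × Y → ℂ) : Prop :=
  IsOpen[prodTop S T] W ∧ ∃ U V, IsOpen[S.top] U ∧ IsOpen[T.top] V ∧ W ⊆ U ×ˢ V ∧
    ∃ g ∈ tensor S T U V, ∃ h ∈ tensor S T U V, ∀ z ∈ W, h z ≠ 0 ∧ f z = g z / h z

theorem ProdFrac.common {X Y : Type*} {S : FunSpace X} {T : FunSpace Y} {W : Set (X × Y)}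
    {f f' : X × Y → ℂ} (hf : ProdFrac S T W f) (hf' : ProdFrac S T W f') :
    ∃ U V, IsOpen[S.top] U ∧ IsOpen[T.top] V ∧ W ⊆ U ×ˢ V ∧
      (∃ g ∈ tensor S T U V, ∃ h ∈ tensor S T U V, ∀ z ∈ W, h z ≠ 0 ∧ f z = g z / h z) ∧
      (∃ g ∈ tensor S T U V, ∃ h ∈ tensor S T U V, ∀ z ∈ W, h z ≠ 0 ∧ f' z = g z / h z) := by
  obtain ⟨_, U, V, hU, hV, hW, g, hg, h, hh, H⟩ := hf
  obtain ⟨_, U', V', hU', hV', hW', g', hg', h', hh', H'⟩ := hf'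
  have hUU := S.top.isOpen_inter _ _ hU hU'
  have hVV := T.top.isOpen_inter _ _ hV hV'
  have h1 := tensor_mono S T hUU hVV Set.inter_subset_left Set.inter_subset_left
  have h2 := tensor_mono S T hUU hVV Set.inter_subset_right Set.inter_subset_right
  exact ⟨U ∩ U', V ∩ V', hUU, hVV,
    fun z hz => ⟨⟨(hW hz).1, (hW' hz).1⟩, ⟨(hW hz).2, (hW' hz).2⟩⟩,
    ⟨g, h1 hg, h, h1 hh, H⟩, ⟨g', h2 hg', h', h2 hh', H'⟩⟩

/-- The product of two spaces with functions (for varieties: the product variety). Regular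
functions are locally of the form `(∑ aᵢ(x) bᵢ(y)) / (∑ cⱼ(x) dⱼ(y))`. -/
def prod {X Y : Type*} (S : FunSpace X) (T : FunSpace Y) : FunSpace (X × Y) :=
  ofLocal (prodTop S T) (ProdFrac S T)
    (fun h => h.1)
    (fun {_ _ _} h hff => by
      obtain ⟨hW, U, V, hU, hV, hWUV, g, hg, h, hh, H⟩ := h
      exact ⟨hW, U, V, hU, hV, hWUV, g, hg, h, hh,
        fun z hz => ⟨(H z hz).1, (hff hz).symm.trans (H z hz).2⟩⟩)
    (fun {_ _ _} h hW' hWW => by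
      obtain ⟨_, U, V, hU, hV, hWUV, g, hg, h, hh, H⟩ := h
      exact ⟨hW', U, V, hU, hV, hWW.trans hWUV, g, hg, h, hh, fun z hz => H z (hWW hz)⟩)
    (fun c hW => ⟨hW, Set.univ, Set.univ, S.top.isOpen_univ, T.top.isOpen_univ,
      fun _ _ => ⟨trivial, trivial⟩, _, Subalgebra.algebraMap_mem _ c, 1, Subalgebra.one_mem _,
      fun z _ => by simp⟩)
    (fun {_ _ _} hf hf' => by
      obtain ⟨U, V, hU, hV, hW, ⟨g, hg, h, hh, H⟩, ⟨g', hg', h', hh', H'⟩⟩ := hf.common hf'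
      refine ⟨hf.1, U, V, hU, hV, hW, g * h' + h * g', add_mem (mul_mem hg hh') (mul_mem hh hg'),
        h * h', mul_mem hh hh', fun z hz => ?_⟩
      obtain ⟨h1, h2⟩ := H z hz
      obtain ⟨h3, h4⟩ := H' z hz
      simp only [Pi.mul_apply, Pi.add_apply, h2, h4]
      exact ⟨mul_ne_zero h1 h3, div_add_div _ _ h1 h3⟩)
    (fun {_ _ _} hf hf' => by
      obtain ⟨U, V, hU, hV, hW, ⟨g, hg, h, hh, H⟩, ⟨g', hg', h', hh', H'⟩⟩ := hf.common hf'
      refine ⟨hf.1, U, V, hU, hV, hW, g * g', mul_mem hg hg',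
        h * h', mul_mem hh hh', fun z hz => ?_⟩
      obtain ⟨h1, h2⟩ := H z hz
      obtain ⟨h3, h4⟩ := H' z hz
      simp only [Pi.mul_apply, h2, h4]
      exact ⟨mul_ne_zero h1 h3, div_mul_div_comm _ _ _ _⟩)
    (fun {W f} hf => by
      obtain ⟨hW, U, V, hU, hV, hWUV, g, hg, h, hh, H⟩ := hf
      have : W ∩ {z | f z ≠ 0} = W ∩ ((U ×ˢ V) ∩ {z | g z ≠ 0}) := by
        ext z
        refine and_congr_right fun hz => ?_
        obtain ⟨h1, h2⟩ := H z hz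
        have := hWUV hz
        simp only [Set.mem_ofPred_eq, Set.mem_inter_iff, this, true_and, h2, ne_eq, div_eq_zero_iff,
          h1, or_false]
      rw [this]
      exact (prodTop S T).isOpen_inter _ _ hW
        (TopologicalSpace.isOpen_generateFrom_of_mem ⟨U, V, hU, hV, g, hg, rfl⟩))
    (fun {W f} hf h0 => by
      obtain ⟨hW, U, V, hU, hV, hWUV, g, hg, h, hh, H⟩ := hf
      refine ⟨hW, U, V, hU, hV, hWUV, h, hh, g, hg, fun z hz => ?_⟩
      obtain ⟨h1, h2⟩ := H z hz
      refine ⟨fun hg0 => h0 z hz (by rw [h2, hg0, zero_div]), ?_⟩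
      simp only [h2, inv_div])

/-- Morphisms: continuous maps that pull back regular functions to regular functions. -/
def IsMorphism {X Y : Type*} (S : FunSpace X) (T : FunSpace Y) (φ : X → Y) : Prop :=
  @Continuous X Y S.top T.top φ ∧ ∀ V g, T.reg V g → S.reg (φ ⁻¹' V) (g ∘ φ)

/-- Isomorphisms of spaces with functions. -/
def IsIso {X Y : Type*} (S : FunSpace X) (T : FunSpace Y) (e : X ≃ Y) : Prop :=
  IsMorphism S T e ∧ IsMorphism T S e.symm

/-- Smoothness: every point has an open neighbourhood isomorphic to a locally closed subset
`{z ∈ D | f₁ z = ⋯ = f_r z = 0}` of some affine space `ℂ^N`, with `D` Zariski open and with the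
Jacobian matrix of the polynomials `f₁, …, f_r` of rank `r` at every point of the subset. -/
def IsSmooth {X : Type*} (S : FunSpace X) : Prop :=
  ∀ x : X, ∃ U : Set X, IsOpen[S.top] U ∧ x ∈ U ∧
    ∃ (N r : ℕ) (f : Fin r → MvPolynomial (Fin N) ℂ) (D Z : Set (Fin N → ℂ)),
      IsOpen[zariski (Fin N)] D ∧
      Z = D ∩ {z | ∀ i, MvPolynomial.eval z (f i) = 0} ∧
      (∀ z ∈ Z, LinearIndependent ℂ fun (i : Fin r) (j : Fin N) =>
        MvPolynomial.eval z (MvPolynomial.pderiv j (f i))) ∧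
      ∃ e : U ≃ Z, IsIso (S.induced ((↑) : U → X))
        ((affine (Fin N)).induced ((↑) : Z → (Fin N → ℂ))) e

/-- The projective line `ℂP¹`, with the quotient structure from `ℂ² \ {0}`. -/
noncomputable def projLine : FunSpace (ℙ ℂ (Fin 2 → ℂ)) :=
  ((affine (Fin 2)).induced ((↑) : {v : Fin 2 → ℂ // v ≠ 0} → (Fin 2 → ℂ))).coinduced
    (Projectivization.mk' ℂ)

/-- `π : X → B` is a (Zariski) locally trivial fiber bundle with typical fiber `F`. -/
def IsFiberBundle {X B F : Type*} (S : FunSpace X) (SB : FunSpace B) (SF : FunSpace F)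
    (π : X → B) : Prop :=
  IsMorphism S SB π ∧ ∀ b : B, ∃ U : Set B, IsOpen[SB.top] U ∧ b ∈ U ∧
    ∃ e : (π ⁻¹' U : Set X) ≃ U × F,
      IsIso (S.induced ((↑) : (π ⁻¹' U : Set X) → X))
        ((SB.induced ((↑) : U → B)).prod SF) e ∧
      ∀ x : (π ⁻¹' U : Set X), ((e x).1 : B) = π x

/-- Iterated fiber bundles over `ℂP¹` of length `ℓ`: a point for `ℓ = 0`; for `ℓ + 1`, a fiber
bundle over `ℂP¹` whose typical fiber is an iterated fiber bundle over `ℂP¹` of length `ℓ`. -/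
def IsIteratedBundle : ℕ → ∀ {X : Type}, FunSpace X → Prop
  | 0, X, _ => Nonempty (Unique X)
  | ℓ + 1, X, S => ∃ (F : Type) (SF : FunSpace F) (π : X → ℙ ℂ (Fin 2 → ℂ)),
      IsFiberBundle S projLine SF π ∧ IsIteratedBundle ℓ SF

end FunSpace

/-! ### Complete flags -/

/-- Complete flags `0 = F 0 ⊊ F 1 ⊊ ⋯ ⊊ F n = ℂ^ι` where `n = |ι|`; by convention `F i` is the
whole space for `i > n`. -/
@[ext] structure CompleteFlag (ι : Type) [Fintype ι] where
  F : ℕ → Submodule ℂ (ι → ℂ)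
  zero : F 0 = ⊥
  lt_succ : ∀ i < Fintype.card ι, F i < F (i + 1)
  eq_top : ∀ i, Fintype.card ι ≤ i → F i = ⊤

/-- Ordered bases of `ℂ^ι`, i.e. invertible matrices. -/
abbrev Frame (ι : Type) [Fintype ι] : Type :=
  {g : Fin (Fintype.card ι) × ι → ℂ // LinearIndependent ℂ fun j i => g (j, i)}

/-- The flag of a frame: `F i` is the span of the first `i` basis vectors. -/
def Frame.flag {ι : Type} [Fintype ι] (g : Frame ι) : CompleteFlag ι where
  F i := Submodule.span ℂ ((fun j i => g.1 (j, i)) '' {j | j.val < i})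
  zero := by simp
  lt_succ i hi := by
    refine lt_of_le_of_ne (Submodule.span_mono (Set.image_mono fun j hj => ?_)) fun h => ?_
    · exact Nat.lt_succ_of_lt hj
    · have h1 : (fun i' => g.1 (⟨i, hi⟩, i')) ∈ Submodule.span ℂ
          ((fun j i => g.1 (j, i)) '' {j | j.val < i}) := by
        rw [h]
        exact Submodule.subset_span ⟨⟨i, hi⟩, Nat.lt_succ_self i, rfl⟩
      have := g.2.notMem_span_image (s := {j | j.val < i}) (x := ⟨i, hi⟩) (by simp)
      exact this h1
  eq_top i hi := by
    have h1 : {j : Fin (Fintype.card ι) | j.val < i} = Set.univ :=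
      Set.eq_univ_of_forall fun j => j.2.trans_le hi
    rw [h1, Set.image_univ]
    exact g.2.span_eq_top_of_card_eq_finrank' (by simp)

/-- The flag variety: complete flags, with the quotient structure `GL_n / B`. -/
def flagVariety (ι : Type) [Fintype ι] : FunSpace (CompleteFlag ι) :=
  ((FunSpace.affine (Fin (Fintype.card ι) × ι)).induced
    ((↑) : Frame ι → (Fin (Fintype.card ι) × ι → ℂ))).coinduced Frame.flag

/-! ### Two-row Springer fibers of type D

The partition is `λ = (p, k)` with `p = n - k`, so `n = p + k = 2 m`. -/

/-- The partitions `(p, k)`, `p ≥ k > 0`, with `p = k` or with both parts odd. -/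
def IsTypeD (p k : ℕ) : Prop :=
  0 < k ∧ k ≤ p ∧ (p = k ∨ (Odd p ∧ Odd k))

/-- Index set of the basis `e₁, …, e_p, f₁, …, f_k` of `V_λ = ℂ^(Idx p k)`. -/
abbrev Idx (p k : ℕ) : Type := Fin p ⊕ Fin k

/-- The basis vector `e_i` for `1 ≤ i ≤ p` (and zero for other `i`). -/
def eVec (p k i : ℕ) : Idx p k → ℂ
  | .inl j => if j.val + 1 = i then 1 else 0
  | .inr _ => 0

/-- The basis vector `f_i` for `1 ≤ i ≤ k` (and zero for other `i`). -/
def fVec (p k i : ℕ) : Idx p k → ℂ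
  | .inl _ => 0
  | .inr j => if j.val + 1 = i then 1 else 0

/-- The nilpotent endomorphism `e_i ↦ e_{i-1}`, `f_i ↦ f_{i-1}`, where `e_0 = f_0 = 0`. -/
noncomputable def nilp (p k : ℕ) : Module.End ℂ (Idx p k → ℂ) :=
  (Pi.basisFun ℂ (Idx p k)).constr ℂ
    (Sum.elim (fun j => eVec p k j.val) (fun j => fVec p k j.val))

/-- The antidiagonal matrix `J_r` with entries `1, -1, …, (-1)^(r-1)` from the top row down. -/
noncomputable def Jmat (r s : ℕ) : Matrix (Fin r) (Fin s) ℂ :=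
  Matrix.of fun a b => if a.val + b.val + 1 = r then (-1) ^ a.val else 0

/-- The Gram matrix of the symmetric form: blocks `0, J_k, J_kᵗ, 0` if `p = k`, and
`J_p, 0, 0, (-1)^m J_k` if `p > k`, with `m = (p + k) / 2` (with this sign the middle vectors
`f_((k+1)/2) ± e_((p+1)/2)` are isotropic). -/
noncomputable def gram (p k : ℕ) : Matrix (Idx p k) (Idx p k) ℂ :=
  if p = k then Matrix.fromBlocks 0 (Jmat p k) (Jmat p k).transpose 0
  else Matrix.fromBlocks (Jmat p p) 0 0 ((-1 : ℂ) ^ ((p + k) / 2) • Jmat k k)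

/-- The nondegenerate symmetric bilinear form on `V_λ`. -/
noncomputable def form (p k : ℕ) : LinearMap.BilinForm ℂ (Idx p k → ℂ) :=
  Matrix.toBilin' (gram p k)

/-- The Springer fiber: isotropic complete flags with `x F_i ⊆ F_{i-1}` for `1 ≤ i ≤ n`. -/
def springerFiber (p k : ℕ) : Set (CompleteFlag (Idx p k)) :=
  {F | (∀ i ≤ p + k, F.F (p + k - i) = (form p k).orthogonal (F.F i)) ∧
    ∀ i < p + k, (F.F (i + 1)).map (nilp p k) ≤ F.F i}

/-! ### Marked cup diagrams -/

/-- Marked cup diagrams on `m` vertices (numbered `0, …, m - 1` from left to right). The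
involution `σ` sends an endpoint of a cup to the other endpoint and fixes the vertices on rays.
A marked cup is recorded by its left endpoint in `marked`, a marked ray by its vertex. -/
structure MarkedCupDiagram (m : ℕ) where
  σ : Fin m → Fin m
  invol : ∀ i, σ (σ i) = i
  /-- no two cups cross -/
  noncrossing : ∀ i j, i < j → j < σ i → σ j ≤ σ i
  /-- no ray passes through a cup -/
  ray_not_under : ∀ i r, σ r = r → ¬ (i < r ∧ r < σ i)
  marked : Finset (Fin m)
  marked_le : ∀ i ∈ marked, i ≤ σ i
  /-- marked cups and rays are accessible from the right: there is no ray to their right, and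
  they do not lie under a cup -/
  accessible : ∀ i ∈ marked, (∀ r, σ r = r → ¬ σ i < r) ∧ ∀ u, ¬ (u < i ∧ σ i < σ u)

namespace MarkedCupDiagram

/-- The cups, represented by their left endpoints. -/
def cups {m : ℕ} (a : MarkedCupDiagram m) : Finset (Fin m) :=
  Finset.univ.filter fun i => i < a.σ i

/-- The number of cups to the left of the vertex `v`. -/
def cupsLeft {m : ℕ} (a : MarkedCupDiagram m) (v : Fin m) : ℕ :=
  (a.cups.filter fun u => a.σ u < v).card

end MarkedCupDiagram

/-- The set of marked cup diagrams on `m = (p + k) / 2` vertices with `⌊k / 2⌋` cups. -/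
def diagramsD (p k : ℕ) : Set (MarkedCupDiagram ((p + k) / 2)) :=
  {a | a.cups.card = k / 2}

/-- The subspace `⟨e₁, …, e_r, f₁, …, f_s⟩`. -/
def spanEF (p k r s : ℕ) : Submodule ℂ (Idx p k → ℂ) :=
  Submodule.span ℂ ({v | ∃ i, 1 ≤ i ∧ i ≤ r ∧ v = eVec p k i} ∪
    {v | ∃ i, 1 ≤ i ∧ i ≤ s ∧ v = fVec p k i})

/-- The relation imposed by a cup connecting the vertices `i < j` (numbered from `1`). -/
def CupRelation (p k : ℕ) (F : CompleteFlag (Idx p k)) (i j : ℕ) (marked : Prop) : Prop :=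
  (¬ marked → F.F j = (F.F (i - 1)).comap (nilp p k ^ ((j - i + 1) / 2))) ∧
  (marked →
    F.F (i - 1) ⊔ (F.F j).map (nilp p k ^ ((j - i + 1) / 2)) = F.F i ∧
    (form p k).orthogonal (F.F j) = (F.F j).comap (nilp p k ^ ((p + k - 2 * j) / 2)))

/-- The relation imposed by a ray at the vertex `i` (numbered from `1`), where `c` is the number
of cups to its left and `rightmost` says that there is no ray to its right. -/
def RayRelation (p k : ℕ) (F : CompleteFlag (Idx p k)) (i c : ℕ) (marked rightmost : Prop) :
    Prop :=
  (p = k →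
    (marked → F.F i = spanEF p k ((i - 1) / 2) ((i + 1) / 2)) ∧
    (¬ marked → F.F i = spanEF p k ((i + 1) / 2) ((i - 1) / 2))) ∧
  (k < p →
    (marked → F.F i = spanEF p k (i - c - 1) c ⊔
      Submodule.span ℂ {fVec p k (c + 1) + eVec p k (i - c)}) ∧
    (¬ marked → rightmost → F.F i = spanEF p k (i - c - 1) c ⊔
      Submodule.span ℂ {fVec p k (c + 1) - eVec p k (i - c)}) ∧
    (¬ marked → ¬ rightmost → F.F i = spanEF p k (i - c) c))

/-- The subset `K_a` of the Springer fiber attached to a marked cup diagram `a`. -/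
def K (p k : ℕ) (a : MarkedCupDiagram ((p + k) / 2)) : Set (CompleteFlag (Idx p k)) :=
  {F | F ∈ springerFiber p k ∧
    (∀ v, v < a.σ v → CupRelation p k F (v.val + 1) ((a.σ v).val + 1) (v ∈ a.marked)) ∧
    ∀ v, a.σ v = v → RayRelation p k F (v.val + 1) (a.cupsLeft v) (v ∈ a.marked)
      (∀ r, a.σ r = r → r ≤ v)}

/-- `K_a` as a subvariety of the flag variety. -/
def KSpace (p k : ℕ) (a : MarkedCupDiagram ((p + k) / 2)) : FunSpace (K p k a) :=
  (flagVariety (Idx p k)).induced ((↑) : K p k a → CompleteFlag (Idx p k))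

/-! Write `m = (p + k) / 2`, `x = nilp p k`, and call a subspace `U` of dimension `l ≤ m` good if
`U^⊥ = x^{-(m-l)} U`. The variety `K_a` is analysed by fixing the subspaces of a flag one at a time.
For a base point `P ∈ K_a` let `S_v` (`stratum a P v`) be the set of flags in `K_a` that agree with
`P` in the steps up to `v`. Then `S_0 = K_a`, and `S_m = {P}` because an isotropic flag is
determined by its lower half.

If the vertex `v` (numbered from `0`) is on a ray or is the right end of a cup, its relation
determines `F_{v+1}` from the earlier steps, so `S_{v+1} = S_v` (`stratum_succ_eq`). If `v` is the
left end of a cup, then `F ↦ F_{v+1}/P_v`, a line in the plane `x^{-1}P_v/P_v`, is a morphism `S_v →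
ℂP¹`. Its fibre over the line of `P` is `S_{v+1}`. So each cup contributes one `ℂP¹`
(`isIteratedBundle_stratum`).

Local triviality comes from symmetry (`isFiberBundle_of_transvections`): it suffices to lift the two
groups of transvections of `ℂ²` to `S_v`. For a suitable `r` the quotient `x^{-r}P_v/P_v` is `ℂ² ⊗
ℂ[x]/(x^r)`, so transvections extend to maps `1 + cη` that commute with `x` modulo `P_v`
(`JordanPair.exists_transvections`). At an unmarked cup, `r` is half its length and `x^{-r}P_v` is
the subspace at its right end; everything outside the cup stays fixed. At a marked cup, `r = m - v`
and `x^{-r}P_v = P_v^⊥`, so the form has to be preserved as well. For suitably chosen generators it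
is a tensor product of two alternating forms, on which `SL₂` acts by isometries. That these maps
preserve all relations is `ShearData.mem_stratum_of_eq_map`.

Two facts about marked cups carry the rest. The subspace in front of a marked cup is good
(`RelationsUpTo.good`). Over a good subspace the relation of a marked cup, which looks quadratic, is
linear: it puts the subspace at the right end equal to an explicit `markedSpace` (`le_markedSpace`,
`finrank_markedSpace_le`). This yields both the uniqueness at right ends (`isRight_eq`) and the
closedness of `K_a` (`isClosed_K`).

The base point (`exists_mem_K`) is a coordinate flag up to the rightmost ray and is built beyond it
from two Jordan chains that are isotropic except for their pairing with each other. Irreducibility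
and smoothness pass from fibre to total space (`Irred.of_isFiberBundle`,
`LocallyAffine.of_isFiberBundle`). Regularity of maps into the flag variety is always checked on
local frames, available by `exists_local_frame`. -/

/-! ### Morphisms of spaces with functions -/

namespace FunSpace

section Basic

variable {X Y Z : Type*}

/-- The map `φ` restricts to a morphism on the open set `W`. -/
structure MorOn (S : FunSpace X) (T : FunSpace Y) (W : Set X) (φ : X → Y) : Prop where
  isOpen : IsOpen[S.top] W
  preimage : ∀ V, IsOpen[T.top] V → IsOpen[S.top] (W ∩ φ ⁻¹' V)
  reg : ∀ V g, T.reg V g → S.reg (W ∩ φ ⁻¹' V) (g ∘ φ)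

variable {S : FunSpace X} {T : FunSpace Y} {R : FunSpace Z}

theorem isOpen_inter {U W : Set X} (hU : IsOpen[S.top] U) (hW : IsOpen[S.top] W) :
    IsOpen[S.top] (U ∩ W) := S.top.isOpen_inter _ _ hU hW

theorem isOpen_of_local {U : Set X} (h : ∀ x ∈ U, ∃ W ⊆ U, x ∈ W ∧ IsOpen[S.top] W) :
    IsOpen[S.top] U := by
  refine (@isOpen_iff_forall_mem_open X S.top U).2 fun x hx => ?_
  obtain ⟨W, h1, h2, h3⟩ := h x hx
  exact ⟨W, h1, h3, h2⟩

theorem morOn_univ {φ : X → Y} : MorOn S T Set.univ φ ↔ IsMorphism S T φ := by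
  constructor
  · intro h
    refine ⟨(@continuous_def X Y S.top T.top φ).2 fun V hV => ?_, fun V g hg => ?_⟩
    · simpa using h.preimage V hV
    · simpa using h.reg V g hg
  · intro h
    refine ⟨S.top.isOpen_univ, fun V hV => ?_, fun V g hg => ?_⟩
    · simpa using (@continuous_def X Y S.top T.top φ).1 h.1 V hV
    · simpa using h.2 V g hg

theorem IsMorphism.isOpen_preimage {φ : X → Y} (h : IsMorphism S T φ) {V : Set Y}
    (hV : IsOpen[T.top] V) : IsOpen[S.top] (φ ⁻¹' V) :=
  (@continuous_def X Y S.top T.top φ).1 h.1 V hV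

theorem isMorphism_id : IsMorphism S S id :=
  ⟨@continuous_id X S.top, fun _ _ h => h⟩

theorem IsMorphism.comp {φ : X → Y} {ψ : Y → Z} (hψ : IsMorphism T R ψ) (hφ : IsMorphism S T φ) :
    IsMorphism S R (ψ ∘ φ) :=
  ⟨@Continuous.comp X Y Z S.top T.top R.top _ _ hψ.1 hφ.1,
    fun V g hg => hφ.2 _ _ (hψ.2 V g hg)⟩

theorem MorOn.mono {W W' : Set X} {φ : X → Y} (h : MorOn S T W φ) (hW : IsOpen[S.top] W')
    (hWW : W' ⊆ W) : MorOn S T W' φ := by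
  have key : ∀ V : Set Y, W' ∩ φ ⁻¹' V = W' ∩ (W ∩ φ ⁻¹' V) := fun V => by
    rw [← Set.inter_assoc, Set.inter_eq_left.2 hWW]
  have h1 : ∀ V, IsOpen[S.top] (W ∩ φ ⁻¹' V) → IsOpen[S.top] (W' ∩ φ ⁻¹' V) := fun V hV => by
    rw [key]
    exact isOpen_inter hW hV
  refine ⟨hW, fun V hV => h1 V (h.preimage V hV), fun V g hg => ?_⟩
  exact S.restrict (h.reg V g hg) (h1 V (S.isOpen_of_reg (h.reg V g hg)))
    (Set.inter_subset_inter_left _ hWW)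

theorem MorOn.of_local {W : Set X} {φ : X → Y} (h : ∀ x ∈ W, ∃ W' ⊆ W, x ∈ W' ∧ MorOn S T W' φ) :
    MorOn S T W φ := by
  refine ⟨isOpen_of_local fun x hx => ?_, fun V hV => isOpen_of_local fun x hx => ?_,
    fun V g hg => S.glue fun x hx => ?_⟩
  · obtain ⟨W', h1, h2, h3⟩ := h x hx
    exact ⟨W', h1, h2, h3.isOpen⟩
  · obtain ⟨W', h1, h2, h3⟩ := h x hx.1
    exact ⟨_, Set.inter_subset_inter_left _ h1, ⟨h2, hx.2⟩, h3.preimage V hV⟩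
  · obtain ⟨W', h1, h2, h3⟩ := h x hx.1
    exact ⟨_, Set.inter_subset_inter_left _ h1, ⟨h2, hx.2⟩, h3.reg V g hg⟩

theorem MorOn.comp {W : Set X} {W' : Set Y} {φ : X → Y} {ψ : Y → Z} (hψ : MorOn T R W' ψ)
    (hφ : MorOn S T W φ) : MorOn S R (W ∩ φ ⁻¹' W') (ψ ∘ φ) := by
  have key : ∀ V : Set Z, W ∩ φ ⁻¹' W' ∩ ψ ∘ φ ⁻¹' V = W ∩ φ ⁻¹' (W' ∩ ψ ⁻¹' V) := fun V => by
    rw [Set.preimage_inter, Set.inter_assoc]; rfl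
  refine ⟨hφ.preimage _ hψ.isOpen, fun V hV => ?_, fun V g hg => ?_⟩
  · rw [key]
    exact hφ.preimage _ (hψ.preimage V hV)
  · rw [key]
    exact hφ.reg _ _ (hψ.reg V g hg)

theorem isMorphism_induced (S : FunSpace X) (i : Y → X) : IsMorphism (S.induced i) S i := by
  have h0 : ∀ V, IsOpen[S.top] V → IsOpen[(S.induced i).top] (i ⁻¹' V) := fun V hV => ⟨V, hV, rfl⟩
  refine ⟨(@continuous_def Y X (S.induced i).top S.top i).2 h0, fun V g hg x hx => ?_⟩
  exact ⟨_, subset_rfl, hx, h0 V (S.isOpen_of_reg hg), V, g, hg, subset_rfl, fun _ _ => rfl⟩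

/-- The universal property of the induced structure: a map into a subvariety is a morphism as soon
as it is one into the ambient variety. -/
theorem IsMorphism.induced_lift {i : Y → X} {f : Z → Y} (h : IsMorphism R S (i ∘ f)) :
    IsMorphism R (S.induced i) f := by
  have h0 : ∀ V, IsOpen[(S.induced i).top] V → IsOpen[R.top] (f ⁻¹' V) := by
    rintro V ⟨O, hO, rfl⟩
    exact h.isOpen_preimage hO
  refine ⟨(@continuous_def Z Y R.top (S.induced i).top f).2 h0, fun V g hg => R.glue fun z hz => ?_⟩
  obtain ⟨W, hWV, hzW, hW, V', g', hg', hWV', hgg⟩ := hg (f z) hz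
  refine ⟨f ⁻¹' W, Set.preimage_mono hWV, hzW, ?_⟩
  refine R.congr (R.restrict (h.2 V' g' hg') (h0 W hW) fun y hy => hWV' hy) fun y hy => ?_
  exact (hgg (f y) hy).symm

theorem MorOn.subtype {W : Set X} {φ : X → Y} (h : MorOn S T W φ) :
    IsMorphism (S.induced ((↑) : W → X)) T (φ ∘ (↑)) := by
  have := h.comp (morOn_univ.2 (isMorphism_induced S ((↑) : W → X)))
  rw [← morOn_univ]
  convert this using 1
  ext x
  simp

theorem isOpen_image_val {W : Set X} (hW : IsOpen[S.top] W) {U : Set W}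
    (hU : IsOpen[(S.induced ((↑) : W → X)).top] U) : IsOpen[S.top] ((↑) '' U : Set X) := by
  obtain ⟨O, hO, rfl⟩ := hU
  rw [Subtype.image_preimage_coe]
  exact isOpen_inter hW hO

theorem morOn_of_subtype {W : Set X} (hW : IsOpen[S.top] W) {φ : X → Y}
    (h : IsMorphism (S.induced ((↑) : W → X)) T (φ ∘ (↑))) : MorOn S T W φ := by
  have key : ∀ V : Set Y, W ∩ φ ⁻¹' V = (↑) '' ((φ ∘ (↑) : W → Y) ⁻¹' V) := fun V => by
    ext x
    simp [and_comm]
  refine ⟨hW, fun V hV => ?_, fun V g hg => ?_⟩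
  · rw [key]
    exact isOpen_image_val hW (h.isOpen_preimage hV)
  · rw [key]
    refine S.glue ?_
    rintro _ ⟨x, hx, rfl⟩
    obtain ⟨U, hUV, hxU, hU, V', g', hg', hUV', hgg⟩ := h.2 V g hg x hx
    refine ⟨_, Set.image_mono hUV, Set.mem_image_of_mem _ hxU, ?_⟩
    have ho := isOpen_image_val hW hU
    refine S.congr (S.restrict hg' ho ?_) ?_
    · rintro _ ⟨y, hy, rfl⟩
      exact hUV' hy
    · rintro _ ⟨y, hy, rfl⟩
      exact (hgg y hy).symm

theorem isMorphism_const (y : Y) : IsMorphism S T fun _ => y := by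
  refine ⟨@continuous_const X Y S.top T.top y, fun V g _ => ?_⟩
  refine S.const (g y) ?_
  by_cases hy : y ∈ V
  · rw [Set.preimage_const_of_mem hy]
    exact S.top.isOpen_univ
  · rw [Set.preimage_const_of_notMem hy]
    exact @isOpen_empty X S.top

/-! ### Regular functions -/

theorem reg_sum {ι : Type*} (s : Finset ι) {U : Set X} (hU : IsOpen[S.top] U) {f : ι → X → ℂ}
    (h : ∀ i ∈ s, S.reg U (f i)) : S.reg U fun x => ∑ i ∈ s, f i x := by
  classical
  induction s using Finset.induction_on with
  | empty => simpa using S.const 0 hU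
  | insert a s ha ih =>
    simp only [Finset.sum_insert ha]
    exact S.add (h a (Finset.mem_insert_self a s)) (ih fun i hi => h i (Finset.mem_insert_of_mem hi))

theorem reg_prod {ι : Type*} (s : Finset ι) {U : Set X} (hU : IsOpen[S.top] U) {f : ι → X → ℂ}
    (h : ∀ i ∈ s, S.reg U (f i)) : S.reg U fun x => ∏ i ∈ s, f i x := by
  classical
  induction s using Finset.induction_on with
  | empty => simpa using S.const 1 hU
  | insert a s ha ih =>
    simp only [Finset.prod_insert ha]
    exact S.mul (h a (Finset.mem_insert_self a s)) (ih fun i hi => h i (Finset.mem_insert_of_mem hi))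

theorem reg_const_mul {U : Set X} {f : X → ℂ} (c : ℂ) (hf : S.reg U f) :
    S.reg U fun x => c * f x := S.mul (S.const c (S.isOpen_of_reg hf)) hf

theorem reg_neg {U : Set X} {f : X → ℂ} (hf : S.reg U f) : S.reg U fun x => - f x := by
  simpa using reg_const_mul (-1) hf

theorem reg_sub {U : Set X} {f g : X → ℂ} (hf : S.reg U f) (hg : S.reg U g) :
    S.reg U fun x => f x - g x := by
  simpa [sub_eq_add_neg] using S.add hf (reg_neg hg)

theorem reg_div {U : Set X} {f g : X → ℂ} (hf : S.reg U f) (hg : S.reg U g)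
    (h0 : ∀ x ∈ U, g x ≠ 0) : S.reg U fun x => f x / g x := by
  simpa [div_eq_mul_inv] using S.mul hf (S.inv hg h0)

theorem isOpen_eq_zero_compl {f : X → ℂ} (hf : S.reg Set.univ f) :
    IsOpen[S.top] {x | f x ≠ 0} := by
  simpa using S.isOpen_ne hf

theorem isClosed_eq_zero {f : X → ℂ} (hf : S.reg Set.univ f) :
    IsClosed[S.top] {x | f x = 0} := by
  refine (@isOpen_compl_iff X _ S.top).1 ?_
  exact isOpen_eq_zero_compl hf

theorem reg_det {n : Type*} [Fintype n] [DecidableEq n] {U : Set X} (hU : IsOpen[S.top] U)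
    {A : X → Matrix n n ℂ} (h : ∀ i j, S.reg U fun x => A x i j) :
    S.reg U fun x => (A x).det := by
  simp only [Matrix.det_apply']
  exact reg_sum _ hU fun σ _ => reg_const_mul _ (reg_prod _ hU fun i _ => h _ _)

theorem reg_inv_matrix {n : Type*} [Fintype n] [DecidableEq n] {U : Set X}
    (hU : IsOpen[S.top] U) {A : X → Matrix n n ℂ} (h : ∀ i j, S.reg U fun x => A x i j)
    (h0 : ∀ x ∈ U, (A x).det ≠ 0) (i j : n) : S.reg U fun x => (A x)⁻¹ i j := by
  have h1 : ∀ x, (A x)⁻¹ i j = ((A x).det)⁻¹ * (A x).adjugate i j := fun x => by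
    simp [Matrix.inv_def]
  simp only [h1]
  refine S.mul (S.inv (reg_det hU h) h0) ?_
  simp only [Matrix.adjugate_apply]
  refine reg_det hU fun a b => ?_
  by_cases hab : a = j
  · subst hab
    simpa using S.const _ hU
  · simpa [Matrix.updateRow_ne hab] using h a b

theorem IsMorphism.reg_comp {φ : X → Y} (h : IsMorphism S T φ) {g : Y → ℂ}
    (hg : T.reg Set.univ g) : S.reg Set.univ (g ∘ φ) := by
  simpa using h.2 _ _ hg

/-! ### Affine space -/

theorem affine_coord {ι : Type*} (i : ι) : (affine ι).reg Set.univ fun x => x i := by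
  intro x _
  exact ⟨Set.univ, subset_rfl, trivial, (zariski ι).isOpen_univ, MvPolynomial.X i, 1,
    fun y _ => by simp⟩

theorem reg_eval {ι : Type*} {U : Set X} (hU : IsOpen[S.top] U) {f : X → ι → ℂ}
    (h : ∀ i, S.reg U fun x => f x i) (a : MvPolynomial ι ℂ) :
    S.reg U fun x => MvPolynomial.eval (f x) a := by
  induction a using MvPolynomial.induction_on with
  | C c => simpa using S.const c hU
  | add a b ha hb => simpa using S.add ha hb
  | mul_X a i ha => simpa using S.mul ha (h i)

/-- Preimages of basic open sets are nonvanishing loci of regular functions, hence open, and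
quotients of polynomials pull back to quotients of regular functions. -/
theorem morOn_affine {ι : Type*} {U : Set X} (hU : IsOpen[S.top] U) {f : X → ι → ℂ}
    (h : ∀ i, S.reg U fun x => f x i) : MorOn S (affine ι) U f := by
  have h0 : ∀ V, IsOpen[(affine ι).top] V → IsOpen[S.top] (U ∩ f ⁻¹' V) := by
    intro V hV
    change TopologicalSpace.GenerateOpen _ V at hV
    induction hV with
    | basic s hs =>
      obtain ⟨a, rfl⟩ := hs
      exact S.isOpen_ne (reg_eval hU h a)
    | univ => simpa using hU
    | inter s t _ _ hs ht =>
      rw [Set.preimage_inter, Set.inter_inter_distrib_left]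
      exact isOpen_inter hs ht
    | sUnion K _ ih =>
      rw [Set.sUnion_eq_biUnion, Set.preimage_iUnion₂, Set.inter_iUnion₂]
      exact @isOpen_biUnion X _ S.top _ _ ih
  refine ⟨hU, h0, fun V g hg => S.glue fun x hx => ?_⟩
  obtain ⟨W, hWV, hxW, hW, a, b, hab⟩ := hg (f x) hx.2
  refine ⟨U ∩ f ⁻¹' W, Set.inter_subset_inter_right _ (Set.preimage_mono hWV), ⟨hx.1, hxW⟩, ?_⟩
  have ho := h0 W hW
  have h1 := fun c => S.restrict (reg_eval hU h c) ho Set.inter_subset_left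
  refine S.congr (reg_div (h1 a) (h1 b) fun y hy => (hab _ hy.2).1) fun y hy => ?_
  exact (hab _ hy.2).2.symm

theorem isMorphism_affine {ι : Type*} {f : X → ι → ℂ}
    (h : ∀ i, S.reg Set.univ fun x => f x i) : IsMorphism S (affine ι) f :=
  morOn_univ.1 (morOn_affine S.top.isOpen_univ h)

/-! ### Products -/

theorem isMorphism_fst (S : FunSpace X) (T : FunSpace Y) :
    IsMorphism (S.prod T) S Prod.fst := by
  have h0 : ∀ V, IsOpen[S.top] V → IsOpen[(S.prod T).top] (Prod.fst ⁻¹' V) := fun V hV =>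
    TopologicalSpace.isOpen_generateFrom_of_mem ⟨V, Set.univ, hV, T.top.isOpen_univ, 1,
      one_mem _, by ext; simp⟩
  refine ⟨(@continuous_def _ _ (S.prod T).top S.top _).2 h0, fun V g hg z hz => ?_⟩
  refine ⟨_, subset_rfl, hz, h0 V (S.isOpen_of_reg hg), V, Set.univ, S.isOpen_of_reg hg,
    T.top.isOpen_univ, fun y hy => ⟨hy, trivial⟩, fun z => g z.1,
    Algebra.subset_adjoin (Or.inl ⟨g, hg, rfl⟩), 1, one_mem _, fun y _ => by simp⟩

theorem isMorphism_snd (S : FunSpace X) (T : FunSpace Y) :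
    IsMorphism (S.prod T) T Prod.snd := by
  have h0 : ∀ V, IsOpen[T.top] V → IsOpen[(S.prod T).top] (Prod.snd ⁻¹' V) := fun V hV =>
    TopologicalSpace.isOpen_generateFrom_of_mem ⟨Set.univ, V, S.top.isOpen_univ, hV, 1,
      one_mem _, by ext; simp⟩
  refine ⟨(@continuous_def _ _ (S.prod T).top T.top _).2 h0, fun V g hg z hz => ?_⟩
  refine ⟨_, subset_rfl, hz, h0 V (T.isOpen_of_reg hg), Set.univ, V, S.top.isOpen_univ,
    T.isOpen_of_reg hg, fun y hy => ⟨trivial, hy⟩, fun z => g z.2,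
    Algebra.subset_adjoin (Or.inr ⟨g, hg, rfl⟩), 1, one_mem _, fun y _ => by simp⟩

theorem reg_tensor {f : Z → X} {g : Z → Y} (hf : IsMorphism R S f) (hg : IsMorphism R T g)
    {U : Set X} {V : Set Y} (hU : IsOpen[S.top] U) (hV : IsOpen[T.top] V) {h : X × Y → ℂ}
    (hh : h ∈ tensor S T U V) : R.reg (f ⁻¹' U ∩ g ⁻¹' V) fun z => h (f z, g z) := by
  have ho := isOpen_inter (hf.isOpen_preimage hU) (hg.isOpen_preimage hV)
  induction hh using Algebra.adjoin_induction with
  | mem h hh =>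
    rcases hh with ⟨a, ha, rfl⟩ | ⟨b, hb, rfl⟩
    · exact R.restrict (hf.2 _ _ ha) ho Set.inter_subset_left
    · exact R.restrict (hg.2 _ _ hb) ho Set.inter_subset_right
  | algebraMap c => exact R.const c ho
  | add a b _ _ ha hb => exact R.add ha hb
  | mul a b _ _ ha hb => exact R.mul ha hb

/-- The universal property of the product variety. Continuity needs more than that of the
components, because basic open sets are nonvanishing loci of sums `∑ aᵢ(x) bᵢ(y)`. -/
theorem IsMorphism.prodMk {f : Z → X} {g : Z → Y} (hf : IsMorphism R S f)
    (hg : IsMorphism R T g) : IsMorphism R (S.prod T) fun z => (f z, g z) := by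
  have h0 : @Continuous _ _ R.top (S.prod T).top fun z => (f z, g z) := by
    refine (@continuous_generateFrom_iff _ _ _ R.top _).2 ?_
    rintro _ ⟨U, V, hU, hV, h, hh, rfl⟩
    exact R.isOpen_ne (reg_tensor hf hg hU hV hh)
  refine ⟨h0, fun O q hq => R.glue fun z hz => ?_⟩
  obtain ⟨W, hWO, hzW, hW, U, V, hU, hV, hWUV, a, ha, b, hb, hab⟩ := hq _ hz
  have hW' := (@continuous_def _ _ R.top (S.prod T).top _).1 h0 W hW
  have hsub : (fun z => (f z, g z)) ⁻¹' W ⊆ f ⁻¹' U ∩ g ⁻¹' V := fun y hy => hWUV hy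
  refine ⟨_, Set.preimage_mono hWO, hzW, ?_⟩
  refine R.congr (reg_div (R.restrict (reg_tensor hf hg hU hV ha) hW' hsub)
    (R.restrict (reg_tensor hf hg hU hV hb) hW' hsub) fun y hy => (hab _ hy).1) fun y hy => ?_
  exact (hab _ hy).2.symm

end Basic

end FunSpace

/-! ### Morphisms into quotient structures -/

namespace FunSpace

theorem isMorphism_coinduced {X Y : Type*} (S : FunSpace X) (p : X → Y) :
    IsMorphism S (S.coinduced p) p :=
  ⟨(@continuous_def X Y S.top (S.coinduced p).top p).2 fun _ h => h, fun _ _ h => h⟩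

/-- A map that locally lifts through the quotient map of a coinduced structure, after embedding
the source of the quotient map into an affine space, is a morphism. -/
theorem isMorphism_coinduced_of_local_lift {Z A Y ι : Type*} {R : FunSpace Z} (i : A → ι → ℂ)
    (p : A → Y) {f : Z → Y}
    (h : ∀ z, ∃ W : Set Z, IsOpen[R.top] W ∧ z ∈ W ∧ ∃ w : Z → ι → ℂ,
      (∀ j, R.reg W fun z => w z j) ∧ ∀ z ∈ W, ∃ a : A, i a = w z ∧ p a = f z) :
    IsMorphism R (((affine ι).induced i).coinduced p) f := by
  refine morOn_univ.1 (MorOn.of_local fun z _ => ?_)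
  obtain ⟨W, hW, hz, w, hw, hl⟩ := h z
  refine ⟨W, Set.subset_univ _, hz, morOn_of_subtype hW ?_⟩
  choose g hg1 hg2 using fun z : W => hl z z.2
  have h1 : IsMorphism (R.induced ((↑) : W → Z)) ((affine ι).induced i) g := by
    refine IsMorphism.induced_lift ?_
    have h2 : i ∘ g = w ∘ (↑) := funext fun z => hg1 z
    rw [h2]
    exact (morOn_affine hW hw).subtype
  have h3 : f ∘ (↑) = p ∘ g := funext fun z => (hg2 z).symm
  rw [h3]
  exact (isMorphism_coinduced _ p).comp h1

/-! ### The projective line -/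

theorem isMorphism_projLine {Z : Type*} {R : FunSpace Z} {f : Z → ℙ ℂ (Fin 2 → ℂ)}
    (h : ∀ z, ∃ W : Set Z, IsOpen[R.top] W ∧ z ∈ W ∧ ∃ w : Z → Fin 2 → ℂ,
      (∀ j, R.reg W fun z => w z j) ∧ ∀ z ∈ W, ∃ h0 : w z ≠ 0, f z = Projectivization.mk ℂ (w z) h0) :
    IsMorphism R projLine f := by
  refine isMorphism_coinduced_of_local_lift _ _ fun z => ?_
  obtain ⟨W, hW, hz, w, hw, hl⟩ := h z
  refine ⟨W, hW, hz, w, hw, fun z hz => ?_⟩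
  obtain ⟨h0, h1⟩ := hl z hz
  exact ⟨⟨w z, h0⟩, rfl, h1.symm⟩

/-- The affine chart of the projective line where the `i`-th homogeneous coordinate is nonzero. -/
def projChart (i : Fin 2) : Set (ℙ ℂ (Fin 2 → ℂ)) := {P | P.rep i ≠ 0}

/-- The affine coordinate on `projChart i`. -/
noncomputable def projCoord (i : Fin 2) (P : ℙ ℂ (Fin 2 → ℂ)) : ℂ := P.rep (1 - i) / P.rep i

theorem mk_mem_projChart {i : Fin 2} {v : Fin 2 → ℂ} (hv : v ≠ 0) :
    Projectivization.mk ℂ v hv ∈ projChart i ↔ v i ≠ 0 := by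
  obtain ⟨a, ha⟩ := Projectivization.exists_smul_eq_mk_rep ℂ v hv
  simp [projChart, ← ha, Units.smul_def]

theorem projCoord_mk (i : Fin 2) {v : Fin 2 → ℂ} (hv : v ≠ 0) :
    projCoord i (Projectivization.mk ℂ v hv) = v (1 - i) / v i := by
  obtain ⟨a, ha⟩ := Projectivization.exists_smul_eq_mk_rep ℂ v hv
  simp [projCoord, ← ha, Units.smul_def, mul_div_mul_left]

theorem reg_coord_proj (j : Fin 2) :
    ((affine (Fin 2)).induced ((↑) : {v : Fin 2 → ℂ // v ≠ 0} → (Fin 2 → ℂ))).reg Set.univ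
      fun v => v.1 j :=
  (isMorphism_induced _ _).reg_comp (affine_coord j)

theorem isOpen_projChart (i : Fin 2) : IsOpen[projLine.top] (projChart i) := by
  have h : IsOpen[((affine (Fin 2)).induced
      ((↑) : {v : Fin 2 → ℂ // v ≠ 0} → (Fin 2 → ℂ))).top]
      (Projectivization.mk' ℂ ⁻¹' projChart i) := by
    convert isOpen_eq_zero_compl (reg_coord_proj i) using 1
    ext v
    exact mk_mem_projChart v.2
  exact h

theorem reg_projCoord (i : Fin 2) : projLine.reg (projChart i) (projCoord i) := by
  have h : ((affine (Fin 2)).induced ((↑) : {v : Fin 2 → ℂ // v ≠ 0} → (Fin 2 → ℂ))).reg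
      (Projectivization.mk' ℂ ⁻¹' projChart i) (projCoord i ∘ Projectivization.mk' ℂ) := by
    have ho := isOpen_projChart i
    refine FunSpace.congr _ (reg_div (FunSpace.restrict _ (reg_coord_proj (1 - i)) ho
      (Set.subset_univ _)) (FunSpace.restrict _ (reg_coord_proj i) ho (Set.subset_univ _))
      fun v hv => (mk_mem_projChart v.2).1 hv) fun v _ => ?_
    exact (projCoord_mk i v.2).symm
  exact h

theorem exists_mem_projChart (P : ℙ ℂ (Fin 2 → ℂ)) : ∃ i, P ∈ projChart i := by
  by_contra! h
  exact P.rep_nonzero (funext fun i => not_not.1 (h i))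

/-- The vector in `ℂ²` with `i`-th coordinate `1` and other coordinate `t`. -/
noncomputable def chartVec (i : Fin 2) (t : ℂ) : Fin 2 → ℂ := fun j => if j = i then 1 else t

theorem chartVec_ne_zero (i : Fin 2) (t : ℂ) : chartVec i t ≠ 0 := fun h => by
  have := congrFun h i
  simp [chartVec] at this

/-- The point of `projChart i` with affine coordinate `t`. -/
noncomputable def projPoint (i : Fin 2) (t : ℂ) : ℙ ℂ (Fin 2 → ℂ) :=
  Projectivization.mk ℂ (chartVec i t) (chartVec_ne_zero i t)

theorem projPoint_mem (i : Fin 2) (t : ℂ) : projPoint i t ∈ projChart i :=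
  (mk_mem_projChart _).2 (by simp [chartVec])

theorem projCoord_projPoint (i : Fin 2) (t : ℂ) : projCoord i (projPoint i t) = t := by
  rw [projPoint, projCoord_mk]
  fin_cases i <;> simp [chartVec]

theorem projPoint_projCoord {i : Fin 2} {P : ℙ ℂ (Fin 2 → ℂ)} (h : P ∈ projChart i) :
    projPoint i (projCoord i P) = P := by
  conv_rhs => rw [← P.mk_rep]
  rw [projPoint, Projectivization.mk_eq_mk_iff']
  have h' : P.rep i ≠ 0 := h
  refine ⟨(P.rep i)⁻¹, funext fun j => ?_⟩
  by_cases hj : j = i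
  · subst hj
    simp [chartVec, h']
  · have aux : ∀ i j : Fin 2, j ≠ i → j = 1 - i := by decide
    have := aux i j hj
    subst this
    simp [chartVec, hj, projCoord, div_eq_inv_mul]

theorem isMorphism_projPoint (i : Fin 2) :
    IsMorphism (affine (Fin 1)) projLine fun z => projPoint i (z 0) := by
  refine isMorphism_projLine fun z => ⟨Set.univ, (affine (Fin 1)).top.isOpen_univ, trivial,
    fun z => chartVec i (z 0), fun j => ?_, fun z _ => ⟨chartVec_ne_zero _ _, rfl⟩⟩
  by_cases hj : j = i
  · simpa [chartVec, hj] using FunSpace.const _ 1 (affine (Fin 1)).top.isOpen_univ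
  · simpa [chartVec, hj] using affine_coord (0 : Fin 1)

/-! ### Irreducibility of affine space and of the projective line -/

/-- Nonvanishing loci of polynomials are stable under finite intersection (take products), so they
form a basis and not just a subbasis. -/
theorem exists_basic_zariski {ι : Type*} {U : Set (ι → ℂ)} (hU : IsOpen[zariski ι] U) {x : ι → ℂ}
    (hx : x ∈ U) : ∃ a : MvPolynomial ι ℂ, MvPolynomial.eval x a ≠ 0 ∧
      ∀ y, MvPolynomial.eval y a ≠ 0 → y ∈ U := by
  change TopologicalSpace.GenerateOpen _ U at hU
  induction hU with
  | basic s hs =>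
    obtain ⟨a, rfl⟩ := hs
    exact ⟨a, hx, fun y hy => hy⟩
  | univ => exact ⟨1, by simp, fun _ _ => trivial⟩
  | inter s t _ _ hs ht =>
    obtain ⟨a, ha, ha'⟩ := hs hx.1
    obtain ⟨b, hb, hb'⟩ := ht hx.2
    refine ⟨a * b, by simp [ha, hb], fun y hy => ?_⟩
    rw [map_mul] at hy
    exact ⟨ha' y (left_ne_zero_of_mul hy), hb' y (right_ne_zero_of_mul hy)⟩
  | sUnion K _ ih =>
    obtain ⟨s, hs, hxs⟩ := hx
    obtain ⟨a, ha, ha'⟩ := ih s hs hxs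
    exact ⟨a, ha, fun y hy => ⟨s, hs, ha' y hy⟩⟩

/-- A nonempty open subset of `ℂP¹` contains the image of the nonvanishing locus of a nonzero
polynomial on `ℂ²`, and a product of nonzero polynomials has a point where it does not vanish. -/
theorem projLine_inter_nonempty {U V : Set (ℙ ℂ (Fin 2 → ℂ))} (hU : IsOpen[projLine.top] U)
    (hV : IsOpen[projLine.top] V) (hU0 : U.Nonempty) (hV0 : V.Nonempty) : (U ∩ V).Nonempty := by
  have key : ∀ U, IsOpen[projLine.top] U → U.Nonempty → ∃ a : MvPolynomial (Fin 2) ℂ, a ≠ 0 ∧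
      ∀ v (hv : v ≠ 0), MvPolynomial.eval v a ≠ 0 → Projectivization.mk ℂ v hv ∈ U := by
    rintro U ⟨O, hO, hOU⟩ ⟨P, hP⟩
    have h1 : P.rep ∈ O := by
      have : (⟨P.rep, P.rep_nonzero⟩ : {v : Fin 2 → ℂ // v ≠ 0}) ∈ Projectivization.mk' ℂ ⁻¹' U := by
        change Projectivization.mk ℂ P.rep P.rep_nonzero ∈ U
        rwa [P.mk_rep]
      rw [← hOU] at this
      exact this
    obtain ⟨a, ha, ha'⟩ := exists_basic_zariski hO h1
    refine ⟨a, fun h => ha (by simp [h]), fun v hv hva => ?_⟩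
    have : (⟨v, hv⟩ : {v : Fin 2 → ℂ // v ≠ 0}) ∈ Projectivization.mk' ℂ ⁻¹' U := by
      rw [← hOU]
      exact ha' v hva
    exact this
  obtain ⟨a, ha, ha'⟩ := key U hU hU0
  obtain ⟨b, hb, hb'⟩ := key V hV hV0
  -- The factor `X 0` guarantees that the point found is not the origin, so that it defines a point
  -- of `ℂP¹`.
  have hne : a * b * MvPolynomial.X 0 ≠ 0 := mul_ne_zero (mul_ne_zero ha hb) (MvPolynomial.X_ne_zero _)
  obtain ⟨v, hv⟩ : ∃ v, MvPolynomial.eval v (a * b * MvPolynomial.X 0) ≠ 0 := by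
    by_contra! h
    exact hne (MvPolynomial.funext fun v => by rw [h v, map_zero])
  simp only [map_mul, MvPolynomial.eval_X] at hv
  have hv0 : v ≠ 0 := fun h => by simp [h] at hv
  exact ⟨_, ha' v hv0 (left_ne_zero_of_mul (left_ne_zero_of_mul hv)),
    hb' v hv0 (right_ne_zero_of_mul (left_ne_zero_of_mul hv))⟩

end FunSpace

/-! ### Frames of complete flags -/

section Flags

variable {ι : Type} [Fintype ι]

theorem CompleteFlag.mono (F : CompleteFlag ι) {i j : ℕ} (h : i ≤ j) : F.F i ≤ F.F j := by
  induction j, h using Nat.le_induction with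
  | base => exact le_rfl
  | succ j _ ih =>
    refine ih.trans ?_
    by_cases hj : j < Fintype.card ι
    · exact (F.lt_succ j hj).le
    · rw [F.eq_top (j + 1) (by omega)]
      exact le_top

/-- Strict growth bounds the dimension from below when counting up from `0`, and from above when
counting down from the whole space. -/
theorem CompleteFlag.finrank_F (F : CompleteFlag ι) {i : ℕ} (hi : i ≤ Fintype.card ι) :
    Module.finrank ℂ (F.F i) = i := by
  have h1 : ∀ i ≤ Fintype.card ι, i ≤ Module.finrank ℂ (F.F i) := by
    intro i
    induction i with
    | zero => simp
    | succ i ih =>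
      intro h
      exact (ih (by omega)).trans_lt (Submodule.finrank_lt_finrank_of_lt (F.lt_succ i h))
  have h2 : ∀ i ≤ Fintype.card ι,
      Module.finrank ℂ (F.F (Fintype.card ι - i)) + i ≤ Fintype.card ι := by
    intro i
    induction i with
    | zero =>
      intro _
      simpa using Submodule.finrank_le (F.F (Fintype.card ι))
    | succ i ih =>
      intro h
      have h3 := F.lt_succ (Fintype.card ι - (i + 1)) (by omega)
      rw [show Fintype.card ι - (i + 1) + 1 = Fintype.card ι - i by omega] at h3
      have := Submodule.finrank_lt_finrank_of_lt h3
      have := ih (by omega)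
      omega
  have := h1 i hi
  have := h2 (Fintype.card ι - i) (by omega)
  rw [show Fintype.card ι - (Fintype.card ι - i) = i by omega] at this
  omega

/-- `w` is a basis adapted to the flag `F`. -/
def IsFrameOf (w : Fin (Fintype.card ι) → ι → ℂ) (F : CompleteFlag ι) : Prop :=
  ∀ j : Fin (Fintype.card ι), w j ∈ F.F (j + 1) ∧ w j ∉ F.F j

theorem exists_isFrameOf (F : CompleteFlag ι) : ∃ w, IsFrameOf w F := by
  have h : ∀ j : Fin (Fintype.card ι), ∃ v, v ∈ F.F (j + 1) ∧ v ∉ F.F j := fun j =>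
    SetLike.exists_of_lt (F.lt_succ j j.2)
  choose w hw using h
  exact ⟨w, hw⟩

theorem IsFrameOf.span_eq {w : Fin (Fintype.card ι) → ι → ℂ} {F : CompleteFlag ι}
    (h : IsFrameOf w F) (i : ℕ) : F.F i = Submodule.span ℂ (w '' {j | j.val < i}) := by
  have h1 : ∀ i ≤ Fintype.card ι, F.F i = Submodule.span ℂ (w '' {j | j.val < i}) := by
    intro i
    induction i with
    | zero => simp [F.zero]
    | succ i ih =>
      intro hi
      have h2 := ih (by omega)
      have h3 : Submodule.span ℂ (w '' {j | j.val < i + 1}) ≤ F.F (i + 1) := by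
        rw [Submodule.span_le]
        rintro _ ⟨j, hj, rfl⟩
        exact F.mono hj (h j).1
      have h4 : F.F i < Submodule.span ℂ (w '' {j | j.val < i + 1}) := by
        refine lt_of_le_of_ne ?_ fun h5 => (h ⟨i, hi⟩).2 ?_
        · rw [h2]
          exact Submodule.span_mono (Set.image_mono fun j hj => Nat.lt_succ_of_lt hj)
        · change w ⟨i, hi⟩ ∈ F.F i
          rw [h5]
          exact Submodule.subset_span ⟨⟨i, hi⟩, Nat.lt_succ_self i, rfl⟩
      have h5 := Submodule.finrank_lt_finrank_of_lt h4
      rw [F.finrank_F (by omega)] at h5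
      exact (Submodule.eq_of_le_of_finrank_le h3 (by rw [F.finrank_F hi]; omega)).symm
  by_cases hi : i ≤ Fintype.card ι
  · exact h1 i hi
  · rw [F.eq_top i (by omega), ← F.eq_top _ le_rfl, h1 _ le_rfl]
    congr 2
    ext j
    simp only [Set.mem_ofPred_eq]
    omega

theorem IsFrameOf.linearIndependent {w : Fin (Fintype.card ι) → ι → ℂ} {F : CompleteFlag ι}
    (h : IsFrameOf w F) : LinearIndependent ℂ w := by
  refine linearIndependent_of_top_le_span_of_card_eq_finrank ?_ (by simp)
  rw [← F.eq_top _ le_rfl, h.span_eq]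
  exact Submodule.span_mono (Set.image_subset_range _ _)

theorem Frame.isFrameOf (g : Frame ι) : IsFrameOf (fun j i => g.1 (j, i)) g.flag := by
  intro j
  refine ⟨Submodule.subset_span ⟨j, Nat.lt_succ_self j, rfl⟩, fun h => ?_⟩
  exact g.2.notMem_span_image (s := {l | l.val < j.val}) (x := j) (by simp) h

theorem IsFrameOf.exists_frame {w : Fin (Fintype.card ι) → ι → ℂ} {F : CompleteFlag ι}
    (h : IsFrameOf w F) : ∃ g : Frame ι, g.1 = (fun x => w x.1 x.2) ∧ g.flag = F := by
  refine ⟨⟨fun x => w x.1 x.2, h.linearIndependent⟩, rfl, ?_⟩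
  ext1
  funext i
  exact (h.span_eq i).symm

theorem IsFrameOf.mem_iff {w : Fin (Fintype.card ι) → ι → ℂ} {F : CompleteFlag ι}
    (h : IsFrameOf w F) {r : ℕ} (hr : r ≤ Fintype.card ι) {v : ι → ℂ} :
    v ∈ F.F r ↔ ∃ u : Fin r → ℂ, ∑ a, u a • w (Fin.castLE hr a) = v := by
  have h1 : w '' {j | j.val < r} = Set.range fun a : Fin r => w (Fin.castLE hr a) := by
    ext y
    constructor
    · rintro ⟨j, hj, rfl⟩
      exact ⟨⟨j, hj⟩, rfl⟩
    · rintro ⟨a, rfl⟩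
      exact ⟨_, a.2, rfl⟩
  rw [h.span_eq, h1, Submodule.mem_span_range_iff_exists_fun]

/-! ### Morphisms to the flag variety -/

/-- A family of vectors depends regularly on the point of an open set. -/
def FunSpace.RegVec {X : Type*} {κ : Type*} (S : FunSpace X) (U : Set X) (w : X → κ → ℂ) : Prop :=
  ∀ i, S.reg U fun x => w x i

/-- The criterion by which all maps into the flag variety are shown to be morphisms: locally there
is an adapted basis with regular entries. -/
theorem isMorphism_flagVariety {Z : Type*} {R : FunSpace Z} {f : Z → CompleteFlag ι}
    (h : ∀ z, ∃ W : Set Z, IsOpen[R.top] W ∧ z ∈ W ∧ ∃ w : Z → Fin (Fintype.card ι) → ι → ℂ,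
      (∀ j, R.RegVec W fun z => w z j) ∧ ∀ z ∈ W, IsFrameOf (w z) (f z)) :
    R.IsMorphism (flagVariety ι) f := by
  refine FunSpace.isMorphism_coinduced_of_local_lift _ _ fun z => ?_
  obtain ⟨W, hW, hz, w, hw, hl⟩ := h z
  refine ⟨W, hW, hz, fun z x => w z x.1 x.2, fun x => hw _ _, fun z hz => ?_⟩
  obtain ⟨g, h1, h2⟩ := (hl z hz).exists_frame
  exact ⟨g, h1, h2⟩

/-- The structure on the set of frames. -/
def frameSpace (ι : Type) [Fintype ι] : FunSpace (Frame ι) :=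
  (FunSpace.affine (Fin (Fintype.card ι) × ι)).induced
    ((↑) : Frame ι → (Fin (Fintype.card ι) × ι → ℂ))

theorem frameSpace_reg (j : Fin (Fintype.card ι)) (i : ι) :
    (frameSpace ι).reg Set.univ fun g => g.1 (j, i) :=
  (FunSpace.isMorphism_induced _ _).reg_comp (FunSpace.affine_coord (j, i))

open FunSpace in
theorem FunSpace.RegVec.linear {X : Type*} {S : FunSpace X} {U : Set X} {w : X → ι → ℂ}
    (hU : IsOpen[S.top] U) (hw : S.RegVec U w) (f : (ι → ℂ) →ₗ[ℂ] ℂ) :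
    S.reg U fun x => f (w x) := by
  classical
  have h : ∀ x, f (w x) = ∑ i, f (Pi.single i 1) * w x i := fun x => by
    conv_lhs => rw [pi_eq_sum_univ' (w x)]
    rw [map_sum]
    refine Finset.sum_congr rfl fun i _ => ?_
    rw [map_smul, smul_eq_mul, mul_comm]
  simp only [h]
  exact reg_sum _ hU fun i _ => reg_const_mul _ (hw i)

theorem FunSpace.RegVec.linearMap {κ X : Type*} {S : FunSpace X} {U : Set X} {w : X → ι → ℂ}
    (hU : IsOpen[S.top] U) (hw : S.RegVec U w) (f : (ι → ℂ) →ₗ[ℂ] (κ → ℂ)) :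
    S.RegVec U fun x => f (w x) := fun i => hw.linear hU ((LinearMap.proj i).comp f)

theorem FunSpace.RegVec.add {κ X : Type*} {S : FunSpace X} {U : Set X} {w w' : X → κ → ℂ}
    (hw : S.RegVec U w) (hw' : S.RegVec U w') : S.RegVec U fun x => w x + w' x :=
  fun i => S.add (hw i) (hw' i)

theorem FunSpace.RegVec.sub {κ X : Type*} {S : FunSpace X} {U : Set X} {w w' : X → κ → ℂ}
    (hw : S.RegVec U w) (hw' : S.RegVec U w') : S.RegVec U fun x => w x - w' x :=
  fun i => reg_sub (hw i) (hw' i)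

theorem FunSpace.RegVec.smul {κ X : Type*} {S : FunSpace X} {U : Set X} {c : X → ℂ} {w : X → κ → ℂ}
    (hc : S.reg U c) (hw : S.RegVec U w) : S.RegVec U fun x => c x • w x :=
  fun i => S.mul hc (hw i)

theorem FunSpace.RegVec.bilin {X : Type*} {S : FunSpace X} {U : Set X} {w w' : X → ι → ℂ}
    (hU : IsOpen[S.top] U) (hw : S.RegVec U w) (hw' : S.RegVec U w')
    (B : LinearMap.BilinForm ℂ (ι → ℂ)) : S.reg U fun x => B (w x) (w' x) := by
  classical
  have h : ∀ x, B (w x) (w' x) = ∑ i, B (Pi.single i 1) (w' x) * w x i := fun x => by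
    conv_lhs => rw [pi_eq_sum_univ' (w x)]
    rw [map_sum, LinearMap.sum_apply]
    refine Finset.sum_congr rfl fun i _ => ?_
    rw [map_smul, LinearMap.smul_apply, smul_eq_mul, mul_comm]
  simp only [h]
  exact reg_sum _ hU fun i _ => S.mul (hw'.linear hU _) (hw i)

theorem isMorphism_frame_flag :
    (frameSpace ι).IsMorphism (flagVariety ι) Frame.flag :=
  FunSpace.isMorphism_coinduced _ _

/-- Local sections of the quotient map from frames to flags. -/
theorem exists_local_frame (F₀ : CompleteFlag ι) : ∃ O : Set (CompleteFlag ι),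
    IsOpen[(flagVariety ι).top] O ∧ F₀ ∈ O ∧ ∃ s : CompleteFlag ι → Fin (Fintype.card ι) → ι → ℂ,
      (∀ j, (flagVariety ι).RegVec O fun F => s F j) ∧ ∀ F ∈ O, IsFrameOf (s F) F := by
  classical
  obtain ⟨g₀, hg₀⟩ := exists_isFrameOf F₀
  have hli := hg₀.linearIndependent
  let b := Module.Basis.mk hli (by
    rw [← F₀.eq_top _ le_rfl, hg₀.span_eq]
    exact Submodule.span_mono (Set.image_subset_range _ _))
  let c : Fin (Fintype.card ι) → (ι → ℂ) →ₗ[ℂ] ℂ := b.coord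
  have hc0 : ∀ v, (∀ l, c l v = 0) → v = 0 := fun v hv =>
    b.ext_elem_iff.2 fun l => by simpa [c] using hv l
  -- A big cell around `F₀`: each `F_r` meets the common kernel of the first `r` coordinates of `b`
  -- only in `0`. On frames this is the nonvanishing of all leading minors `M g r`.
  let O : Set (CompleteFlag ι) :=
    {F | ∀ r ≤ Fintype.card ι, ∀ v ∈ F.F r, (∀ l, l.val < r → c l v = 0) → v = 0}
  let M : Frame ι → ∀ r, r ≤ Fintype.card ι → Matrix (Fin r) (Fin r) ℂ := fun g r hr =>
    Matrix.of fun a l => c (Fin.castLE hr l) fun i => g.1 (Fin.castLE hr a, i)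
  have hM : ∀ (g : Frame ι) r (hr : r ≤ Fintype.card ι) (u : Fin r → ℂ) (l : Fin r),
      Matrix.vecMul u (M g r hr) l =
        c (Fin.castLE hr l) (∑ a, u a • fun i => g.1 (Fin.castLE hr a, i)) := by
    intro g r hr u l
    simp [Matrix.vecMul, dotProduct, M]
  have hdet : ∀ g : Frame ι, g.flag ∈ O ↔ ∀ r hr, (M g r hr).det ≠ 0 := by
    intro g
    constructor
    · intro h r hr h0
      obtain ⟨u, hu0, hu⟩ := Matrix.exists_vecMul_eq_zero_iff.2 h0
      have h1 := h r hr _ ((g.isFrameOf.mem_iff hr).2 ⟨u, rfl⟩) fun l hl => by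
        have := congrFun hu ⟨l, hl⟩
        rw [hM] at this
        exact this
      have h2 := (g.2.comp (Fin.castLE hr) (Fin.castLE_injective hr))
      exact hu0 (funext (Fintype.linearIndependent_iff.1 h2 u h1))
    · intro h r hr v hv hcv
      obtain ⟨u, rfl⟩ := (g.isFrameOf.mem_iff hr).1 hv
      have h1 : Matrix.vecMul u (M g r hr) = 0 := by
        ext l
        rw [hM]
        exact hcv _ l.2
      by_contra h2
      have h3 : u ≠ 0 := fun h3 => h2 (by simp [h3])
      exact h r hr (Matrix.exists_vecMul_eq_zero_iff.1 ⟨u, h3, h1⟩)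
  have hregM : ∀ r hr a l, (frameSpace ι).reg Set.univ fun g => M g r hr a l := fun r hr a l =>
    FunSpace.RegVec.linear (frameSpace ι).top.isOpen_univ
      (fun i => frameSpace_reg (Fin.castLE hr a) i) (c (Fin.castLE hr l))
  have hO : IsOpen[(flagVariety ι).top] O := by
    have h1 : IsOpen[(frameSpace ι).top] (Frame.flag ⁻¹' O) := by
      have h2 : (Frame.flag ⁻¹' O : Set (Frame ι)) =
          ⋂ r : Fin (Fintype.card ι + 1), {g | (M g r (by omega)).det ≠ 0} := by
        ext g
        simp only [Set.mem_preimage, hdet, Set.mem_iInter, Set.mem_ofPred_eq]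
        exact ⟨fun h r => h _ _, fun h r hr => h ⟨r, by omega⟩⟩
      rw [h2]
      refine @isOpen_iInter_of_finite _ _ (frameSpace ι).top _ _ fun r => ?_
      exact FunSpace.isOpen_eq_zero_compl
        (FunSpace.reg_det (frameSpace ι).top.isOpen_univ (hregM _ _))
    exact h1
  -- The last row of the inverse of the leading block of size `j + 1` gives the combination of frame
  -- vectors whose first `j + 1` coordinates are `0, …, 0, 1`.
  let sg : Frame ι → Fin (Fintype.card ι) → ι → ℂ := fun g j =>
    ∑ a, (M g (j + 1) (by omega))⁻¹ (Fin.last _) a • fun i => g.1 (Fin.castLE (by omega) a, i)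
  have hsg : ∀ g : Frame ι, g.flag ∈ O → ∀ j : Fin (Fintype.card ι), sg g j ∈ g.flag.F (j + 1) ∧
      ∀ l, l.val ≤ j.val → c l (sg g j) = if l = j then 1 else 0 := by
    intro g hg j
    have hj : j.val + 1 ≤ Fintype.card ι := by omega
    refine ⟨(g.isFrameOf.mem_iff hj).2 ⟨_, rfl⟩, fun l hl => ?_⟩
    have h1 := hM g (j + 1) hj ((M g (j + 1) hj)⁻¹ (Fin.last _)) ⟨l, by omega⟩
    have h2 : Matrix.vecMul ((M g (j + 1) hj)⁻¹ (Fin.last _)) (M g (j + 1) hj) =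
        (1 : Matrix (Fin (j.val + 1)) (Fin (j.val + 1)) ℂ) (Fin.last _) := by
      rw [← Matrix.nonsing_inv_mul (M g (j + 1) hj) (isUnit_iff_ne_zero.2 ((hdet g).1 hg _ _))]
      rfl
    rw [h2] at h1
    refine h1.symm.trans ?_
    simp only [Matrix.one_apply, Fin.ext_iff, Fin.val_last]
    exact if_congr eq_comm rfl rfl
  -- This normalisation singles out a vector by the flag alone. Hence the section computed from a
  -- frame is independent of the frame and descends to the quotient.
  let P : CompleteFlag ι → Fin (Fintype.card ι) → (ι → ℂ) → Prop := fun F j v =>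
    v ∈ F.F (j + 1) ∧ ∀ l, l.val ≤ j.val → c l v = if l = j then 1 else 0
  have huniq : ∀ F ∈ O, ∀ j v v', P F j v → P F j v' → v = v' := by
    intro F hF j v v' hv hv'
    refine sub_eq_zero.1 (hF (j + 1) (by omega) _ (sub_mem hv.1 hv'.1) fun l hl => ?_)
    rw [map_sub, hv.2 l (by omega), hv'.2 l (by omega), sub_self]
  have hex : ∀ F ∈ O, ∃ v : Fin (Fintype.card ι) → ι → ℂ, ∀ j, P F j (v j) := by
    intro F hF
    obtain ⟨w, hw⟩ := exists_isFrameOf F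
    obtain ⟨g, -, rfl⟩ := hw.exists_frame
    exact ⟨sg g, hsg g hF⟩
  let s : CompleteFlag ι → Fin (Fintype.card ι) → ι → ℂ := fun F =>
    if h : ∃ v : Fin (Fintype.card ι) → ι → ℂ, ∀ j, P F j (v j) then h.choose else 0
  have hs : ∀ F ∈ O, ∀ j, P F j (s F j) := by
    intro F hF j
    simp only [s, dif_pos (hex F hF)]
    exact (hex F hF).choose_spec j
  refine ⟨O, hO, ?_, s, fun j i => ?_, fun F hF j => ⟨(hs F hF j).1, fun h => ?_⟩⟩
  · intro r hr v hv hcv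
    refine hc0 v fun l => ?_
    by_cases hl : l.val < r
    · exact hcv l hl
    · rw [hg₀.span_eq, show g₀ = b from (Module.Basis.coe_mk _ _).symm,
        Module.Basis.mem_span_image] at hv
      by_contra h
      have h2 : l ∈ (b.repr v).support := Finsupp.mem_support_iff.2 h
      exact hl (hv h2)
  · have h1 : (frameSpace ι).reg (Frame.flag ⁻¹' O) fun g => sg g j i := by
      have h2 : ∀ g, sg g j i = ∑ a, (M g (j + 1) (by omega))⁻¹ (Fin.last _) a *
          g.1 (Fin.castLE (by omega) a, i) := fun g => by simp [sg, Finset.sum_apply]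
      simp only [h2]
      have ho : IsOpen[(frameSpace ι).top] (Frame.flag ⁻¹' O) :=
        isMorphism_frame_flag.isOpen_preimage hO
      refine FunSpace.reg_sum _ ho fun a _ => FunSpace.mul _ ?_
        (FunSpace.restrict _ (frameSpace_reg _ _) ho (Set.subset_univ _))
      refine FunSpace.reg_inv_matrix ho (fun a l =>
        FunSpace.restrict _ (hregM _ _ a l) ho (Set.subset_univ _)) (fun g hg => ?_) _ _
      exact (hdet g).1 hg _ _
    have h2 : (frameSpace ι).reg (Frame.flag ⁻¹' O) ((fun F => s F j i) ∘ Frame.flag) := by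
      refine FunSpace.congr _ h1 fun g hg => ?_
      exact congrFun (huniq g.flag hg j _ _ (hsg g hg j) (hs g.flag hg j)) i
    exact h2
  · have h1 := hF j (by omega) _ h fun l hl => by
      rw [(hs F hF j).2 l hl.le, if_neg (by rintro rfl; exact lt_irrefl _ hl)]
    have h2 := (hs F hF j).2 j le_rfl
    rw [h1] at h2
    simp at h2

/-- A morphism to the flag variety locally lifts to frames. -/
theorem exists_local_lift {Z : Type*} {R : FunSpace Z} {f : Z → CompleteFlag ι}
    (hf : R.IsMorphism (flagVariety ι) f) (z : Z) :
    ∃ W : Set Z, IsOpen[R.top] W ∧ z ∈ W ∧ ∃ w : Z → Fin (Fintype.card ι) → ι → ℂ,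
      (∀ j, R.RegVec W fun z => w z j) ∧ ∀ z ∈ W, IsFrameOf (w z) (f z) := by
  obtain ⟨O, hO, hz, s, hs, hsf⟩ := exists_local_frame (f z)
  exact ⟨f ⁻¹' O, hf.isOpen_preimage hO, hz, fun z => s (f z), fun j i => hf.2 _ _ (hs j i),
    fun z hz => hsf _ hz⟩

/-! ### Closed conditions on flags -/

theorem isClosed_flagVariety_iff {K : Set (CompleteFlag ι)} :
    IsClosed[(flagVariety ι).top] K ↔ IsClosed[(frameSpace ι).top] (Frame.flag ⁻¹' K) := by
  rw [← @isOpen_compl_iff _ _ (flagVariety ι).top, ← @isOpen_compl_iff _ _ (frameSpace ι).top]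
  exact Iff.rfl

/-- Cramer's rule: up to the invertible factor `det A₀`, the coefficients of `w g` in the basis `g`
are determinants `det A_l`, and membership in `F_a` is the vanishing of those with `l ≥ a`. -/
theorem isClosed_mem_flag {w : Frame ι → ι → ℂ} (hw : (frameSpace ι).RegVec Set.univ w) (a : ℕ) :
    IsClosed[(frameSpace ι).top] {g | w g ∈ g.flag.F a} := by
  classical
  let e := (Fintype.equivFin ι).symm
  let A : Frame ι → Fin (Fintype.card ι) → Matrix (Fin (Fintype.card ι)) (Fin (Fintype.card ι)) ℂ :=
    fun g l => Matrix.of fun j j' => if j = l then w g (e j') else g.1 (j, e j')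
  let A₀ : Frame ι → Matrix (Fin (Fintype.card ι)) (Fin (Fintype.card ι)) ℂ :=
    fun g => Matrix.of fun j j' => g.1 (j, e j')
  have hreg : ∀ l, (frameSpace ι).reg Set.univ fun g => (A g l).det := by
    intro l
    refine FunSpace.reg_det (frameSpace ι).top.isOpen_univ fun j j' => ?_
    by_cases h : j = l
    · simpa [A, h] using hw (e j')
    · simpa [A, h] using frameSpace_reg j (e j')
  have key : ∀ g : Frame ι, ∀ u : Fin (Fintype.card ι) → ℂ,
      (∑ j, u j • fun i => g.1 (j, i)) = w g → ∀ l, (A g l).det = u l * (A₀ g).det := by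
    intro g u hu l
    have h1 : A g l = (A₀ g).updateRow l (∑ j, u j • A₀ g j) := by
      ext j j'
      by_cases h : j = l
      · subst h
        simp only [A, A₀, Matrix.of_apply, if_true, Matrix.updateRow_self]
        rw [← hu]
        simp [Finset.sum_apply]
      · simp [A, A₀, h]
    rw [h1, Matrix.det_updateRow_sum]
    simp
  have hdet : ∀ g : Frame ι, (A₀ g).det ≠ 0 := by
    intro g h0
    obtain ⟨u, hu0, hu⟩ := Matrix.exists_vecMul_eq_zero_iff.2 h0
    refine hu0 (funext (Fintype.linearIndependent_iff.1 g.2 u ?_))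
    ext i
    have := congrFun hu (e.symm i)
    simpa [Matrix.vecMul, dotProduct, A₀, Finset.sum_apply] using this
  have hset : {g : Frame ι | w g ∈ g.flag.F a} =
      ⋂ l : {l : Fin (Fintype.card ι) // a ≤ l.val}, {g | (A g l).det = 0} := by
    ext g
    simp only [Set.mem_ofPred_eq, Set.mem_iInter]
    have hspan := g.isFrameOf.mem_iff le_rfl (v := w g)
    rw [g.flag.eq_top _ le_rfl] at hspan
    obtain ⟨u, hu⟩ := hspan.1 trivial
    have hu' : (∑ j, u j • fun i => g.1 (j, i)) = w g := hu
    constructor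
    · intro h l
      rw [g.isFrameOf.span_eq, Submodule.mem_span_image_iff_exists_fun] at h
      obtain ⟨t, ht, c, hc⟩ := h
      have h2 : (∑ j, (if h : j ∈ t then c ⟨j, h⟩ else 0) • fun i => g.1 (j, i)) = w g := by
        rw [← hc, ← Finset.sum_subset (Finset.subset_univ t) fun j _ hj => by simp [hj],
          ← Finset.sum_coe_sort]
        exact Finset.sum_congr rfl fun j _ => by simp
      rw [key g _ h2 l.1, dif_neg fun h => ?_, zero_mul]
      have := ht h
      have h3 := l.2
      simp only [Set.mem_ofPred_eq] at this
      omega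
    · intro h
      rw [← hu']
      refine Submodule.sum_mem _ fun j _ => ?_
      by_cases hj : j.val < a
      · exact Submodule.smul_mem _ _ (g.flag.mono hj (g.isFrameOf j).1)
      · have := h ⟨j, by omega⟩
        rw [key g u hu' j] at this
        rw [(mul_eq_zero.1 this).resolve_right (hdet g), zero_smul]
        exact zero_mem _
  rw [hset]
  exact @isClosed_iInter _ _ (frameSpace ι).top _ fun l => FunSpace.isClosed_eq_zero (hreg l)

end Flags

namespace FunSpace

/-! ### A criterion for fiber bundles over the projective line -/

theorem projPoint_one_one : projPoint 1 1 = projPoint 0 1 := by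
  have : chartVec 1 1 = chartVec 0 1 := by
    ext j
    simp [chartVec]
  simp only [projPoint, this]

/-- A morphism to the projective line is a fiber bundle if the two one-parameter groups of
transvections of `ℂ²` lift to algebraic families of automorphisms of the source. -/
theorem isFiberBundle_of_transvections {X F : Type} {S : FunSpace X} {SF : FunSpace F}
    {π : X → ℙ ℂ (Fin 2 → ℂ)} (hπ : IsMorphism S projLine π) (T : Fin 2 → ℂ → X → X)
    (hT : ∀ (i : Fin 2) {Z : Type} (R : FunSpace Z) (c : Z → ℂ) (f : Z → X), R.reg Set.univ c →
      IsMorphism R S f → IsMorphism R S fun z => T i (c z) (f z))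
    (hT0 : ∀ i c x, T i (-c) (T i c x) = x)
    (hπT : ∀ i t c x, π x = projPoint i t → π (T i c x) = projPoint i (t + c))
    (j : F → X) (hj : IsMorphism SF S j) (hinj : Function.Injective j)
    (hrange : Set.range j = {x | π x = projPoint 0 0})
    (hlift : ∀ {Z : Type} (R : FunSpace Z) (f : Z → F), IsMorphism R S (j ∘ f) →
      IsMorphism R SF f) : IsFiberBundle S projLine SF π := by
  refine ⟨hπ, fun b => ?_⟩
  obtain ⟨i, hi⟩ := exists_mem_projChart b
  refine ⟨projChart i, isOpen_projChart i, hi, ?_⟩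
  have hT0' : ∀ i c x, T i c (T i (-c) x) = x := fun i c x => by simpa using hT0 i (-c) x
  have hjπ : ∀ y, π (j y) = projPoint 0 0 := fun y => by
    have : j y ∈ Set.range j := ⟨y, rfl⟩
    rwa [hrange] at this
  have hTm : ∀ i c, IsMorphism S S (T i c) := fun i c =>
    hT i S (fun _ => c) id (S.const c S.top.isOpen_univ) isMorphism_id
  obtain ⟨ρ, ρ', hρ, hρ', h1, h2, h3, h4⟩ : ∃ ρ ρ' : X → X, IsMorphism S S ρ ∧
      IsMorphism S S ρ' ∧ (∀ x, π x = projPoint i 0 → π (ρ x) = projPoint 0 0) ∧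
      (∀ x, π x = projPoint 0 0 → π (ρ' x) = projPoint i 0) ∧ (∀ x, ρ' (ρ x) = x) ∧
      ∀ x, ρ (ρ' x) = x := by
    have h01 : ∀ i : Fin 2, i = 0 ∨ i = 1 := by decide
    rcases h01 i with rfl | rfl
    · exact ⟨id, id, isMorphism_id, isMorphism_id, fun _ h => h, fun _ h => h, fun _ => rfl,
        fun _ => rfl⟩
    · refine ⟨fun x => T 0 (-1) (T 1 1 x), fun x => T 1 (-1) (T 0 1 x),
        (hTm 0 (-1)).comp (hTm 1 1), (hTm 1 (-1)).comp (hTm 0 1), fun x hx => ?_, fun x hx => ?_,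
        fun x => by simp [hT0, hT0'], fun x => by simp [hT0, hT0']⟩
      · have := hπT 1 0 1 x hx
        rw [zero_add, projPoint_one_one] at this
        simpa using hπT 0 1 (-1) _ this
      · have := hπT 0 0 1 x hx
        rw [zero_add, ← projPoint_one_one] at this
        simpa using hπT 1 1 (-1) _ this
  have hfib : ∀ x : (π ⁻¹' projChart i : Set X), ∃ y, j y = ρ (T i (-projCoord i (π x)) x) := by
    intro x
    have h5 : ρ (T i (-projCoord i (π x)) x) ∈ {x | π x = projPoint 0 0} := by
      refine h1 _ ?_
      simpa using hπT i (projCoord i (π x)) (-projCoord i (π x)) x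
        (projPoint_projCoord x.2).symm
    rwa [← hrange] at h5
  choose q hq using hfib
  have hmem : ∀ z : projChart i × F, T i (projCoord i z.1) (ρ' (j z.2)) ∈ π ⁻¹' projChart i := by
    intro z
    rw [Set.mem_preimage, hπT i 0 _ _ (h2 _ (hjπ z.2))]
    exact projPoint_mem _ _
  have hπe : ∀ z : projChart i × F, π (T i (projCoord i z.1) (ρ' (j z.2))) = z.1 := by
    intro z
    rw [hπT i 0 _ _ (h2 _ (hjπ z.2)), zero_add, projPoint_projCoord z.1.2]
  -- The trivialisation translates a fibre to the origin of the chart along `T i` and then applies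
  -- `ρ`; `j` identifies the resulting fibre with `F`.
  let e : (π ⁻¹' projChart i : Set X) ≃ projChart i × F :=
    { toFun := fun x => (⟨π x, x.2⟩, q x)
      invFun := fun z => ⟨T i (projCoord i z.1) (ρ' (j z.2)), hmem z⟩
      left_inv := fun x => by
        ext
        simp only [hq, h3, hT0']
      right_inv := fun z => by
        refine Prod.ext (Subtype.ext (hπe z)) (hinj ?_)
        simp only [hq, hπe, hT0, h4] }
  refine ⟨e, ⟨?_, ?_⟩, fun x => rfl⟩
  · have h6 : IsMorphism (S.induced ((↑) : (π ⁻¹' projChart i : Set X) → X)) projLine (π ∘ (↑)) :=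
      hπ.comp (isMorphism_induced _ _)
    refine IsMorphism.prodMk (IsMorphism.induced_lift h6) (hlift _ _ ?_)
    have h5 : (j ∘ fun x => q x) =
        fun x : (π ⁻¹' projChart i : Set X) => ρ (T i (-projCoord i (π x)) x) := funext hq
    rw [h5]
    refine hρ.comp (hT i _ (fun x : (π ⁻¹' projChart i : Set X) => -projCoord i (π x)) _ ?_
      (isMorphism_induced _ _))
    refine reg_neg ?_
    have := h6.2 _ _ (reg_projCoord i)
    convert this using 1
    · ext x
      exact iff_of_true trivial x.2
    · rfl
  · refine IsMorphism.induced_lift ?_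
    refine hT i _ (fun z : projChart i × F => projCoord i z.1) (fun z => ρ' (j z.2)) ?_
      (hρ'.comp (hj.comp (isMorphism_snd _ _)))
    have h6 : IsMorphism ((projLine.induced ((↑) : projChart i → _)).prod SF) projLine
        fun z => (z.1 : ℙ ℂ (Fin 2 → ℂ)) := (isMorphism_induced _ _).comp (isMorphism_fst _ _)
    have := h6.2 _ _ (reg_projCoord i)
    convert this using 1
    · ext x
      simp
    · rfl

/-! ### Irreducibility of iterated bundles -/

/-- The space is nonempty and any two nonempty open subsets meet. -/
def Irred {X : Type*} (S : FunSpace X) : Prop :=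
  Nonempty X ∧ ∀ U V, IsOpen[S.top] U → IsOpen[S.top] V → U.Nonempty → V.Nonempty →
    (U ∩ V).Nonempty

theorem Irred.irreducibleSpace {X : Type*} {S : FunSpace X} (h : S.Irred) :
    @IrreducibleSpace X S.top := by
  let _ := S.top
  have h1 : IsPreirreducible (Set.univ : Set X) := by
    intro U V hU hV hU0 hV0
    simp only [Set.univ_inter] at hU0 hV0 ⊢
    exact h.2 U V hU hV hU0 hV0
  have : PreirreducibleSpace X := ⟨h1⟩
  exact { toNonempty := h.1 }

/-- The image of a nonempty open set contains a nonempty open subset of the base, namely its trace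
on a local constant section. Two such subsets of `ℂP¹` share a point, and over this point both open
sets meet the irreducible fibre. -/
theorem Irred.of_isFiberBundle {X F : Type} {S : FunSpace X} {SF : FunSpace F}
    {π : X → ℙ ℂ (Fin 2 → ℂ)} (h : IsFiberBundle S projLine SF π) (hF : SF.Irred) : S.Irred := by
  obtain ⟨hπ, h⟩ := h
  have key : ∀ U, IsOpen[S.top] U → U.Nonempty → ∃ O, IsOpen[projLine.top] O ∧ O.Nonempty ∧
      ∀ b ∈ O, ∃ x ∈ U, π x = b := by
    rintro U hU ⟨x, hx⟩
    obtain ⟨B, hB, hxB, e, he, heπ⟩ := h (π x)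
    have hs : IsMorphism (projLine.induced ((↑) : B → _)) S
        fun u => (e.symm (u, (e ⟨x, hxB⟩).2) : X) :=
      (isMorphism_induced _ _).comp (he.2.comp (isMorphism_id.prodMk (isMorphism_const _)))
    refine ⟨_, isOpen_image_val hB (hs.isOpen_preimage hU),
      ⟨π x, ⟨⟨π x, hxB⟩, ?_, rfl⟩⟩, ?_⟩
    · have h1 : (⟨π x, hxB⟩ : B) = (e ⟨x, hxB⟩).1 := Subtype.ext (heπ ⟨x, hxB⟩).symm
      rw [h1]
      simpa using hx
    · rintro _ ⟨u, hu, rfl⟩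
      refine ⟨_, hu, ?_⟩
      rw [← heπ]
      simp
  refine ⟨?_, fun U V hU hV hU0 hV0 => ?_⟩
  · obtain ⟨y⟩ := hF.1
    obtain ⟨B, -, hbB, e, -, -⟩ := h (projPoint 0 0)
    exact ⟨(e.symm (⟨_, hbB⟩, y) : X)⟩
  · obtain ⟨O, hO, hO0, hOU⟩ := key U hU hU0
    obtain ⟨O', hO', hO0', hOV⟩ := key V hV hV0
    obtain ⟨b, hb, hb'⟩ := projLine_inter_nonempty hO hO' hO0 hO0'
    obtain ⟨B, hB, hbB, e, he, heπ⟩ := h b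
    have hs : IsMorphism SF S fun y => (e.symm (⟨b, hbB⟩, y) : X) :=
      (isMorphism_induced _ _).comp (he.2.comp ((isMorphism_const _).prodMk isMorphism_id))
    have hpt : ∀ W : Set X, (∃ x ∈ W, π x = b) →
        ((fun y => (e.symm (⟨b, hbB⟩, y) : X)) ⁻¹' W).Nonempty := by
      rintro W ⟨x, hx, rfl⟩
      refine ⟨(e ⟨x, hbB⟩).2, ?_⟩
      have h1 : (⟨π x, hbB⟩ : B) = (e ⟨x, hbB⟩).1 := Subtype.ext (heπ ⟨x, hbB⟩).symm
      rw [h1]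
      simpa using hx
    obtain ⟨y, hy, hy'⟩ := hF.2 _ _ (hs.isOpen_preimage hU) (hs.isOpen_preimage hV)
      (hpt U (hOU b hb)) (hpt V (hOV b hb'))
    exact ⟨_, hy, hy'⟩

theorem IsIteratedBundle.irred {ℓ : ℕ} {X : Type} {S : FunSpace X} (h : IsIteratedBundle ℓ S) :
    S.Irred := by
  induction ℓ generalizing X with
  | zero =>
    obtain ⟨u⟩ := h
    refine ⟨⟨u.default⟩, fun U V _ _ ⟨x, hx⟩ ⟨y, hy⟩ => ⟨x, hx, ?_⟩⟩
    rwa [Subsingleton.elim x y]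
  | succ ℓ ih =>
    obtain ⟨F, SF, π, hπ, hF⟩ := h
    exact Irred.of_isFiberBundle hπ (ih hF)

/-! ### Smoothness of iterated bundles -/

/-- Every point has an open neighbourhood isomorphic to an open subset of `ℂⁿ`. -/
def LocallyAffine (n : ℕ) {X : Type*} (S : FunSpace X) : Prop :=
  ∀ x : X, ∃ (U : Set X) (D : Set (Fin n → ℂ)) (c : X → Fin n → ℂ) (s : (Fin n → ℂ) → X), x ∈ U ∧
    MorOn S (affine (Fin n)) U c ∧ MorOn (affine (Fin n)) S D s ∧ Set.MapsTo c U D ∧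
    Set.MapsTo s D U ∧ (∀ x ∈ U, s (c x) = x) ∧ ∀ z ∈ D, c (s z) = z

theorem LocallyAffine.isSmooth {n : ℕ} {X : Type*} {S : FunSpace X} (h : LocallyAffine n S) :
    S.IsSmooth := by
  intro x
  obtain ⟨U, D, c, s, hx, hc, hs, hcU, hsD, hsc, hcs⟩ := h x
  refine ⟨U, hc.isOpen, hx, n, 0, Fin.elim0, D, D, hs.isOpen, by ext; simp,
    fun z _ => linearIndependent_empty_type, ?_⟩
  let e : U ≃ D :=
    { toFun := fun x => ⟨c x, hcU x.2⟩
      invFun := fun z => ⟨s z, hsD z.2⟩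
      left_inv := fun x => Subtype.ext (hsc x x.2)
      right_inv := fun z => Subtype.ext (hcs z z.2) }
  exact ⟨e, IsMorphism.induced_lift hc.subtype, IsMorphism.induced_lift hs.subtype⟩

/-- Inside a trivialising open set, combine a chart of the fibre with the affine coordinate of a
chart of `ℂP¹`. -/
theorem LocallyAffine.of_isFiberBundle {n : ℕ} {X F : Type} {S : FunSpace X} {SF : FunSpace F}
    {π : X → ℙ ℂ (Fin 2 → ℂ)} (h : IsFiberBundle S projLine SF π) (hF : LocallyAffine n SF) :
    LocallyAffine (n + 1) S := by
  classical
  intro x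
  obtain ⟨hπ, h⟩ := h
  obtain ⟨B, hB, hxB, e, he, heπ⟩ := h (π x)
  obtain ⟨i, hi⟩ := exists_mem_projChart (π x)
  obtain ⟨V, D, c, s, hy, hc, hs, hcV, hsD, hsc, hcs⟩ := hF (e ⟨x, hxB⟩).2
  -- The fibre component of the trivialisation, with an arbitrary constant value off `π⁻¹ B`.
  let q : X → F := fun x' => if h : π x' ∈ B then (e ⟨x', h⟩).2 else (e ⟨x, hxB⟩).2
  have hq : MorOn S SF (π ⁻¹' B) q := by
    refine morOn_of_subtype (hπ.isOpen_preimage hB) ?_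
    convert (isMorphism_snd _ _).comp he.1 using 1
    funext x'
    have : π x' ∈ B := x'.2
    simp [q, this]
  have hqe : ∀ x' (h : π x' ∈ B), (e ⟨x', h⟩) = (⟨π x', h⟩, q x') := fun x' h =>
    Prod.ext (Subtype.ext (heπ ⟨x', h⟩)) (by simp [q, h])
  let s' : (Fin (n + 1) → ℂ) → X := fun z =>
    if h : projPoint i (z 0) ∈ B then e.symm (⟨_, h⟩, s (Fin.tail z)) else x
  have hcq := hc.comp hq
  have ho : IsOpen[S.top] ((π ⁻¹' B ∩ q ⁻¹' V) ∩ π ⁻¹' projChart i) :=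
    isOpen_inter hcq.isOpen (hπ.isOpen_preimage (isOpen_projChart i))
  have htail : IsMorphism (affine (Fin (n + 1))) (affine (Fin n)) Fin.tail :=
    isMorphism_affine fun i => affine_coord i.succ
  have hpt : IsMorphism (affine (Fin (n + 1))) projLine
      fun z : Fin (n + 1) → ℂ => projPoint i (z 0) :=
    (isMorphism_projPoint i).comp (isMorphism_affine (f := fun (z : Fin (n + 1) → ℂ) (_ : Fin 1) => z 0)
      fun _ => affine_coord 0)
  have hst := hs.comp (morOn_univ.2 htail)
  rw [Set.univ_inter] at hst
  let D' : Set (Fin (n + 1) → ℂ) := (fun z => projPoint i (z 0)) ⁻¹' B ∩ Fin.tail ⁻¹' D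
  have hoD : IsOpen[(affine (Fin (n + 1))).top] D' :=
    isOpen_inter (hpt.isOpen_preimage hB) hst.isOpen
  have hs'e : ∀ z (h : projPoint i (z 0) ∈ B), s' z = e.symm (⟨_, h⟩, s (Fin.tail z)) :=
    fun z h => by simp [s', h]
  have hπs : ∀ z (h : projPoint i (z 0) ∈ B), π (s' z) = projPoint i (z 0) := fun z h => by
    rw [hs'e z h, ← heπ]
    simp
  have hqs : ∀ z (h : projPoint i (z 0) ∈ B), q (s' z) = s (Fin.tail z) := fun z h => by
    have h1 := hqe (s' z) (by rwa [hπs z h])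
    have h2 : (⟨s' z, by rwa [Set.mem_preimage, hπs z h]⟩ : (π ⁻¹' B : Set X)) =
        e.symm (⟨_, h⟩, s (Fin.tail z)) := Subtype.ext (hs'e z h)
    rw [h2, Equiv.apply_symm_apply] at h1
    exact (congrArg Prod.snd h1).symm
  refine ⟨(π ⁻¹' B ∩ q ⁻¹' V) ∩ π ⁻¹' projChart i,
    D', fun x' => Fin.cons (projCoord i (π x')) (c (q x')), s',
    ⟨⟨hxB, ?_⟩, hi⟩, morOn_affine ho fun j => ?_, morOn_of_subtype hoD ?_,
    fun x' hx' => ⟨?_, ?_⟩, fun z hz => ⟨⟨?_, ?_⟩, ?_⟩, fun x' hx' => ?_, fun z hz => ?_⟩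
  · simpa [q, hxB] using hy
  · refine Fin.cases ?_ (fun j => ?_) j
    · simp only [Fin.cons_zero]
      exact S.restrict (hπ.2 _ _ (reg_projCoord i)) ho Set.inter_subset_right
    · simp only [Fin.cons_succ]
      have h1 := hcq.reg _ _ (affine_coord j)
      rw [Set.preimage_univ, Set.inter_univ] at h1
      exact S.restrict h1 ho Set.inter_subset_left
  · have h1 : IsMorphism ((affine (Fin (n + 1))).induced ((↑) : D' → (Fin (n + 1) → ℂ)))
        (projLine.induced ((↑) : B → _)) fun z => ⟨projPoint i (z.1 0), z.2.1⟩ :=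
      IsMorphism.induced_lift (hpt.comp (isMorphism_induced _ _))
    have h2 := (hst.mono hoD Set.inter_subset_right).subtype
    convert (isMorphism_induced S ((↑) : (π ⁻¹' B : Set X) → X)).comp
      (he.2.comp (h1.prodMk h2)) using 1
    funext z
    exact hs'e z.1 z.2.1
  · change projPoint i (projCoord i (π x')) ∈ B
    rw [projPoint_projCoord hx'.2]
    exact hx'.1.1
  · simpa using hcV hx'.1.2
  · change π (s' z) ∈ B
    rw [hπs z hz.1]
    exact hz.1
  · change q (s' z) ∈ V
    rw [hqs z hz.1]
    exact hsD hz.2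
  · rw [Set.mem_preimage, hπs z hz.1]
    exact projPoint_mem _ _
  · have h1 : projPoint i (projCoord i (π x')) = π x' := projPoint_projCoord hx'.2
    have h2 : π x' ∈ B := hx'.1.1
    have h3 := hs'e (Fin.cons (projCoord i (π x')) (c (q x'))) (by simpa [h1] using h2)
    rw [h3]
    simp only [Fin.tail_cons, hsc _ hx'.1.2, Fin.cons_zero, h1]
    rw [← hqe x' h2, Equiv.symm_apply_apply]
  · simp only [hπs z hz.1, projCoord_projPoint, hqs z hz.1, hcs _ hz.2, Fin.cons_self_tail]

theorem IsIteratedBundle.locallyAffine {ℓ : ℕ} {X : Type} {S : FunSpace X}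
    (h : IsIteratedBundle ℓ S) : LocallyAffine ℓ S := by
  induction ℓ generalizing X with
  | zero =>
    obtain ⟨u⟩ := h
    intro x
    refine ⟨Set.univ, Set.univ, fun _ => Fin.elim0, fun _ => x, trivial,
      morOn_affine S.top.isOpen_univ fun j => j.elim0, morOn_univ.2 (isMorphism_const x),
      fun _ _ => trivial, fun _ _ => trivial, fun _ _ => Subsingleton.elim _ _,
      fun _ _ => Subsingleton.elim _ _⟩
  | succ ℓ ih =>
    obtain ⟨F, SF, π, hπ, hF⟩ := h
    exact LocallyAffine.of_isFiberBundle hπ (ih hF)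

end FunSpace

/-! ### Nilpotent endomorphisms with two Jordan blocks that are skew for a symmetric form -/

section SkewPair

set_option linter.unusedSectionVars false

open Module

variable {V : Type*} [AddCommGroup V] [Module ℂ V] [FiniteDimensional ℂ V]

theorem finrank_map_add_inf_ker {W : Type*} [AddCommGroup W] [Module ℂ W] (f : V →ₗ[ℂ] W)
    (S : Submodule ℂ V) :
    finrank ℂ (S.map f) + finrank ℂ (S ⊓ LinearMap.ker f : Submodule ℂ V) = finrank ℂ S := by
  have h := LinearMap.finrank_range_add_finrank_ker (f.domRestrict S)
  rw [LinearMap.range_domRestrict, LinearMap.ker_domRestrict] at h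
  have h2 : finrank ℂ ((LinearMap.ker f).comap S.subtype) =
      finrank ℂ (S ⊓ LinearMap.ker f : Submodule ℂ V) := by
    rw [← Submodule.map_comap_subtype]
    exact (LinearEquiv.finrank_eq (Submodule.equivMapOfInjective _ S.subtype_injective _))
  omega

theorem finrank_le_map_add_ker {W : Type*} [AddCommGroup W] [Module ℂ W] (f : V →ₗ[ℂ] W)
    (S : Submodule ℂ V) : finrank ℂ S ≤ finrank ℂ (S.map f) + finrank ℂ (LinearMap.ker f) := by
  rw [← finrank_map_add_inf_ker f S]
  exact Nat.add_le_add_left (Submodule.finrank_mono inf_le_right) _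

variable {x : Module.End ℂ V} {B : LinearMap.BilinForm ℂ V}

theorem comap_pow_add (x : Module.End ℂ V) (U : Submodule ℂ V) (a b : ℕ) :
    U.comap (x ^ (a + b)) = (U.comap (x ^ a)).comap (x ^ b) := by
  rw [pow_add]; rfl

theorem map_pow_add (x : Module.End ℂ V) (U : Submodule ℂ V) (a b : ℕ) :
    U.map (x ^ (a + b)) = (U.map (x ^ b)).map (x ^ a) := by
  rw [pow_add]
  exact Submodule.map_comp _ _ _

/-- Each preimage under `x` raises the dimension by at most `dim ker x ≤ 2`. The cases of equality
drive all later arguments. -/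
theorem finrank_comap_pow_le (hx : finrank ℂ (LinearMap.ker x) ≤ 2) (U : Submodule ℂ V) (s : ℕ) :
    finrank ℂ (U.comap (x ^ s)) ≤ finrank ℂ U + 2 * s := by
  induction s with
  | zero =>
    have h : U.comap (x ^ 0) = U := by
      ext
      simp
    rw [h]
    omega
  | succ s ih =>
    rw [comap_pow_add, pow_one]
    have h1 := finrank_le_map_add_ker x ((U.comap (x ^ s)).comap x)
    have h2 := Submodule.finrank_mono (Submodule.map_comap_le x (U.comap (x ^ s)))
    omega

/-- If the preimage of `W` under a power of `x` has the maximal possible dimension, then `W`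
lies in the image of this power. -/
theorem le_range_of_finrank_comap (hx : finrank ℂ (LinearMap.ker x) ≤ 2) {W : Submodule ℂ V}
    {s : ℕ} (h : finrank ℂ W + 2 * s ≤ finrank ℂ (W.comap (x ^ s))) :
    W ≤ LinearMap.range (x ^ s) := by
  have h1 := finrank_le_map_add_ker (x ^ s) (W.comap (x ^ s))
  rw [Submodule.map_comap_eq] at h1
  have h2 : finrank ℂ (LinearMap.ker (x ^ s)) ≤ 2 * s := by
    have := finrank_comap_pow_le hx ⊥ s
    rwa [finrank_bot, zero_add] at this
  have h3 := Submodule.eq_of_le_of_finrank_le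
    (inf_le_right : LinearMap.range (x ^ s) ⊓ W ≤ W) (by omega)
  exact inf_eq_right.1 h3

/-- A nilpotent endomorphism `x` with kernel of dimension at most two that is skew for a
nondegenerate symmetric bilinear form `B`. -/
structure IsSkewPair (x : Module.End ℂ V) (B : LinearMap.BilinForm ℂ V) : Prop where
  skew : ∀ u v, B (x u) v = - B u (x v)
  symm : ∀ u v, B u v = B v u
  nondeg : B.Nondegenerate
  finrank_ker : finrank ℂ (LinearMap.ker x) ≤ 2

namespace IsSkewPair

variable (h : IsSkewPair x B)
include h

theorem isRefl : B.IsRefl := fun u v huv => by rw [h.symm, huv]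

theorem pow_apply (s : ℕ) (u v : V) : B ((x ^ s) u) v = (-1) ^ s * B u ((x ^ s) v) := by
  induction s generalizing u v with
  | zero => simp
  | succ s ih =>
    rw [pow_succ', Module.End.mul_apply, h.skew, ih, ← pow_succ', pow_succ x s,
      Module.End.mul_apply]
    ring

/-- An odd power of a skew endomorphism is skew, so `B u (x^s u)` equals its own negative by
symmetry of `B`. -/
theorem odd_pow_self {s : ℕ} (hs : Odd s) (u : V) : B u ((x ^ s) u) = 0 := by
  have h1 := h.pow_apply s u u
  rw [h.symm, hs.neg_one_pow] at h1
  have h2 : 2 * B u ((x ^ s) u) = 0 := by linear_combination h1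
  simpa using h2

theorem finrank_orthogonal (U : Submodule ℂ V) :
    finrank ℂ (B.orthogonal U) + finrank ℂ U = finrank ℂ V := by
  have := LinearMap.BilinForm.finrank_orthogonal h.nondeg U
  have := U.finrank_le
  omega

theorem orthogonal_orthogonal (U : Submodule ℂ V) : B.orthogonal (B.orthogonal U) = U :=
  LinearMap.BilinForm.orthogonal_orthogonal h.nondeg h.isRefl U

theorem orthogonal_map_pow (U : Submodule ℂ V) (s : ℕ) :
    B.orthogonal (U.map (x ^ s)) = (B.orthogonal U).comap (x ^ s) := by
  ext v
  simp only [LinearMap.BilinForm.mem_orthogonal_iff, Submodule.mem_map, Submodule.mem_comap,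
    forall_exists_index, and_imp, forall_apply_eq_imp_iff₂, h.pow_apply]
  refine forall₂_congr fun u _ => ?_
  simp

theorem orthogonal_comap_pow (U : Submodule ℂ V) (s : ℕ) :
    B.orthogonal (U.comap (x ^ s)) = (B.orthogonal U).map (x ^ s) := by
  rw [← h.orthogonal_orthogonal ((B.orthogonal U).map (x ^ s)), h.orthogonal_map_pow,
    h.orthogonal_orthogonal]

/-- The hypothesis gives `U^⊥ ⊆ x^{-r}U`, and `dim U^⊥ = dim U + 2r` is already the largest
dimension possible for `x^{-r}U`. Good subspaces are recorded through this inclusion. -/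
theorem orthogonal_eq_of_map_le {U : Submodule ℂ V} {r : ℕ}
    (hr : 2 * (finrank ℂ U + r) = finrank ℂ V) (hU : (B.orthogonal U).map (x ^ r) ≤ U) :
    B.orthogonal U = U.comap (x ^ r) := by
  refine Submodule.eq_of_le_of_finrank_le (Submodule.map_le_iff_le_comap.1 hU) ?_
  have := finrank_comap_pow_le h.finrank_ker U r
  have := h.finrank_orthogonal U
  omega

/-- Since `x^{-r}U = U^⊥` has the maximal dimension `dim U + 2r` and each of the `r` preimages gains
at most `2`, every one of them gains exactly `2`. -/
theorem finrank_comap_of_map_le {U : Submodule ℂ V} {r s : ℕ}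
    (hr : 2 * (finrank ℂ U + r) = finrank ℂ V) (hU : (B.orthogonal U).map (x ^ r) ≤ U)
    (hs : s ≤ r) : finrank ℂ (U.comap (x ^ s)) = finrank ℂ U + 2 * s := by
  refine le_antisymm (finrank_comap_pow_le h.finrank_ker U s) ?_
  have h1 := h.finrank_orthogonal U
  rw [h.orthogonal_eq_of_map_le hr hU, ← Nat.add_sub_of_le hs, comap_pow_add] at h1
  have h2 := finrank_comap_pow_le h.finrank_ker (U.comap (x ^ s)) (r - s)
  omega

/-- As `(x^{-s}U)^⊥ = x^s(U^⊥)`, the claim becomes the hypothesis after applying `x^s` once more.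
Goodness thus passes through an unmarked cup of half length `s`. -/
theorem map_orthogonal_comap_le {U : Submodule ℂ V} {q s : ℕ}
    (hU : (B.orthogonal U).map (x ^ (q + 2 * s)) ≤ U) :
    (B.orthogonal (U.comap (x ^ s))).map (x ^ q) ≤ U.comap (x ^ s) := by
  rw [h.orthogonal_comap_pow, ← Submodule.map_le_iff_le_comap, ← map_pow_add, ← map_pow_add]
  rwa [show s + q + s = q + 2 * s by ring]

/-! ### The relation imposed by a marked cup -/

omit h in
/-- The subspace cut out by the relation of a marked cup. -/
def markedSpace (x : Module.End ℂ V) (B : LinearMap.BilinForm ℂ V) (U T : Submodule ℂ V)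
    (s q : ℕ) (f y : V) : Submodule ℂ V :=
  T.comap (x ^ s) ⊓ U.comap ((2 : ℂ) • (B y).smulRight f - B y ((x ^ q) y) • x ^ s)

omit h in
omit [FiniteDimensional ℂ V] in
theorem mem_markedSpace {U T : Submodule ℂ V} {s q : ℕ} {f y w : V} :
    w ∈ markedSpace x B U T s q f y ↔ (x ^ s) w ∈ T ∧
      (2 * B y w) • f - B y ((x ^ q) y) • (x ^ s) w ∈ U := by
  simp [markedSpace, smul_smul]

variable {U T : Submodule ℂ V} {s q : ℕ} {f y : V}

/-- Otherwise `y` is orthogonal to the good subspace `N = x^{-s}U`. Then `y ∈ N^⊥ = x^{-q}N =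
x^{-(s+q)}U`, so that `f = x^{s+q}y` lies in `U`. -/
theorem exists_pair_ne_zero
    (hdim : 2 * (finrank ℂ U + (q + 2 * s)) = finrank ℂ V)
    (hgood : (B.orthogonal U).map (x ^ (q + 2 * s)) ≤ U) (hf : f ∉ U)
    (hy : (x ^ (s + q)) y = f) : ∃ ν, (x ^ s) ν ∈ U ∧ B y ν ≠ 0 := by
  by_contra! h1
  have h2 : y ∈ B.orthogonal (U.comap (x ^ s)) := by
    rw [LinearMap.BilinForm.mem_orthogonal_iff]
    intro ν hν
    rw [h.symm]
    exact h1 ν hν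
  have h3 := h.finrank_comap_of_map_le hdim hgood (s := s) (by omega)
  rw [h.orthogonal_eq_of_map_le (r := q) (by omega) (h.map_orthogonal_comap_le hgood),
    ← comap_pow_add] at h2
  exact hf (hy ▸ h2)

/-- For `ν ∈ x^{-s}U` the second condition of `markedSpace` reduces to `2 B(y, ν) f ∈ U`, which
fails for the vector of `exists_pair_ne_zero`. -/
theorem comap_not_le_markedSpace
    (hdim : 2 * (finrank ℂ U + (q + 2 * s)) = finrank ℂ V)
    (hgood : (B.orthogonal U).map (x ^ (q + 2 * s)) ≤ U) (hf : f ∉ U)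
    (hy : (x ^ (s + q)) y = f) : ¬ U.comap (x ^ s) ≤ markedSpace x B U T s q f y := by
  intro hle
  obtain ⟨ν, hν, hν0⟩ := h.exists_pair_ne_zero hdim hgood hf hy
  have h1 := (mem_markedSpace.1 (hle hν)).2
  have h2 := add_mem h1 (U.smul_mem (B y ((x ^ q) y)) hν)
  rw [sub_add_cancel] at h2
  exact hf ((U.smul_mem_iff (mul_ne_zero two_ne_zero hν0)).1 h2)

/-- `markedSpace` is a proper subspace of `x^{-s}T`, because it misses part of `x^{-s}U`, and
`x^{-s}T` has dimension at most `dim U + 1 + 2s`. -/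
theorem finrank_markedSpace_le
    (hdim : 2 * (finrank ℂ U + (q + 2 * s)) = finrank ℂ V)
    (hgood : (B.orthogonal U).map (x ^ (q + 2 * s)) ≤ U) (hUT : U ≤ T)
    (hT : finrank ℂ T = finrank ℂ U + 1) (hf : f ∉ U) (hy : (x ^ (s + q)) y = f) :
    finrank ℂ (markedSpace x B U T s q f y) ≤ finrank ℂ U + 2 * s := by
  have h1 : markedSpace x B U T s q f y < T.comap (x ^ s) := by
    refine lt_of_le_of_ne inf_le_left fun heq => ?_
    refine h.comap_not_le_markedSpace (T := T) hdim hgood hf hy ?_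
    rw [heq]
    exact Submodule.comap_mono hUT
  have h2 := Submodule.finrank_lt_finrank_of_lt h1
  have h3 := finrank_comap_pow_le h.finrank_ker T s
  omega

omit h in
theorem eq_sup_span (hUT : U ≤ T) (hT : finrank ℂ T = finrank ℂ U + 1) (hfT : f ∈ T)
    (hf : f ∉ U) : U ⊔ Submodule.span ℂ {f} = T := by
  refine Submodule.eq_of_le_of_finrank_le
    (sup_le hUT ((Submodule.span_singleton_le_iff_mem _ _).2 hfT)) ?_
  have h1 : U < U ⊔ Submodule.span ℂ {f} := by
    refine lt_of_le_of_ne le_sup_left fun h => hf ?_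
    rw [h]
    exact Submodule.mem_sup_right (Submodule.mem_span_singleton_self f)
  have := Submodule.finrank_lt_finrank_of_lt h1
  omega

/-- Where the quadratic relation becomes linear. Write `w = x^q w'` for `w ∈ L` and `x^s w ≡ τ f`
modulo `U`. From `w' ∈ x^{-q}L = L^⊥` comes `B(x^q w', w') = 0`. Likewise `w' - τ y` lies in
`x^{-q}N = N^⊥` for `N = x^{-s}U`, so `B(x^q(w' - τ y), w' - τ y) = 0`. For even `q` the expansion
gives `τ (τ B(y, x^q y) - 2 B(y, w)) = 0`, and dividing by `τ ≠ 0` leaves a linear condition on `w`.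
-/
theorem le_markedSpace {L : Submodule ℂ V}
    (hdim : 2 * (finrank ℂ U + (q + 2 * s)) = finrank ℂ V) (hq : Even q)
    (hgood : (B.orthogonal U).map (x ^ (q + 2 * s)) ≤ U) (hUT : U ≤ T)
    (hT : finrank ℂ T = finrank ℂ U + 1) (hfT : f ∈ T) (hf : f ∉ U) (hy : (x ^ (s + q)) y = f)
    (hL : finrank ℂ L = finrank ℂ U + 2 * s) (h1 : U ⊔ L.map (x ^ s) = T)
    (h2 : B.orthogonal L = L.comap (x ^ q)) : L ≤ markedSpace x B U T s q f y := by
  -- `x^{-q}L = L^⊥` has dimension `dim L + 2q`, the maximum.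
  have hLr : L ≤ LinearMap.range (x ^ q) := by
    refine le_range_of_finrank_comap h.finrank_ker ?_
    have := h.finrank_orthogonal L
    rw [h2] at this
    omega
  have hLT : ∀ w ∈ L, (x ^ s) w ∈ T := fun w hw => by
    rw [← h1]
    exact Submodule.mem_sup_right (Submodule.mem_map_of_mem hw)
  have hN := h.finrank_comap_of_map_le hdim hgood (s := s) (by omega)
  have hNo := h.orthogonal_eq_of_map_le (r := q) (by omega) (h.map_orthogonal_comap_le hgood)
  have key : ∀ w ∈ L, (x ^ s) w ∉ U → w ∈ markedSpace x B U T s q f y := by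
    intro w hw hwU
    refine mem_markedSpace.2 ⟨hLT w hw, ?_⟩
    obtain ⟨w', rfl⟩ := hLr hw
    have h3 := hLT _ hw
    rw [← eq_sup_span hUT hT hfT hf, Submodule.mem_sup] at h3
    obtain ⟨u, hu, v, hv, huv⟩ := h3
    obtain ⟨τ, rfl⟩ := Submodule.mem_span_singleton.1 hv
    have hτ : τ ≠ 0 := by
      rintro rfl
      rw [zero_smul, add_zero] at huv
      exact hwU (huv ▸ hu)
    have h4 : B ((x ^ q) w') w' = 0 := by
      have h5 : w' ∈ B.orthogonal L := by
        rw [h2]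
        exact hw
      exact (LinearMap.BilinForm.mem_orthogonal_iff.1 h5) _ hw
    have h6 : (x ^ q) (w' - τ • y) ∈ U.comap (x ^ s) := by
      rw [Submodule.mem_comap, ← Module.End.mul_apply, ← pow_add, map_sub, map_smul, hy, pow_add,
        Module.End.mul_apply, ← huv, add_sub_cancel_right]
      exact hu
    have h7 : w' - τ • y ∈ B.orthogonal (U.comap (x ^ s)) := by
      rw [hNo]
      exact h6
    have h8 := (LinearMap.BilinForm.mem_orthogonal_iff.1 h7) _ h6
    have h9 : B ((x ^ q) y) w' = B y ((x ^ q) w') := by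
      rw [h.pow_apply, hq.neg_one_pow, one_mul]
    have h10 : τ * B y ((x ^ q) y) = 2 * B y ((x ^ q) w') := by
      simp only [map_sub, map_smul, LinearMap.sub_apply, LinearMap.smul_apply, smul_eq_mul, h4, h9,
        h.symm ((x ^ q) w') y, h.symm ((x ^ q) y) y] at h8
      refine mul_left_cancel₀ hτ ?_
      linear_combination h8
    rw [← h10, ← huv, smul_add, smul_smul, mul_comm τ]
    have : (B y ((x ^ q) y) * τ) • f - (B y ((x ^ q) y) • u + (B y ((x ^ q) y) * τ) • f) =
        - (B y ((x ^ q) y) • u) := by abel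
    rw [this]
    exact neg_mem (U.smul_mem _ hu)
  -- Vectors with `τ = 0` are differences of two vectors with `τ ≠ 0`, once one of the latter is
  -- known to exist.
  obtain ⟨l, hl, hlU⟩ : ∃ l ∈ L, (x ^ s) l ∉ U := by
    by_contra! h3
    have h4 : U ⊔ L.map (x ^ s) ≤ U := sup_le le_rfl (Submodule.map_le_iff_le_comap.2 h3)
    rw [h1] at h4
    have := Submodule.finrank_mono h4
    omega
  intro w hw
  by_cases hwU : (x ^ s) w ∈ U
  · have h3 := key (l + w) (add_mem hl hw) fun h4 => hlU (by
      rw [map_add] at h4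
      exact (U.add_mem_iff_left hwU).1 h4)
    exact (Submodule.add_mem_iff_right _ (key l hl hlU)).1 h3
  · exact key w hw hwU

theorem eq_markedSpace {L : Submodule ℂ V}
    (hdim : 2 * (finrank ℂ U + (q + 2 * s)) = finrank ℂ V)
    (hgood : (B.orthogonal U).map (x ^ (q + 2 * s)) ≤ U) (hUT : U ≤ T)
    (hT : finrank ℂ T = finrank ℂ U + 1) (hf : f ∉ U) (hy : (x ^ (s + q)) y = f)
    (hL : finrank ℂ L = finrank ℂ U + 2 * s) (h1 : L ≤ markedSpace x B U T s q f y) :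
    L = markedSpace x B U T s q f y :=
  Submodule.eq_of_le_of_finrank_le h1 (by
    rw [hL]
    exact h.finrank_markedSpace_le hdim hgood hUT hT hf hy)

/-- If the sum did not grow beyond `U`, then `L` would be all of `x^{-s}U` by dimension, which
`markedSpace` does not contain. This is the converse used for closedness. -/
theorem sup_map_eq_of_le_markedSpace {L : Submodule ℂ V}
    (hdim : 2 * (finrank ℂ U + (q + 2 * s)) = finrank ℂ V)
    (hgood : (B.orthogonal U).map (x ^ (q + 2 * s)) ≤ U) (hUT : U ≤ T)
    (hT : finrank ℂ T = finrank ℂ U + 1) (hf : f ∉ U) (hy : (x ^ (s + q)) y = f)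
    (hL : finrank ℂ L = finrank ℂ U + 2 * s) (h1 : L ≤ markedSpace x B U T s q f y) :
    U ⊔ L.map (x ^ s) = T := by
  have hle : U ⊔ L.map (x ^ s) ≤ T := sup_le hUT
    (Submodule.map_le_iff_le_comap.2 fun w hw => (mem_markedSpace.1 (h1 hw)).1)
  refine Submodule.eq_of_le_of_finrank_le hle ?_
  have h2 : U < U ⊔ L.map (x ^ s) := by
    refine lt_of_le_of_ne le_sup_left fun h3 => ?_
    have h4 : L ≤ U.comap (x ^ s) := by
      rw [← Submodule.map_le_iff_le_comap, h3]
      exact le_sup_right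
    have h5 := Submodule.eq_of_le_of_finrank_le h4 (by
      rw [hL]
      exact finrank_comap_pow_le h.finrank_ker U s)
    exact h.comap_not_le_markedSpace (T := T) hdim hgood hf hy (h5 ▸ h1)
  have := Submodule.finrank_lt_finrank_of_lt h2
  omega

/-- `f` lies in `x^{-1}U`, and going from `x^{-1}U` to its preimage under `x^a` still gains the
maximal `2a`. -/
theorem mem_range_of_good {r a : ℕ} (hr : 2 * (finrank ℂ U + r) = finrank ℂ V)
    (hgood : (B.orthogonal U).map (x ^ r) ≤ U) (hf : x f ∈ U) (ha : a < r) :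
    f ∈ LinearMap.range (x ^ a) := by
  have h1 : f ∈ U.comap (x ^ 1) := by simpa using hf
  refine le_range_of_finrank_comap h.finrank_ker ?_ h1
  have h2 := h.finrank_comap_of_map_le hr hgood (s := 1) (by omega)
  have h3 := h.finrank_comap_of_map_le hr hgood (s := 1 + a) (by omega)
  rw [comap_pow_add] at h3
  omega

end IsSkewPair

end SkewPair

/-! ### Two Jordan blocks modulo a subspace and their transvections -/

section JordanPair

open Module

set_option linter.unusedSectionVars false

variable {V : Type*} [AddCommGroup V] [Module ℂ V] [FiniteDimensional ℂ V]

/-- The vectors `gen 0` and `gen 1` generate two Jordan blocks of length `r` modulo `U`. -/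
structure JordanPair (x : Module.End ℂ V) (U : Submodule ℂ V) (r : ℕ) (gen : Fin 2 → V) : Prop where
  pos : 0 < r
  map_mem : ∀ u ∈ U, x u ∈ U
  pow_mem : ∀ i, (x ^ r) (gen i) ∈ U
  indep : ∀ c : Fin 2 → ℂ, ∑ i, c i • (x ^ (r - 1)) (gen i) ∈ U → c = 0

namespace JordanPair

variable {x : Module.End ℂ V} {U : Submodule ℂ V} {r : ℕ} {gen : Fin 2 → V}

theorem pow_mem_of_mem (h : JordanPair x U r gen) {u : V} (hu : u ∈ U) (a : ℕ) :
    (x ^ a) u ∈ U := by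
  induction a with
  | zero => simpa using hu
  | succ a ih =>
    rw [pow_succ', Module.End.mul_apply]
    exact h.map_mem _ ih

theorem pow_mem_of_le (h : JordanPair x U r gen) {a : ℕ} (ha : r ≤ a) (i : Fin 2) :
    (x ^ a) (gen i) ∈ U := by
  rw [← Nat.sub_add_cancel ha, pow_add, Module.End.mul_apply]
  exact h.pow_mem_of_mem (h.pow_mem i) _

/-- Applying `x^{r-1-a}` sends the terms of exponent above `a` into `U`, and those below `a` vanish
by induction. What remains is a combination of the two socle vectors, which are independent modulo
`U`. -/
theorem coeff_eq_zero (h : JordanPair x U r gen) (c : Fin 2 → ℕ → ℂ)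
    (hc : ∑ i, ∑ a ∈ Finset.range r, c i a • (x ^ a) (gen i) ∈ U) :
    ∀ a < r, ∀ i, c i a = 0 := by
  intro a
  induction a using Nat.strong_induction_on with
  | _ a ih =>
    intro ha
    have h1 := h.pow_mem_of_mem hc (r - 1 - a)
    simp only [map_sum, map_smul, ← Module.End.mul_apply, ← pow_add] at h1
    have h2 : ∀ i, ∑ b ∈ Finset.range r, c i b • (x ^ (r - 1 - a + b)) (gen i) -
        c i a • (x ^ (r - 1)) (gen i) ∈ U := by
      intro i
      rw [← Finset.sum_erase_add _ _ (Finset.mem_range.2 ha),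
        show r - 1 - a + a = r - 1 by omega, add_sub_cancel_right]
      refine Submodule.sum_mem _ fun b hb => ?_
      rw [Finset.mem_erase, Finset.mem_range] at hb
      rcases lt_or_gt_of_ne hb.1 with hba | hba
      · rw [ih b hba hb.2 i, zero_smul]
        exact zero_mem _
      · exact U.smul_mem _ (h.pow_mem_of_le (by omega) i)
    have h3 : ∑ i, c i a • (x ^ (r - 1)) (gen i) ∈ U := by
      have h4 := sub_mem h1 (Submodule.sum_mem U fun i (_ : i ∈ Finset.univ) => h2 i)
      rw [← Finset.sum_sub_distrib] at h4
      simpa using h4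
    exact fun i => congrFun (h.indep _ h3) i

/-- Coordinate functionals for the basis `x ^ a (gen i)`, `a < r`, of the preimage of `U` under
`x ^ r` modulo `U`. -/
theorem exists_coords (h : JordanPair x U r gen) (hx : finrank ℂ (LinearMap.ker x) ≤ 2) :
    ∃ A : Fin 2 → ℕ → (V →ₗ[ℂ] ℂ), (∀ i a, ∀ u ∈ U, A i a u = 0) ∧
      (∀ i j a b, a < r → b < r →
        A i a ((x ^ b) (gen j)) = if i = j ∧ a = b then 1 else 0) ∧
      ∀ w ∈ U.comap (x ^ r),
        w - ∑ i, ∑ a ∈ Finset.range r, A i a w • (x ^ a) (gen i) ∈ U := by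
  let b : Fin 2 × Fin r → V ⧸ U := fun z => U.mkQ ((x ^ z.2.val) (gen z.1))
  have hb : LinearIndependent ℂ b := by
    rw [Fintype.linearIndependent_iff]
    intro g hg z
    have h1 := h.coeff_eq_zero (fun i a => if ha : a < r then g (i, ⟨a, ha⟩) else 0) ?_ z.2 z.2.2 z.1
    · simpa using h1
    · rw [← Submodule.ker_mkQ U, LinearMap.mem_ker, ← hg, Fintype.sum_prod_type]
      simp only [map_sum, map_smul, b]
      refine Finset.sum_congr rfl fun i _ => ?_
      rw [Finset.sum_range]
      exact Finset.sum_congr rfl fun a _ => by simp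
  -- The `2r` vectors are independent in `x^{-r}U/U`, whose dimension is at most `2r`.
  have hspan : (U.comap (x ^ r)).map U.mkQ ≤ Submodule.span ℂ (Set.range b) := by
    have h1 : Submodule.span ℂ (Set.range b) ≤ (U.comap (x ^ r)).map U.mkQ := by
      rw [Submodule.span_le]
      rintro _ ⟨z, rfl⟩
      refine Submodule.mem_map_of_mem ?_
      rw [Submodule.mem_comap, ← Module.End.mul_apply, ← pow_add]
      exact h.pow_mem_of_le (by omega) _
    refine (Submodule.eq_of_le_of_finrank_le h1 ?_).ge
    rw [finrank_span_eq_card hb]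
    have h2 := finrank_map_add_inf_ker U.mkQ (U.comap (x ^ r))
    have h3 := finrank_comap_pow_le hx U r
    rw [Submodule.ker_mkQ, inf_eq_right.2 (fun u hu => h.pow_mem_of_mem hu r)] at h2
    simp only [Fintype.card_prod, Fintype.card_fin]
    omega
  obtain ⟨g, hg⟩ := LinearMap.exists_leftInverse_of_injective (Fintype.linearCombination ℂ b)
    (LinearMap.ker_eq_bot.2 hb.fintypeLinearCombination_injective)
  have hgb : ∀ c, g (∑ z, c z • b z) = c := fun c => by
    have := LinearMap.congr_fun hg c
    simpa [Fintype.linearCombination_apply] using this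
  have hgb' : ∀ z, g (b z) = Pi.single z 1 := fun z => by
    rw [← hgb (Pi.single z 1)]
    congr 1
    simp [Pi.single_apply]
  refine ⟨fun i a => if ha : a < r then
    (LinearMap.proj (i, (⟨a, ha⟩ : Fin r))).comp (g.comp U.mkQ) else 0, ?_, ?_, ?_⟩
  · intro i a u hu
    by_cases ha : a < r
    · have h1 : U.mkQ u = 0 := by simpa using hu
      simp only [dif_pos ha, LinearMap.comp_apply, h1, map_zero]
    · simp [ha]
  · intro i j a c ha hc
    have h1 := congrFun (hgb' (j, ⟨c, hc⟩)) (i, ⟨a, ha⟩)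
    simp only [ha, dif_pos, LinearMap.comp_apply, LinearMap.proj_apply]
    refine h1.trans ?_
    simp [Pi.single_apply, Prod.ext_iff]
  · intro w hw
    have h1 := hspan (Submodule.mem_map_of_mem hw)
    rw [Submodule.mem_span_range_iff_exists_fun] at h1
    obtain ⟨c, hc⟩ := h1
    refine (Submodule.Quotient.mk_eq_zero U).1 ?_
    change U.mkQ _ = 0
    rw [map_sub, sub_eq_zero, ← hc, Fintype.sum_prod_type, map_sum]
    refine Finset.sum_congr rfl fun i _ => ?_
    rw [Finset.sum_range, map_sum]
    refine Finset.sum_congr rfl fun a _ => ?_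
    have h2 := congrFun (hgb c) (i, a)
    rw [hc] at h2
    simp only [a.2, dif_pos, LinearMap.comp_apply, LinearMap.proj_apply, map_smul]
    rw [← h2]

/-- The data of a transvection of the two Jordan blocks and of the coordinates of the two socle
vectors. -/
structure Transvections (x : Module.End ℂ V) (U : Submodule ℂ V) (r : ℕ) (gen : Fin 2 → V)
    (η : Fin 2 → Module.End ℂ V) (α : Fin 2 → V →ₗ[ℂ] ℂ) : Prop where
  eq_zero : ∀ i, ∀ u ∈ U, η i u = 0
  sq : ∀ i v, η i (η i v) = 0
  mem : ∀ i v, η i v ∈ U.comap (x ^ r)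
  comm : ∀ i, ∀ w ∈ U.comap (x ^ r), x (η i w) - η i (x w) ∈ U
  skew : ∀ (B : LinearMap.BilinForm ℂ V), IsSkewPair x B → U.comap (x ^ r) ≤ B.orthogonal U →
    (∀ i c, Even c → B (gen i) ((x ^ c) (gen i)) = 0) →
    (∀ c, Even c → B (gen 0) ((x ^ c) (gen 1)) = 0) →
    ∀ i, ∀ v ∈ U.comap (x ^ r), ∀ w ∈ U.comap (x ^ r), B (η i v) w + B v (η i w) = 0
  coord_zero : ∀ i, ∀ u ∈ U, α i u = 0
  coord_gen : ∀ i j, α i ((x ^ (r - 1)) (gen j)) = if i = j then 1 else 0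
  coord_apply : ∀ i j v, α j (η i v) = if j = i then 0 else α i v
  sub_mem : ∀ w, x w ∈ U → w - ∑ i, α i w • (x ^ (r - 1)) (gen i) ∈ U

/-- On `x^{-r}U/U = ℂ² ⊗ ℂ[x]/(x^r)` the map `η i` is the elementary matrix taking `gen i` to `gen
(1 - i)`, extended `ℂ[x]`-linearly. The coordinate functionals `A` define it on all of `V`. The
functional `α i` reads off the coefficient of the socle vector `x^{r-1} (gen i)`. Skewness holds
because each generator pairs trivially with its own powers and the two generators pair only through
odd powers of `x`. So the form is a product of two alternating forms, for which elements of `sl₂`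
are skew. -/
theorem exists_transvections (h : JordanPair x U r gen) (hx : finrank ℂ (LinearMap.ker x) ≤ 2) :
    ∃ η α, Transvections x U r gen η α := by
  obtain ⟨A, hA0, hA, hAs⟩ := h.exists_coords hx
  have hpos := h.pos
  have hDmem : ∀ i a, (x ^ a) (gen i) ∈ U.comap (x ^ r) := fun i a => by
    rw [Submodule.mem_comap, ← Module.End.mul_apply, ← pow_add]
    exact h.pow_mem_of_le (by omega) _
  -- An induction principle: a subspace that contains `U` and all the vectors `x^a (gen i)` contains
  -- `x^{-r}U`.
  have hind : ∀ S : Submodule ℂ V, U ≤ S → (∀ i, ∀ a < r, (x ^ a) (gen i) ∈ S) →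
      U.comap (x ^ r) ≤ S := by
    intro S hU hS w hw
    have h1 : ∑ i, ∑ a ∈ Finset.range r, A i a w • (x ^ a) (gen i) ∈ S :=
      Submodule.sum_mem _ fun i _ => Submodule.sum_mem _ fun a ha =>
        S.smul_mem _ (hS i a (Finset.mem_range.1 ha))
    have h2 := add_mem (hU (hAs w hw)) h1
    rwa [sub_add_cancel] at h2
  let η : Fin 2 → Module.End ℂ V := fun i =>
    ∑ a ∈ Finset.range r, (A i a).smulRight ((x ^ a) (gen (1 - i)))
  have hη : ∀ i v, η i v = ∑ a ∈ Finset.range r, A i a v • (x ^ a) (gen (1 - i)) := fun i v => by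
    simp [η]
  have hne : ∀ i : Fin 2, i ≠ 1 - i := by decide
  have heq : ∀ i j : Fin 2, j ≠ i → j = 1 - i := by decide
  have hηU : ∀ i, ∀ u ∈ U, η i u = 0 := fun i u hu => by
    rw [hη]
    exact Finset.sum_eq_zero fun a _ => by rw [hA0 i a u hu, zero_smul]
  have hηg : ∀ i, ∀ a < r, η i ((x ^ a) (gen i)) = (x ^ a) (gen (1 - i)) := fun i a ha => by
    rw [hη, Finset.sum_eq_single_of_mem a (Finset.mem_range.2 ha)]
    · simp [hA i i a a ha ha]
    · intro b hb hba
      simp [hA i i b a (Finset.mem_range.1 hb) ha, hba]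
  have hηg' : ∀ i, ∀ a < r, η i ((x ^ a) (gen (1 - i))) = 0 := fun i a ha => by
    rw [hη]
    refine Finset.sum_eq_zero fun b hb => ?_
    rw [hA i (1 - i) b a (Finset.mem_range.1 hb) ha, if_neg fun h => hne i h.1, zero_smul]
  have hηr : ∀ i, ∀ a, r ≤ a → ∀ j, η i ((x ^ a) (gen j)) = 0 := fun i a ha j =>
    hηU i _ (h.pow_mem_of_le ha j)
  have hcg : ∀ i j, ∀ a < r, x (η i ((x ^ a) (gen j))) - η i (x ((x ^ a) (gen j))) ∈ U := by
    intro i j a ha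
    rw [← Module.End.mul_apply x (x ^ a), ← pow_succ']
    by_cases hij : j = i
    · subst hij
      rw [hηg _ _ ha, ← Module.End.mul_apply x (x ^ a), ← pow_succ']
      by_cases ha' : a + 1 < r
      · rw [hηg _ _ ha', sub_self]
        exact zero_mem _
      · rw [hηr _ _ (by omega), sub_zero]
        exact h.pow_mem_of_le (by omega) _
    · rw [heq i j hij, hηg' _ _ ha, map_zero, zero_sub]
      by_cases ha' : a + 1 < r
      · rw [hηg' _ _ ha', neg_zero]
        exact zero_mem _
      · rw [hηr _ _ (by omega), neg_zero]
        exact zero_mem _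
  have hmem : ∀ i v, η i v ∈ U.comap (x ^ r) := fun i v => by
    rw [hη]
    exact Submodule.sum_mem _ fun a _ => Submodule.smul_mem _ _ (hDmem _ _)
  refine ⟨η, fun i => A i (r - 1), hηU, fun i v => ?_, hmem, fun i => ?_, ?_,
    fun i => hA0 i _, fun i j => ?_, fun i j v => ?_, fun w hw => ?_⟩
  · rw [hη i v, map_sum]
    refine Finset.sum_eq_zero fun a ha => ?_
    rw [map_smul, hηg' _ _ (Finset.mem_range.1 ha), smul_zero]
  · have h1 := hind (U.comap (x * η i - η i * x)) (fun u hu => ?_) fun j a ha => ?_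
    · exact fun w hw => by simpa using h1 hw
    · simp [hηU i u hu, hηU i _ (h.map_mem u hu)]
    · simpa using hcg i j a ha
  · intro B hB hD hBs hB01 i
    have hBx : ∀ j c, B (gen j) ((x ^ c) (gen j)) = 0 := fun j c => by
      rcases Nat.even_or_odd c with hc | hc
      · exact hBs j c hc
      · exact hB.odd_pow_self hc _
    have hBne : ∀ j j' c, Even c → B (gen j) ((x ^ c) (gen j')) = 0 := by
      intro j j' c hc
      have h01 : ∀ j j' : Fin 2, j = j' ∨ (j = 0 ∧ j' = 1) ∨ (j = 1 ∧ j' = 0) := by decide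
      rcases h01 j j' with rfl | ⟨rfl, rfl⟩ | ⟨rfl, rfl⟩
      · exact hBx _ _
      · exact hB01 c hc
      · rw [hB.symm, hB.pow_apply, hB01 c hc, mul_zero]
    have hU0 : ∀ u ∈ U, ∀ w ∈ U.comap (x ^ r), B u w = 0 := fun u hu w hw =>
      (LinearMap.BilinForm.mem_orthogonal_iff.1 (hD hw)) u hu
    have hgg : ∀ j j' a b, a < r → b < r →
        B (η i ((x ^ a) (gen j))) ((x ^ b) (gen j')) +
          B ((x ^ a) (gen j)) (η i ((x ^ b) (gen j'))) = 0 := by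
      intro j j' a b ha hb
      have hp : ∀ j j', B ((x ^ a) (gen j)) ((x ^ b) (gen j')) =
          (-1) ^ a * B (gen j) ((x ^ (a + b)) (gen j')) := fun j j' => by
        rw [hB.pow_apply, pow_add, Module.End.mul_apply]
      by_cases hj : j = i <;> by_cases hj' : j' = i
      · subst hj hj'
        rw [hηg _ _ ha, hηg _ _ hb, hp, hp, ← mul_add]
        -- The only case in which two nonzero terms can meet. For odd exponents, symmetry of `B` and
        -- skewness of the odd power make them cancel.
        rcases Nat.even_or_odd (a + b) with hc | hc
        · rw [hBne _ _ _ hc, hBne _ _ _ hc, add_zero, mul_zero]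
        · rw [hB.symm (gen (1 - j')), hB.pow_apply, hc.neg_one_pow]
          ring
      · subst hj
        rw [heq j j' hj', hηg _ _ ha, hηg' _ _ hb, map_zero, hp, hBx, mul_zero, add_zero]
      · subst hj'
        rw [heq j' j hj, hηg _ _ hb, hηg' _ _ ha, map_zero, hp, hBx, mul_zero, LinearMap.zero_apply,
          add_zero]
      · rw [heq i j hj, heq i j' hj', hηg' _ _ ha, hηg' _ _ hb, map_zero, map_zero,
          LinearMap.zero_apply, add_zero]
    intro v hv w hw
    have hgw : ∀ j, ∀ a < r, B (η i ((x ^ a) (gen j))) w + B ((x ^ a) (gen j)) (η i w) = 0 := by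
      intro j a ha
      have h1 := hind (LinearMap.ker (B (η i ((x ^ a) (gen j))) + (B ((x ^ a) (gen j))).comp (η i)))
        (fun u hu => ?_) (fun j' b hb => ?_) hw
      · simpa using h1
      · rw [LinearMap.mem_ker, LinearMap.add_apply, LinearMap.comp_apply, hηU i u hu, map_zero,
          hB.symm, hU0 u hu _ (hmem i _), add_zero]
      · simpa using hgg j j' a b ha hb
    have h1 := hind (LinearMap.ker ((B.flip w).comp (η i) + B.flip (η i w)))
      (fun u hu => ?_) (fun j' b hb => ?_) hv
    · simpa using h1
    · rw [LinearMap.mem_ker, LinearMap.add_apply, LinearMap.comp_apply, hηU i u hu, map_zero,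
        zero_add]
      exact hU0 u hu _ (hmem i _)
    · simpa using hgw j' b hb
  · rw [hA i j _ _ (by omega) (by omega)]
    simp
  · rw [hη, map_sum]
    simp only [map_smul, smul_eq_mul]
    rw [Finset.sum_eq_single_of_mem (r - 1) (Finset.mem_range.2 (by omega))]
    · rw [hA _ _ _ _ (by omega) (by omega)]
      by_cases hji : j = i
      · subst hji
        simp [hne]
      · simp [heq i j hji, (hne i).symm]
    · intro b hb hbr
      rw [hA _ _ _ _ (by omega) (Finset.mem_range.1 hb), if_neg fun h => hbr h.2.symm, mul_zero]
  · have hwD : w ∈ U.comap (x ^ r) := by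
      rw [Submodule.mem_comap, ← Nat.sub_add_cancel hpos, pow_add, Module.End.mul_apply, pow_one]
      exact h.pow_mem_of_mem hw _
    -- On `x^{-r}U` the coefficient of `x^a (gen i)` in `w` is that of `x^{a+1} (gen i)` in `x w`.
    -- As `x w ∈ U`, only the top coefficients of `w` survive.
    have hAx : ∀ i a, a + 1 < r → A i a w = 0 := by
      intro i a ha
      have h1 := hind (LinearMap.ker ((A i (a + 1)).comp x - A i a)) (fun u hu => ?_)
        (fun j b hb => ?_) hwD
      · rw [LinearMap.mem_ker, LinearMap.sub_apply, LinearMap.comp_apply, hA0 _ _ _ hw,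
          zero_sub, neg_eq_zero] at h1
        exact h1
      · simp [hA0 _ _ u hu, hA0 _ _ _ (h.map_mem u hu)]
      · rw [LinearMap.mem_ker, LinearMap.sub_apply, LinearMap.comp_apply,
          ← Module.End.mul_apply x (x ^ b), ← pow_succ', hA i j a b (by omega) hb]
        by_cases hb' : b + 1 < r
        · rw [hA _ _ _ _ ha hb']
          simp
        · rw [hA0 _ _ _ (h.pow_mem_of_le (by omega) _), if_neg (by omega), sub_zero]
    have h1 := hAs w hwD
    convert h1 using 3 with i
    rw [Finset.sum_eq_single_of_mem (r - 1) (Finset.mem_range.2 (by omega))]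
    intro b hb hbr
    rw [Finset.mem_range] at hb
    rw [hAx i b (by omega), zero_smul]

/-- Generators of two Jordan blocks exist if the preimage of `U` under `x ^ s` has maximal
dimension. -/
theorem exists_of_finrank (hx : finrank ℂ (LinearMap.ker x) ≤ 2) {T : Submodule ℂ V} {s : ℕ}
    (hs : 0 < s) (hUT : U ≤ T) (hT : finrank ℂ T = finrank ℂ U + 1) (hTU : T.map x ≤ U)
    (hfin : finrank ℂ (U.comap (x ^ s)) = finrank ℂ U + 2 * s) :
    ∃ gen, JordanPair x U s gen ∧ (x ^ (s - 1)) (gen 0) ∈ T := by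
  have hs1 : 1 + (s - 1) = s := by omega
  have h1 := finrank_comap_pow_le hx (U.comap (x ^ 1)) (s - 1)
  have h2 := finrank_comap_pow_le hx U 1
  have h3 := hfin
  rw [← hs1, comap_pow_add] at h3
  -- Maximality after `s` steps forces it at each step, so all of `x^{-1}U` lies in the image of
  -- `x^{s-1}`, and both socle vectors can be divided by `x^{s-1}`.
  have hr := le_range_of_finrank_comap hx (W := U.comap (x ^ 1)) (s := s - 1) (by omega)
  have hTD : T ≤ U.comap (x ^ 1) := by
    rw [pow_one]
    exact Submodule.map_le_iff_le_comap.1 hTU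
  obtain ⟨b0, hb0, hb0'⟩ := SetLike.exists_of_lt (lt_of_le_of_ne hUT fun h => by
    rw [h] at hT
    omega)
  obtain ⟨b1, hb1, hb1'⟩ := SetLike.exists_of_lt (lt_of_le_of_ne hTD fun h => by
    rw [h] at hT
    omega)
  obtain ⟨g0, hg0⟩ := hr (hTD hb0)
  obtain ⟨g1, hg1⟩ := hr hb1
  have hsU : ∀ g, (x ^ (s - 1)) g ∈ U.comap (x ^ 1) → (x ^ s) g ∈ U := fun g hg => by
    rw [← hs1, pow_add]
    exact hg
  refine ⟨![g0, g1], ⟨hs, fun u hu => hTU (Submodule.mem_map_of_mem (hUT hu)), fun i => ?_,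
    fun c hc => ?_⟩, by simpa [hg0] using hb0⟩
  · fin_cases i
    · exact hsU _ (hg0 ▸ hTD hb0)
    · exact hsU _ (hg1 ▸ hb1)
  · simp only [Fin.sum_univ_two, Matrix.cons_val_zero, Matrix.cons_val_one, hg0, hg1] at hc
    have hc1 : c 1 = 0 := by
      by_contra h0
      have h5 := (T.add_mem_iff_right (T.smul_mem (c 0) hb0)).1 (hUT hc)
      exact hb1' ((T.smul_mem_iff h0).1 h5)
    rw [hc1, zero_smul, add_zero] at hc
    have hc0 : c 0 = 0 := by
      by_contra h0
      exact hb0' ((U.smul_mem_iff h0).1 hc)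
    ext i
    fin_cases i
    · exact hc0
    · exact hc1

end JordanPair

end JordanPair

/-! ### The nilpotent endomorphism and the form on `V_λ` -/

section Concrete

open Module

theorem eVec_zero (p k : ℕ) : eVec p k 0 = 0 := by
  ext (j | j) <;> simp [eVec]

theorem fVec_zero (p k : ℕ) : fVec p k 0 = 0 := by
  ext (j | j) <;> simp [fVec]

theorem eVec_succ {p : ℕ} (k : ℕ) (j : Fin p) :
    eVec p k (j + 1) = Pi.single (Sum.inl j) 1 := by
  ext (i | i) <;> simp [eVec, Pi.single_apply, Fin.ext_iff]

theorem fVec_succ (p : ℕ) {k : ℕ} (j : Fin k) :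
    fVec p k (j + 1) = Pi.single (Sum.inr j) 1 := by
  ext (i | i) <;> simp [fVec, Pi.single_apply, Fin.ext_iff]

theorem eVec_of_lt {p i : ℕ} (k : ℕ) (h : p < i) : eVec p k i = 0 := by
  ext (j | j)
  · simp only [eVec, Pi.zero_apply, ite_eq_right_iff, one_ne_zero, imp_false]
    omega
  · simp [eVec]

theorem fVec_of_lt (p : ℕ) {k i : ℕ} (h : k < i) : fVec p k i = 0 := by
  ext (j | j)
  · simp [fVec]
  · simp only [fVec, Pi.zero_apply, ite_eq_right_iff, one_ne_zero, imp_false]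
    omega

theorem nilp_eVec {p i : ℕ} (k : ℕ) (h : i ≤ p) : nilp p k (eVec p k i) = eVec p k (i - 1) := by
  rcases Nat.eq_zero_or_pos i with rfl | hi
  · simp [eVec_zero]
  · obtain ⟨j, rfl⟩ : ∃ j : Fin p, i = j + 1 := ⟨⟨i - 1, by omega⟩, by simp; omega⟩
    rw [eVec_succ, nilp, ← Pi.basisFun_apply, Basis.constr_basis]
    simp

theorem nilp_fVec (p : ℕ) {k i : ℕ} (h : i ≤ k) : nilp p k (fVec p k i) = fVec p k (i - 1) := by
  rcases Nat.eq_zero_or_pos i with rfl | hi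
  · simp [fVec_zero]
  · obtain ⟨j, rfl⟩ : ∃ j : Fin k, i = j + 1 := ⟨⟨i - 1, by omega⟩, by simp; omega⟩
    rw [fVec_succ, nilp, ← Pi.basisFun_apply, Basis.constr_basis]
    simp

theorem nilp_pow_eVec {p i : ℕ} (k : ℕ) (h : i ≤ p) (s : ℕ) :
    (nilp p k ^ s) (eVec p k i) = eVec p k (i - s) := by
  induction s with
  | zero => simp
  | succ s ih =>
    rw [pow_succ', Module.End.mul_apply, ih, nilp_eVec k (by omega), Nat.sub_sub]

theorem nilp_pow_fVec (p : ℕ) {k i : ℕ} (h : i ≤ k) (s : ℕ) :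
    (nilp p k ^ s) (fVec p k i) = fVec p k (i - s) := by
  induction s with
  | zero => simp
  | succ s ih =>
    rw [pow_succ', Module.End.mul_apply, ih, nilp_fVec p (by omega), Nat.sub_sub]

theorem idx_induction {p k : ℕ} {P : (Idx p k → ℂ) → Prop} (w : Idx p k → ℂ) (h0 : P 0)
    (hadd : ∀ u v, P u → P v → P (u + v))
    (he : ∀ j : Fin p, P (w (Sum.inl j) • eVec p k (j + 1)))
    (hf : ∀ j : Fin k, P (w (Sum.inr j) • fVec p k (j + 1))) : P w := by
  have hw : w = ∑ i, w i • (Pi.single i 1 : Idx p k → ℂ) := by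
    conv_lhs => rw [pi_eq_sum_univ' w]
  rw [hw]
  refine Finset.sum_induction _ P hadd h0 fun i _ => ?_
  rcases i with j | j
  · rw [← eVec_succ]; exact he j
  · rw [← fVec_succ]; exact hf j

theorem nilp_pow_inl {p k : ℕ} (s : ℕ) (w : Idx p k → ℂ) (j : Fin p) :
    (nilp p k ^ s) w (Sum.inl j) = if h : j.val + s < p then w (Sum.inl ⟨j + s, h⟩) else 0 := by
  refine idx_induction (P := fun w => (nilp p k ^ s) w (Sum.inl j) =
    if h : j.val + s < p then w (Sum.inl ⟨j + s, h⟩) else 0) w ?_ ?_ ?_ ?_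
  · simp
  · intro u v hu hv
    rw [map_add, Pi.add_apply, hu, hv]
    split_ifs <;> simp
  · intro i
    rw [map_smul, nilp_pow_eVec k (by omega)]
    simp only [eVec, Pi.smul_apply, smul_eq_mul]
    split_ifs <;> first | rfl | omega | simp
  · intro i
    rw [map_smul, nilp_pow_fVec p (by omega)]
    simp [fVec]

theorem nilp_pow_inr {p k : ℕ} (s : ℕ) (w : Idx p k → ℂ) (j : Fin k) :
    (nilp p k ^ s) w (Sum.inr j) = if h : j.val + s < k then w (Sum.inr ⟨j + s, h⟩) else 0 := by
  refine idx_induction (P := fun w => (nilp p k ^ s) w (Sum.inr j) =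
    if h : j.val + s < k then w (Sum.inr ⟨j + s, h⟩) else 0) w ?_ ?_ ?_ ?_
  · simp
  · intro u v hu hv
    rw [map_add, Pi.add_apply, hu, hv]
    split_ifs <;> simp
  · intro i
    rw [map_smul, nilp_pow_eVec k (by omega)]
    simp [eVec]
  · intro i
    rw [map_smul, nilp_pow_fVec p (by omega)]
    simp only [fVec, Pi.smul_apply, smul_eq_mul]
    split_ifs <;> first | rfl | omega | simp

theorem form_eVec_eVec (p k i j : ℕ) : form p k (eVec p k i) (eVec p k j) =
    if p ≠ k ∧ i + j = p + 1 ∧ 1 ≤ i ∧ 1 ≤ j then (-1) ^ (i - 1) else 0 := by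
  rcases Nat.eq_zero_or_pos i with rfl | hi
  · simp [eVec_zero]
  rcases Nat.eq_zero_or_pos j with rfl | hj
  · simp [eVec_zero]
  rcases lt_or_ge p i with hip | hip
  · rw [eVec_of_lt k hip, if_neg (by omega)]
    simp
  rcases lt_or_ge p j with hjp | hjp
  · rw [eVec_of_lt k hjp, if_neg (by omega)]
    simp
  obtain ⟨a, rfl⟩ : ∃ a : Fin p, i = a + 1 := ⟨⟨i - 1, by omega⟩, by simp; omega⟩
  obtain ⟨b, rfl⟩ : ∃ b : Fin p, j = b + 1 := ⟨⟨j - 1, by omega⟩, by simp; omega⟩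
  rw [eVec_succ, eVec_succ, form, Matrix.toBilin'_single, gram]
  by_cases h : p = k
  · simp [h]
  · simp only [h, if_false, Matrix.fromBlocks_apply₁₁, Jmat, Matrix.of_apply, Nat.add_sub_cancel]
    exact if_congr (by omega) rfl rfl

theorem form_fVec_fVec (p k i j : ℕ) : form p k (fVec p k i) (fVec p k j) =
    if p ≠ k ∧ i + j = k + 1 ∧ 1 ≤ i ∧ 1 ≤ j then (-1) ^ ((p + k) / 2) * (-1) ^ (i - 1) else 0 := by
  rcases Nat.eq_zero_or_pos i with rfl | hi
  · simp [fVec_zero]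
  rcases Nat.eq_zero_or_pos j with rfl | hj
  · simp [fVec_zero]
  rcases lt_or_ge k i with hip | hip
  · rw [fVec_of_lt p hip, if_neg (by omega)]
    simp
  rcases lt_or_ge k j with hjp | hjp
  · rw [fVec_of_lt p hjp, if_neg (by omega)]
    simp
  obtain ⟨a, rfl⟩ : ∃ a : Fin k, i = a + 1 := ⟨⟨i - 1, by omega⟩, by simp; omega⟩
  obtain ⟨b, rfl⟩ : ∃ b : Fin k, j = b + 1 := ⟨⟨j - 1, by omega⟩, by simp; omega⟩
  rw [fVec_succ, fVec_succ, form, Matrix.toBilin'_single, gram]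
  by_cases h : p = k
  · simp [h]
  · simp only [h, if_false, Matrix.fromBlocks_apply₂₂, Jmat, Matrix.of_apply, Nat.add_sub_cancel,
      Matrix.smul_apply, smul_eq_mul, mul_ite, mul_zero]
    exact if_congr (by omega) rfl rfl

theorem form_eVec_fVec (p k i j : ℕ) : form p k (eVec p k i) (fVec p k j) =
    if p = k ∧ i + j = k + 1 ∧ 1 ≤ i ∧ 1 ≤ j then (-1) ^ (i - 1) else 0 := by
  rcases Nat.eq_zero_or_pos i with rfl | hi
  · simp [eVec_zero]
  rcases Nat.eq_zero_or_pos j with rfl | hj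
  · simp [fVec_zero]
  rcases lt_or_ge p i with hip | hip
  · rw [eVec_of_lt k hip, if_neg (by omega)]
    simp
  rcases lt_or_ge k j with hjp | hjp
  · rw [fVec_of_lt p hjp, if_neg (by omega)]
    simp
  obtain ⟨a, rfl⟩ : ∃ a : Fin p, i = a + 1 := ⟨⟨i - 1, by omega⟩, by simp; omega⟩
  obtain ⟨b, rfl⟩ : ∃ b : Fin k, j = b + 1 := ⟨⟨j - 1, by omega⟩, by simp; omega⟩
  rw [eVec_succ, fVec_succ, form, Matrix.toBilin'_single, gram]
  by_cases h : p = k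
  · subst h
    simp only [if_true, Matrix.fromBlocks_apply₁₂, Jmat, Matrix.of_apply, Nat.add_sub_cancel]
    exact if_congr (by rw [true_and]; omega) rfl rfl
  · simp [h]

theorem form_fVec_eVec (p k i j : ℕ) :
    form p k (fVec p k i) (eVec p k j) = form p k (eVec p k j) (fVec p k i) := by
  rw [form_eVec_fVec]
  rcases Nat.eq_zero_or_pos i with rfl | hi
  · simp [fVec_zero]
  rcases Nat.eq_zero_or_pos j with rfl | hj
  · simp [eVec_zero]
  rcases lt_or_ge k i with hip | hip
  · rw [fVec_of_lt p hip, if_neg (by omega)]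
    simp
  rcases lt_or_ge p j with hjp | hjp
  · rw [eVec_of_lt k hjp, if_neg (by omega)]
    simp
  obtain ⟨a, rfl⟩ : ∃ a : Fin k, i = a + 1 := ⟨⟨i - 1, by omega⟩, by simp; omega⟩
  obtain ⟨b, rfl⟩ : ∃ b : Fin p, j = b + 1 := ⟨⟨j - 1, by omega⟩, by simp; omega⟩
  rw [fVec_succ, eVec_succ, form, Matrix.toBilin'_single, gram]
  by_cases h : p = k
  · subst h
    simp only [if_true, Matrix.fromBlocks_apply₂₁, Jmat, Matrix.of_apply, Nat.add_sub_cancel,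
      Matrix.transpose_apply]
    exact if_congr (by rw [true_and]; omega) rfl rfl
  · simp [h]

theorem Jmat_mul_transpose (r : ℕ) : Jmat r r * (Jmat r r).transpose = 1 := by
  ext a b
  have ha := a.2
  rw [Matrix.mul_apply, Finset.sum_eq_single (⟨r - 1 - a, by omega⟩ : Fin r)]
  · simp only [Jmat, Matrix.of_apply, Matrix.transpose_apply]
    by_cases hab : a = b
    · subst hab
      rw [if_pos (by omega), Matrix.one_apply_eq, ← mul_pow]
      simp
    · rw [if_neg (c := b.val + (r - 1 - a.val) + 1 = r), mul_zero, Matrix.one_apply_ne hab]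
      intro h
      exact hab (Fin.ext (by omega))
  · intro c _ hc
    simp only [Jmat, Matrix.of_apply, Matrix.transpose_apply]
    rw [if_neg, zero_mul]
    intro h
    exact hc (Fin.ext (by simp only; omega))
  · simp

theorem gram_mul_transpose (p k : ℕ) : gram p k * (gram p k).transpose = 1 := by
  unfold gram
  split_ifs with h
  · subst h
    have h2 : (Jmat p p).transpose * Jmat p p = 1 :=
      mul_eq_one_comm.1 (Jmat_mul_transpose p)
    simp [Matrix.fromBlocks_transpose, Matrix.fromBlocks_multiply, Jmat_mul_transpose, h2]
  · have h1 : ((-1 : ℂ) ^ ((p + k) / 2)) * (-1) ^ ((p + k) / 2) = 1 := by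
      rw [← mul_pow]
      simp
    simp [Matrix.fromBlocks_transpose, Matrix.fromBlocks_multiply, Jmat_mul_transpose,
      smul_smul, h1]

theorem form_nondegenerate (p k : ℕ) : (form p k).Nondegenerate := by
  refine LinearMap.BilinForm.nondegenerate_toBilin'_of_det_ne_zero' _ ?_
  intro h
  have := congrArg Matrix.det (gram_mul_transpose p k)
  rw [Matrix.det_mul, h, zero_mul, Matrix.det_one] at this
  exact zero_ne_one this

variable {p k : ℕ}

theorem IsTypeD.even_add (h : IsTypeD p k) : 2 * ((p + k) / 2) = p + k := by
  obtain ⟨-, -, rfl | ⟨⟨a, rfl⟩, b, rfl⟩⟩ := h <;> omega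

theorem bilin_ext {B B' : LinearMap.BilinForm ℂ (Idx p k → ℂ)}
    (hee : ∀ i j, 1 ≤ i → i ≤ p → 1 ≤ j → j ≤ p →
      B (eVec p k i) (eVec p k j) = B' (eVec p k i) (eVec p k j))
    (hef : ∀ i j, 1 ≤ i → i ≤ p → 1 ≤ j → j ≤ k →
      B (eVec p k i) (fVec p k j) = B' (eVec p k i) (fVec p k j))
    (hfe : ∀ i j, 1 ≤ i → i ≤ k → 1 ≤ j → j ≤ p →
      B (fVec p k i) (eVec p k j) = B' (fVec p k i) (eVec p k j))
    (hff : ∀ i j, 1 ≤ i → i ≤ k → 1 ≤ j → j ≤ k →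
      B (fVec p k i) (fVec p k j) = B' (fVec p k i) (fVec p k j)) : B = B' := by
  refine LinearMap.BilinForm.ext_basis (Pi.basisFun ℂ (Idx p k)) ?_
  rintro (i | i) (j | j) <;> simp only [Pi.basisFun_apply, ← eVec_succ, ← fVec_succ]
  · exact hee _ _ (by omega) i.2 (by omega) j.2
  · exact hef _ _ (by omega) i.2 (by omega) j.2
  · exact hfe _ _ (by omega) i.2 (by omega) j.2
  · exact hff _ _ (by omega) i.2 (by omega) j.2

theorem neg_one_pow_eq_of_even_add {a b : ℕ} (h : Even (a + b)) : (-1 : ℂ) ^ a = (-1) ^ b := by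
  rcases Nat.even_or_odd b with hb | hb
  · rw [hb.neg_one_pow, ((Nat.even_add.1 h).2 hb).neg_one_pow]
  · have ha : Odd a := by
      rw [← Nat.not_even_iff_odd] at hb ⊢
      exact fun ha => hb ((Nat.even_add.1 h).1 ha)
    rw [hb.neg_one_pow, ha.neg_one_pow]

theorem neg_one_pow_eq_neg {a b : ℕ} (h : Odd (a + b)) : (-1 : ℂ) ^ a = -(-1) ^ b := by
  have h1 : Even (a + (b + 1)) := by
    rw [← add_assoc]
    exact h.add_one
  rw [neg_one_pow_eq_of_even_add h1, pow_succ]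
  ring

/-- For `p ≠ k` the nonzero entries have `i + j = p + 1` or `i + j = k + 1` with `p`, `k` odd, so
`i` and `j` have the same parity. For `p = k` the symmetry is built into the block shape. -/
theorem form_symm (h : IsTypeD p k) (u v : Idx p k → ℂ) : form p k u v = form p k v u := by
  have hodd : p ≠ k → Odd p ∧ Odd k := fun hpk => h.2.2.resolve_left hpk
  have h1 : form p k = (form p k).flip := by
    refine bilin_ext (fun i j hi hi' hj hj' => ?_) (fun i j hi hi' hj hj' => ?_)
      (fun i j hi hi' hj hj' => ?_) (fun i j hi hi' hj hj' => ?_) <;>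
      rw [LinearMap.BilinForm.flip_apply]
    · rw [form_eVec_eVec, form_eVec_eVec]
      by_cases hc : p ≠ k ∧ i + j = p + 1
      · rw [if_pos (by omega), if_pos (by omega)]
        refine neg_one_pow_eq_of_even_add ?_
        obtain ⟨⟨a, ha⟩, -⟩ := hodd hc.1
        exact ⟨a, by omega⟩
      · rw [if_neg (by tauto), if_neg (by omega)]
    · rw [form_fVec_eVec]
    · rw [form_fVec_eVec]
    · rw [form_fVec_fVec, form_fVec_fVec]
      by_cases hc : p ≠ k ∧ i + j = k + 1
      · rw [if_pos (by omega), if_pos (by omega)]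
        congr 1
        refine neg_one_pow_eq_of_even_add ?_
        obtain ⟨-, a, ha⟩ := hodd hc.1
        exact ⟨a, by omega⟩
      · rw [if_neg (by tauto), if_neg (by omega)]
  conv_lhs => rw [h1]
  rfl

/-- Neighbouring antidiagonal entries of `J_r` have opposite signs, and `x` shifts an index by one
on either side. -/
theorem form_skew (u v : Idx p k → ℂ) :
    form p k (nilp p k u) v = - form p k u (nilp p k v) := by
  have hsgn : ∀ i, 2 ≤ i → (-1 : ℂ) ^ (i - 1 - 1) = -(-1) ^ (i - 1) := fun i hi =>
    neg_one_pow_eq_neg ⟨i - 2, by omega⟩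
  have h1 : (form p k).compLeft (nilp p k) = -((form p k).compRight (nilp p k)) := by
    refine bilin_ext (fun i j hi hi' hj hj' => ?_) (fun i j hi hi' hj hj' => ?_)
      (fun i j hi hi' hj hj' => ?_) (fun i j hi hi' hj hj' => ?_) <;>
      simp only [LinearMap.BilinForm.compLeft_apply, LinearMap.neg_apply,
        LinearMap.BilinForm.compRight_apply]
    · rw [nilp_eVec k hi', nilp_eVec k hj', form_eVec_eVec, form_eVec_eVec]
      by_cases hc : p ≠ k ∧ i + j = p + 2 ∧ 2 ≤ i
      · rw [if_pos (by omega), if_pos (by omega), hsgn i hc.2.2]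
      · rw [if_neg (by omega), if_neg (by omega), neg_zero]
    · rw [nilp_eVec k hi', nilp_fVec p hj', form_eVec_fVec, form_eVec_fVec]
      by_cases hc : p = k ∧ i + j = k + 2 ∧ 2 ≤ i
      · rw [if_pos (by omega), if_pos (by omega), hsgn i hc.2.2]
      · rw [if_neg (by omega), if_neg (by omega), neg_zero]
    · rw [nilp_fVec p hi', nilp_eVec k hj', form_fVec_eVec, form_fVec_eVec, form_eVec_fVec,
        form_eVec_fVec]
      by_cases hc : p = k ∧ i + j = k + 2 ∧ 2 ≤ i
      · rw [if_pos (by omega), if_pos (by omega), hsgn j (by omega), neg_neg]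
      · rw [if_neg (by omega), if_neg (by omega), neg_zero]
    · rw [nilp_fVec p hi', nilp_fVec p hj', form_fVec_fVec, form_fVec_fVec]
      by_cases hc : p ≠ k ∧ i + j = k + 2 ∧ 2 ≤ i
      · rw [if_pos (by omega), if_pos (by omega), hsgn i hc.2.2, mul_neg]
      · rw [if_neg (by omega), if_neg (by omega), neg_zero]
  exact LinearMap.congr_fun₂ h1 u v

theorem finrank_ker_nilp (hp : 0 < p) (hk : 0 < k) :
    finrank ℂ (LinearMap.ker (nilp p k)) ≤ 2 := by
  let g : (Idx p k → ℂ) →ₗ[ℂ] (Fin 2 → ℂ) := LinearMap.pi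
    ![LinearMap.proj (Sum.inl ⟨0, hp⟩), LinearMap.proj (Sum.inr ⟨0, hk⟩)]
  have h1 : Function.Injective (g.domRestrict (LinearMap.ker (nilp p k))) := by
    rw [injective_iff_map_eq_zero]
    rintro ⟨w, hw⟩ hg
    have hg' : g w = 0 := hg
    have h0 := congrFun hg' 0
    have h1 := congrFun hg' 1
    simp only [g, LinearMap.pi_apply, Matrix.cons_val_zero, Matrix.cons_val_one,
      LinearMap.proj_apply, Pi.zero_apply] at h0 h1
    rw [LinearMap.mem_ker, ← pow_one (nilp p k)] at hw
    ext (⟨j, hj⟩ | ⟨j, hj⟩)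
    · rcases Nat.eq_zero_or_pos j with rfl | hj0
      · exact h0
      · have h2 := congrFun hw (Sum.inl ⟨j - 1, by omega⟩)
        rw [nilp_pow_inl, dif_pos (by simp only; omega)] at h2
        simpa [Nat.sub_add_cancel hj0] using h2
    · rcases Nat.eq_zero_or_pos j with rfl | hj0
      · exact h1
      · have h2 := congrFun hw (Sum.inr ⟨j - 1, by omega⟩)
        rw [nilp_pow_inr, dif_pos (by simp only; omega)] at h2
        simpa [Nat.sub_add_cancel hj0] using h2
  have := LinearMap.finrank_le_finrank_of_injective h1
  simpa using this

theorem isSkewPair (h : IsTypeD p k) : IsSkewPair (nilp p k) (form p k) where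
  skew := form_skew
  symm := form_symm h
  nondeg := form_nondegenerate p k
  finrank_ker := finrank_ker_nilp (h.1.trans_le h.2.1) h.1

/-! ### The coordinate subspaces -/

theorem eVec_mem_spanEF {r i : ℕ} (s : ℕ) (hi : i ≤ r) : eVec p k i ∈ spanEF p k r s := by
  rcases Nat.eq_zero_or_pos i with rfl | hi0
  · rw [eVec_zero]
    exact zero_mem _
  · exact Submodule.subset_span (Or.inl ⟨i, hi0, hi, rfl⟩)

theorem fVec_mem_spanEF (r : ℕ) {s i : ℕ} (hi : i ≤ s) : fVec p k i ∈ spanEF p k r s := by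
  rcases Nat.eq_zero_or_pos i with rfl | hi0
  · rw [fVec_zero]
    exact zero_mem _
  · exact Submodule.subset_span (Or.inr ⟨i, hi0, hi, rfl⟩)

theorem spanEF_le {r s : ℕ} {S : Submodule ℂ (Idx p k → ℂ)}
    (he : ∀ i, 1 ≤ i → i ≤ r → i ≤ p → eVec p k i ∈ S)
    (hf : ∀ i, 1 ≤ i → i ≤ s → i ≤ k → fVec p k i ∈ S) :
    spanEF p k r s ≤ S := by
  rw [spanEF, Submodule.span_le]
  rintro _ (⟨i, h1, h2, rfl⟩ | ⟨i, h1, h2, rfl⟩)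
  · by_cases hp : i ≤ p
    · exact he i h1 h2 hp
    · rw [eVec_of_lt k (by omega)]
      exact zero_mem _
  · by_cases hp : i ≤ k
    · exact hf i h1 h2 hp
    · rw [fVec_of_lt p (by omega)]
      exact zero_mem _

theorem mem_spanEF {r s : ℕ} {w : Idx p k → ℂ} : w ∈ spanEF p k r s ↔
    (∀ j : Fin p, r ≤ j → w (Sum.inl j) = 0) ∧ ∀ j : Fin k, s ≤ j → w (Sum.inr j) = 0 := by
  constructor
  · intro h
    induction h using Submodule.span_induction with
    | mem w hw =>
      rcases hw with ⟨i, h1, h2, rfl⟩ | ⟨i, h1, h2, rfl⟩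
      · refine ⟨fun j hj => ?_, fun j _ => rfl⟩
        simp only [eVec]
        exact if_neg (by omega)
      · refine ⟨fun j _ => rfl, fun j hj => ?_⟩
        simp only [fVec]
        exact if_neg (by omega)
    | zero => simp
    | add u v _ _ hu hv =>
      exact ⟨fun j hj => by simp [hu.1 j hj, hv.1 j hj], fun j hj => by simp [hu.2 j hj, hv.2 j hj]⟩
    | smul c u _ hu => exact ⟨fun j hj => by simp [hu.1 j hj], fun j hj => by simp [hu.2 j hj]⟩
  · rintro ⟨h1, h2⟩
    refine idx_induction w (zero_mem _) (fun _ _ => add_mem) (fun j => ?_) fun j => ?_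
    · by_cases hj : r ≤ j
      · rw [h1 j hj, zero_smul]
        exact zero_mem _
      · exact Submodule.smul_mem _ _ (eVec_mem_spanEF _ (by omega))
    · by_cases hj : s ≤ j
      · rw [h2 j hj, zero_smul]
        exact zero_mem _
      · exact Submodule.smul_mem _ _ (fVec_mem_spanEF _ (by omega))

theorem finrank_spanEF {r s : ℕ} (hr : r ≤ p) (hs : s ≤ k) :
    finrank ℂ (spanEF p k r s) = r + s := by
  let g : (Idx p k → ℂ) →ₗ[ℂ] (Fin r ⊕ Fin s → ℂ) := LinearMap.funLeft ℂ ℂ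
    (Sum.map (Fin.castLE hr) (Fin.castLE hs))
  have h1 := finrank_map_add_inf_ker g (spanEF p k r s)
  have h2 : spanEF p k r s ⊓ LinearMap.ker g = ⊥ := by
    rw [eq_bot_iff]
    rintro w ⟨hw, hg⟩
    have hg' : g w = 0 := hg
    rw [SetLike.mem_coe, mem_spanEF] at hw
    rw [Submodule.mem_bot]
    ext (j | j)
    · by_cases hj : r ≤ j
      · exact hw.1 j hj
      · exact congrFun hg' (Sum.inl ⟨j, by omega⟩)
    · by_cases hj : s ≤ j
      · exact hw.2 j hj
      · exact congrFun hg' (Sum.inr ⟨j, by omega⟩)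
  have h3 : (spanEF p k r s).map g = ⊤ := by
    rw [eq_top_iff]
    intro v _
    refine ⟨Sum.elim (fun j => if h : j.val < r then v (Sum.inl ⟨j, h⟩) else 0)
      (fun j => if h : j.val < s then v (Sum.inr ⟨j, h⟩) else 0), ?_, ?_⟩
    · rw [SetLike.mem_coe, mem_spanEF]
      exact ⟨fun j hj => by simp [hj.not_gt], fun j hj => by simp [hj.not_gt]⟩
    · ext (j | j) <;> simp [g, LinearMap.funLeft_apply]
  rw [h2, h3, finrank_bot, finrank_top] at h1
  simpa using h1.symm

theorem map_pow_spanEF_le {r s a r' s' : ℕ} (hr : r - a ≤ r') (hs : s - a ≤ s') :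
    (spanEF p k r s).map (nilp p k ^ a) ≤ spanEF p k r' s' := by
  rw [Submodule.map_le_iff_le_comap]
  refine spanEF_le (fun i _ h2 h3 => ?_) (fun i _ h2 h3 => ?_)
  · rw [Submodule.mem_comap, nilp_pow_eVec k h3]
    exact eVec_mem_spanEF _ (by omega)
  · rw [Submodule.mem_comap, nilp_pow_fVec p h3]
    exact fVec_mem_spanEF _ (by omega)

theorem spanEF_mono {r s r' s' : ℕ} (hr : r ≤ r') (hs : s ≤ s') :
    spanEF p k r s ≤ spanEF p k r' s' :=
  spanEF_le (fun _ _ h2 _ => eVec_mem_spanEF _ (h2.trans hr))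
    fun _ _ h2 _ => fVec_mem_spanEF _ (h2.trans hs)

end Concrete

/-! ### Isotropic flags -/

section Isotropic

open Module

variable {p k m : ℕ}

theorem CompleteFlag.finrank_eq (F : CompleteFlag (Idx p k)) {i : ℕ} (hi : i ≤ p + k) :
    finrank ℂ (F.F i) = i :=
  F.finrank_F (by simpa using hi)

/-- Flags with `F (n - i) = (F i)^⊥`. -/
def IsIsotropicFlag (F : CompleteFlag (Idx p k)) : Prop :=
  ∀ i ≤ p + k, F.F (p + k - i) = (form p k).orthogonal (F.F i)

theorem IsIsotropicFlag.le_orthogonal {F : CompleteFlag (Idx p k)} (hF : IsIsotropicFlag F)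
    {i j : ℕ} (hij : i + j ≤ p + k) : F.F i ≤ (form p k).orthogonal (F.F j) := by
  rw [← hF j (by omega)]
  exact F.mono (by omega)

theorem IsIsotropicFlag.apply_eq_zero {F : CompleteFlag (Idx p k)} (hF : IsIsotropicFlag F)
    {i j : ℕ} (hij : i + j ≤ p + k) {u v : Idx p k → ℂ} (hu : u ∈ F.F i) (hv : v ∈ F.F j) :
    form p k u v = 0 :=
  (LinearMap.BilinForm.mem_orthogonal_iff.1 (hF.le_orthogonal (i := j) (j := i) (by omega) hv)) u hu

theorem IsIsotropicFlag.eq_orthogonal {F : CompleteFlag (Idx p k)} (hF : IsIsotropicFlag F)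
    {i : ℕ} (hi : i ≤ p + k) : F.F i = (form p k).orthogonal (F.F (p + k - i)) := by
  rw [← hF _ (Nat.sub_le _ _), Nat.sub_sub_self hi]

theorem IsIsotropicFlag.ext_half (hm : 2 * m = p + k) {F F' : CompleteFlag (Idx p k)}
    (hF : IsIsotropicFlag F) (hF' : IsIsotropicFlag F') (h : ∀ l ≤ m, F.F l = F'.F l) : F = F' := by
  ext1
  funext i
  rcases le_or_gt i m with hi | hi
  · exact h i hi
  rcases le_or_gt i (p + k) with hi' | hi'
  · rw [hF.eq_orthogonal hi', hF'.eq_orthogonal hi', h _ (by omega)]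
  · rw [F.eq_top i (by simpa using hi'.le), F'.eq_top i (by simpa using hi'.le)]

/-- The upper half of the condition on `x` follows from the lower half by orthogonality, because `x`
is skew. -/
theorem IsIsotropicFlag.map_nilp_le (hm : 2 * m = p + k)
    {F : CompleteFlag (Idx p k)} (hF : IsIsotropicFlag F)
    (h1 : ∀ l < m, (F.F (l + 1)).map (nilp p k) ≤ F.F l) : F ∈ springerFiber p k := by
  refine ⟨hF, fun i hi => ?_⟩
  rcases lt_or_ge i m with hi' | hi'
  · exact h1 i hi'
  rintro _ ⟨w, hw, rfl⟩
  rw [hF.eq_orthogonal hi.le, LinearMap.BilinForm.mem_orthogonal_iff]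
  intro u hu
  have h2 : nilp p k u ∈ F.F (p + k - i - 1) := by
    refine h1 _ (by omega) ⟨u, ?_, rfl⟩
    rwa [Nat.sub_add_cancel (by omega)]
  have h3 := form_skew (p := p) (k := k) u w
  rw [hF.apply_eq_zero (by omega) h2 hw] at h3
  exact neg_eq_zero.1 h3.symm

/-- The upper half consists of the orthogonal complements of the lower half; the two agree in the
middle since an isotropic subspace of dimension `m` is its own complement. -/
theorem exists_isotropicFlag (h : IsTypeD p k) (hm : 2 * m = p + k)
    (Q : ℕ → Submodule ℂ (Idx p k → ℂ)) (hQ : ∀ l ≤ m, finrank ℂ (Q l) = l)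
    (hmono : ∀ l < m, Q l ≤ Q (l + 1)) (hiso : Q m ≤ (form p k).orthogonal (Q m)) :
    ∃ F : CompleteFlag (Idx p k), IsIsotropicFlag F ∧ ∀ l ≤ m, F.F l = Q l := by
  have hsk := isSkewPair h
  have hfin : finrank ℂ (Idx p k → ℂ) = p + k := by simp
  have horth : Q m = (form p k).orthogonal (Q m) := by
    refine Submodule.eq_of_le_of_finrank_le hiso ?_
    have := hsk.finrank_orthogonal (Q m)
    have := hQ m le_rfl
    omega
  have hcard : Fintype.card (Idx p k) = p + k := by simp
  let F : ℕ → Submodule ℂ (Idx p k → ℂ) := fun i =>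
    if i ≤ m then Q i else (form p k).orthogonal (Q (p + k - i))
  have hF1 : ∀ i ≤ m, F i = Q i := fun i hi => if_pos hi
  have hF2 : ∀ i, m ≤ i → F i = (form p k).orthogonal (Q (p + k - i)) := fun i hi => by
    rcases hi.eq_or_lt with rfl | hi
    · rw [hF1 _ le_rfl, show p + k - m = m by omega]
      exact horth
    · exact if_neg (by omega)
  have hQ0 : Q 0 = ⊥ := Submodule.finrank_eq_zero.1 (hQ 0 (Nat.zero_le _))
  have hFfin : ∀ i ≤ p + k, finrank ℂ (F i) = i := fun i hi => by
    rcases le_total i m with hi' | hi'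
    · rw [hF1 i hi', hQ i hi']
    · rw [hF2 i hi']
      have := hsk.finrank_orthogonal (Q (p + k - i))
      have := hQ (p + k - i) (by omega)
      omega
  have hFle : ∀ i < p + k, F i ≤ F (i + 1) := fun i hi => by
    rcases lt_or_ge i m with hi' | hi'
    · rw [hF1 i hi'.le, hF1 _ hi']
      exact hmono i hi'
    · rw [hF2 i hi', hF2 _ (by omega)]
      refine LinearMap.BilinForm.orthogonal_le ?_
      have := hmono (p + k - (i + 1)) (by omega)
      rwa [show p + k - (i + 1) + 1 = p + k - i by omega] at this
  refine ⟨⟨F, ?_, fun i hi => ?_, fun i hi => ?_⟩, fun i hi => ?_, hF1⟩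
  · rw [hF1 0 (Nat.zero_le _), hQ0]
  · rw [hcard] at hi
    refine lt_of_le_of_ne (hFle i hi) fun heq => ?_
    have h1 := hFfin i hi.le
    rw [heq, hFfin (i + 1) hi] at h1
    omega
  · rw [hcard] at hi
    rw [hF2 i (by omega), show p + k - i = 0 by omega, hQ0]
    simp
  · show F (p + k - i) = (form p k).orthogonal (F i)
    rcases le_total i m with hi' | hi'
    · rw [hF1 i hi', hF2 _ (by omega), Nat.sub_sub_self hi]
    · rw [hF2 i hi', hF1 _ (by omega), hsk.orthogonal_orthogonal]

theorem finrank_map_of_injective {V : Type*} [AddCommGroup V] [Module ℂ V] {g : V →ₗ[ℂ] V}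
    (hg : Function.Injective g) (U : Submodule ℂ V) : finrank ℂ (U.map g) = finrank ℂ U :=
  (Submodule.equivMapOfInjective g hg U).finrank_eq.symm

theorem map_eq_of_forall_mem {V : Type*} [AddCommGroup V] [Module ℂ V] [FiniteDimensional ℂ V]
    {g : V →ₗ[ℂ] V} (hg : Function.Injective g) {U W : Submodule ℂ V}
    (hle : U.map g ≤ W) (hfin : finrank ℂ W ≤ finrank ℂ U) : U.map g = W := by
  refine Submodule.eq_of_le_of_finrank_le hle ?_
  rw [finrank_map_of_injective hg]
  exact hfin

/-- `g` need not be an isometry: it only has to keep the middle subspace isotropic. The orthogonal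
complements then move by `g'`, the inverse adjoint of `g`. Having a linear map for the upper half
too makes the new flag depend regularly on parameters. -/
theorem exists_isotropicFlag_map (h : IsTypeD p k) (hm : 2 * m = p + k)
    {F : CompleteFlag (Idx p k)} (hF : IsIsotropicFlag F) {g g' : Module.End ℂ (Idx p k → ℂ)}
    (hg : Function.Injective g) (hg' : Function.Injective g')
    (hgg : ∀ u v, form p k (g u) (g' v) = form p k u v)
    (hiso : ∀ u ∈ F.F m, ∀ v ∈ F.F m, form p k (g u) (g v) = 0) :
    ∃ F' : CompleteFlag (Idx p k), IsIsotropicFlag F' ∧ (∀ l ≤ m, F'.F l = (F.F l).map g) ∧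
      ∀ l, m ≤ l → l ≤ p + k → F'.F l = (F.F l).map g' := by
  have hiso' : (F.F m).map g ≤ (form p k).orthogonal ((F.F m).map g) := by
    rintro _ ⟨w, hw, rfl⟩
    rw [LinearMap.BilinForm.mem_orthogonal_iff]
    rintro _ ⟨u, hu, rfl⟩
    exact hiso u hu w hw
  obtain ⟨F', h1, h2⟩ := exists_isotropicFlag h hm (fun l => (F.F l).map g)
    (fun l hl => (finrank_map_of_injective hg _).trans (F.finrank_eq (by omega)))
    (fun l hl => Submodule.map_mono (F.mono (Nat.le_succ l))) hiso'
  refine ⟨F', h1, h2, fun l hl hl' => ?_⟩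
  symm
  refine map_eq_of_forall_mem hg' ?_ ?_
  · rintro _ ⟨w, hw, rfl⟩
    rw [h1.eq_orthogonal hl', h2 _ (by omega), LinearMap.BilinForm.mem_orthogonal_iff]
    rintro _ ⟨u, hu, rfl⟩
    rw [hgg]
    exact hF.apply_eq_zero (by omega) hu hw
  · rw [F.finrank_eq hl', F'.finrank_eq hl']

end Isotropic

/-! ### Combinatorics of cup diagrams -/

namespace MarkedCupDiagram

variable {m : ℕ}

/-- The number of vertices `z` in `[u, w)` that satisfy `P`. -/
noncomputable def cnt (P : Fin m → Prop) (u w : ℕ) : ℕ := by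
  classical exact (Finset.univ.filter fun z : Fin m => u ≤ z.val ∧ z.val < w ∧ P z).card

theorem cnt_self (P : Fin m → Prop) (u : ℕ) : cnt P u u = 0 := by
  classical
  rw [cnt, Finset.card_eq_zero, Finset.filter_eq_empty_iff]
  rintro z - ⟨h1, h2, -⟩
  omega

theorem cnt_add (P : Fin m → Prop) {u w z : ℕ} (h1 : u ≤ w) (h2 : w ≤ z) :
    cnt P u z = cnt P u w + cnt P w z := by
  classical
  rw [cnt, cnt, cnt, ← Finset.card_union_of_disjoint]
  · congr 1
    ext y
    simp only [Finset.mem_filter, Finset.mem_univ, true_and, Finset.mem_union]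
    by_cases hP : P y
    · simp only [hP, and_true]
      omega
    · simp [hP]
  · rw [Finset.disjoint_filter]
    rintro y - ⟨_, h3, -⟩ ⟨h4, -, -⟩
    omega

open Classical in
theorem cnt_succ (P : Fin m → Prop) {u : ℕ} {v : Fin m} (h : u ≤ v.val) :
    cnt P u (v.val + 1) = cnt P u v.val + if P v then 1 else 0 := by
  rw [cnt_add P h (Nat.le_succ _)]
  congr 1
  rw [cnt]
  split_ifs with hP
  · rw [Finset.card_eq_one]
    refine ⟨v, ?_⟩
    ext y
    simp only [Finset.mem_filter, Finset.mem_univ, true_and, Finset.mem_singleton]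
    constructor
    · rintro ⟨h1, h2, -⟩
      exact Fin.ext (by omega)
    · rintro rfl
      exact ⟨le_rfl, Nat.lt_succ_self _, hP⟩
  · rw [Finset.card_eq_zero, Finset.filter_eq_empty_iff]
    rintro y - ⟨h1, h2, h3⟩
    have : y = v := Fin.ext (by omega)
    exact hP (this ▸ h3)

theorem cnt_succ_of_pos {P : Fin m → Prop} {u : ℕ} {v : Fin m} (h : u ≤ v.val) (hP : P v) :
    cnt P u (v.val + 1) = cnt P u v.val + 1 := by
  classical
  rw [cnt_succ P h, if_pos hP]

theorem cnt_succ_of_neg {P : Fin m → Prop} {u : ℕ} {v : Fin m} (h : u ≤ v.val) (hP : ¬ P v) :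
    cnt P u (v.val + 1) = cnt P u v.val := by
  classical
  rw [cnt_succ P h, if_neg hP, add_zero]

theorem cnt_eq_zero {P : Fin m → Prop} {u w : ℕ} (h : ∀ z : Fin m, u ≤ z.val → z.val < w → ¬ P z) :
    cnt P u w = 0 := by
  classical
  rw [cnt, Finset.card_eq_zero, Finset.filter_eq_empty_iff]
  rintro z - ⟨h1, h2, h3⟩
  exact h z h1 h2 h3

theorem cnt_mono (P : Fin m → Prop) {u w z : ℕ} (h1 : u ≤ w) (h2 : w ≤ z) :
    cnt P u w ≤ cnt P u z := by
  rw [cnt_add P h1 h2]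
  exact Nat.le_add_right _ _

variable (a : MarkedCupDiagram m)

/-- Left endpoints of cups. -/
def IsLeft (z : Fin m) : Prop := z < a.σ z

/-- Right endpoints of cups. -/
def IsRight (z : Fin m) : Prop := a.σ z < z

/-- Vertices on rays. -/
def IsRay (z : Fin m) : Prop := a.σ z = z

theorem σ_injective : Function.Injective a.σ := fun u v h => by
  rw [← a.invol u, h, a.invol]

theorem left_or_right_or_ray (z : Fin m) : a.IsLeft z ∨ a.IsRight z ∨ a.IsRay z := by
  rcases lt_trichotomy z (a.σ z) with h | h | h
  · exact Or.inl h
  · exact Or.inr (Or.inr h.symm)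
  · exact Or.inr (Or.inl h)

variable {a} {z : Fin m}

theorem IsLeft.isRight (h : a.IsLeft z) : a.IsRight (a.σ z) := by
  rw [IsRight, a.invol]
  exact h

theorem IsRight.isLeft (h : a.IsRight z) : a.IsLeft (a.σ z) := by
  rw [IsLeft, a.invol]
  exact h

theorem IsLeft.not_isRight (h : a.IsLeft z) : ¬ a.IsRight z := lt_asymm h

theorem IsRight.not_isLeft (h : a.IsRight z) : ¬ a.IsLeft z := lt_asymm h

theorem IsLeft.not_isRay (h : a.IsLeft z) : ¬ a.IsRay z := fun h' => h.ne' h'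

theorem IsRight.not_isRay (h : a.IsRight z) : ¬ a.IsRay z := fun h' => h.ne h'

variable (a)

theorem cnt_total {u w : ℕ} (h1 : u ≤ w) (h2 : w ≤ m) :
    cnt a.IsLeft u w + cnt a.IsRight u w + cnt a.IsRay u w + u = w := by
  induction w, h1 using Nat.le_induction with
  | base => simp [cnt_self]
  | succ w hw ih =>
    have h3 := ih (by omega)
    let z : Fin m := ⟨w, h2⟩
    have hz : u ≤ z.val := hw
    have hz' : w = z.val := rfl
    rw [hz'] at h3 ⊢
    rcases a.left_or_right_or_ray z with h | h | h
    · rw [cnt_succ_of_pos hz h, cnt_succ_of_neg hz h.not_isRight, cnt_succ_of_neg hz h.not_isRay]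
      omega
    · rw [cnt_succ_of_pos hz h, cnt_succ_of_neg hz fun h' => h'.not_isRight h,
        cnt_succ_of_neg hz h.not_isRay]
      omega
    · rw [cnt_succ_of_pos hz h, cnt_succ_of_neg hz fun h' => h'.not_isRay h,
        cnt_succ_of_neg hz fun h' => h'.not_isRay h]
      omega

/-- The set of vertices in `[u, w)` is a union of cups and rays. -/
def Stable (u w : ℕ) : Prop :=
  ∀ z : Fin m, u ≤ z.val → z.val < w → u ≤ (a.σ z).val ∧ (a.σ z).val < w

variable {a}

theorem Stable.cnt_eq {u w : ℕ} (h : a.Stable u w) : cnt a.IsLeft u w = cnt a.IsRight u w := by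
  classical
  rw [cnt, cnt]
  refine Finset.card_bij (fun z _ => a.σ z) (fun z hz => ?_) (fun _ _ _ _ h => a.σ_injective h)
    fun z hz => ?_
  · simp only [Finset.mem_filter, Finset.mem_univ, true_and] at hz ⊢
    obtain ⟨h1, h2⟩ := h z hz.1 hz.2.1
    exact ⟨h1, h2, hz.2.2.isRight⟩
  · simp only [Finset.mem_filter, Finset.mem_univ, true_and] at hz
    obtain ⟨h1, h2⟩ := h z hz.1 hz.2.1
    refine ⟨a.σ z, ?_, a.invol z⟩
    simp only [Finset.mem_filter, Finset.mem_univ, true_and]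
    exact ⟨h1, h2, hz.2.2.isLeft⟩

theorem Stable.of_right {u w : ℕ} (h : a.Stable 0 w) (h' : a.Stable u w) (huw : u ≤ w) : a.Stable 0 u := by
  intro z _ hz
  refine ⟨Nat.zero_le _, ?_⟩
  by_contra hc
  have h1 := (h' (a.σ z) (by omega) ?_).1
  · rw [a.invol] at h1
    omega
  · by_contra hw
    have h2 := h z (Nat.zero_le _)
    omega

theorem stable_univ : a.Stable 0 m := fun z _ _ => ⟨Nat.zero_le _, (a.σ z).2⟩

theorem Stable.compl {u : ℕ} (h : a.Stable 0 u) : a.Stable u m := by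
  intro z hz _
  refine ⟨?_, (a.σ z).2⟩
  by_contra hc
  have := (h (a.σ z) (Nat.zero_le _) (by omega)).2
  rw [a.invol] at this
  omega

theorem IsLeft.stable {v : Fin m} (h : a.IsLeft v) : a.Stable v.val ((a.σ v).val + 1) := by
  intro z h1 h2
  have hv : v.val < (a.σ v).val := h
  rcases h1.eq_or_lt with h3 | h3
  · have : z = v := Fin.ext h3.symm
    subst this
    omega
  rcases (Nat.lt_succ_iff.1 h2).eq_or_lt with h4 | h4
  · have : z = a.σ v := Fin.ext h4
    rw [this, a.invol]
    omega
  have h5 : (a.σ z).val ≤ (a.σ v).val := a.noncrossing v z h3 h4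
  refine ⟨?_, by omega⟩
  by_contra hc
  have h6 := a.noncrossing (a.σ z) v (Fin.lt_def.2 (by omega)) (by rw [a.invol]; exact h3)
  rw [a.invol, Fin.le_def] at h6
  omega

theorem IsLeft.not_isRay_of_mem {v z : Fin m} (h : a.IsLeft v) (h1 : v.val ≤ z.val)
    (h2 : z.val ≤ (a.σ v).val) : ¬ a.IsRay z := by
  intro hz
  have hne : z ≠ v := fun h' => h.not_isRay (h' ▸ hz)
  have hne' : z ≠ a.σ v := fun h' => h.isRight.not_isRay (h' ▸ hz)
  refine a.ray_not_under v z hz ⟨lt_of_le_of_ne h1 hne.symm, lt_of_le_of_ne h2 hne'⟩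

theorem IsRay.stable {r : Fin m} (h : a.IsRay r) : a.Stable 0 r.val := by
  intro z _ hz
  refine ⟨Nat.zero_le _, ?_⟩
  by_contra hc
  refine a.ray_not_under z r h ⟨hz, lt_of_le_of_ne (Fin.le_def.2 (by omega)) fun h' => ?_⟩
  have h1 : a.σ r = z := by rw [h', a.invol]
  rw [show a.σ r = r from h] at h1
  rw [h1] at hz
  exact lt_irrefl _ hz

theorem IsRay.stable_succ {r : Fin m} (h : a.IsRay r) : a.Stable 0 (r.val + 1) := by
  intro z _ hz
  refine ⟨Nat.zero_le _, ?_⟩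
  rcases (Nat.lt_succ_iff.1 hz).eq_or_lt with h1 | h1
  · have : z = r := Fin.ext h1
    subst this
    rw [show a.σ z = z from h]
    omega
  · exact (h.stable z (Nat.zero_le _) h1).2.trans (Nat.lt_succ_self _)

/-- A cup starting before `v` and ending at or beyond it would cross the cup or ray of `v`, or would
enclose it, which accessibility forbids. -/
theorem stable_of_marked {v : Fin m} (h : v ∈ a.marked) : a.Stable 0 v.val := by
  intro z _ hz
  refine ⟨Nat.zero_le _, ?_⟩
  by_contra hc
  rcases (a.marked_le v h).eq_or_lt with h1 | h1
  · have := (IsRay.stable (a := a) h1.symm z (Nat.zero_le _) hz).2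
    omega
  · rcases le_or_gt (a.σ z).val (a.σ v).val with h2 | h2
    · have := (IsLeft.stable (a := a) h1 (a.σ z) (by omega) (by omega)).1
      rw [a.invol] at this
      omega
    · exact (a.accessible v h).2 z ⟨hz, h2⟩

theorem stable_cup_of_marked {v : Fin m} (h : v ∈ a.marked) (hv : a.IsLeft v) :
    a.Stable 0 ((a.σ v).val + 1) := by
  intro z _ hz
  refine ⟨Nat.zero_le _, ?_⟩
  have h1 : v.val < (a.σ v).val := hv
  rcases lt_or_ge z.val v.val with h2 | h2
  · have := (stable_of_marked h z (Nat.zero_le _) h2).2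
    omega
  · exact (hv.stable z h2 hz).2

theorem ray_lt_of_marked {v r : Fin m} (h : v ∈ a.marked) (hv : a.IsLeft v) (hr : a.IsRay r) :
    r.val < v.val := by
  by_contra hc
  rcases le_or_gt r.val (a.σ v).val with h1 | h1
  · exact hv.not_isRay_of_mem (by omega) h1 hr
  · exact (a.accessible v h).1 r hr h1

/-- Beyond `l` there are only complete cups. This parity is what makes the exponents at marked cups
even. -/
theorem even_sub {l : ℕ} (h : a.Stable 0 l) (hl : l ≤ m) (hr : ∀ r, a.IsRay r → r.val < l) :
    Even (m - l) := by
  have h1 := a.cnt_total hl le_rfl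
  have h2 := h.compl.cnt_eq
  have h3 : cnt a.IsRay l m = 0 := cnt_eq_zero fun z hz _ hz' => by
    have := hr z hz'
    omega
  exact ⟨cnt a.IsLeft l m, by omega⟩

theorem cupsLeft_eq {r : Fin m} (h : a.IsRay r) : a.cupsLeft r = cnt a.IsRight 0 r.val := by
  classical
  rw [← h.stable.cnt_eq, cupsLeft, cnt, cups, Finset.filter_filter]
  congr 1
  ext z
  simp only [Finset.mem_filter, Finset.mem_univ, true_and, Nat.zero_le]
  constructor
  · rintro ⟨h1, h2⟩
    exact ⟨lt_trans h1 h2, h1⟩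
  · rintro ⟨h1, h2⟩
    exact ⟨h2, (h.stable z (Nat.zero_le _) h1).2⟩

variable (a)

theorem cnt_isLeft_univ : cnt a.IsLeft 0 m = a.cups.card := by
  classical
  rw [cnt, cups]
  congr 1
  ext z
  simp only [Finset.mem_filter, Finset.mem_univ, true_and, Nat.zero_le, z.2]
  exact Iff.rfl

theorem cnt_isRay_univ : 2 * a.cups.card + cnt a.IsRay 0 m = m := by
  have h1 := a.cnt_total (Nat.zero_le m) le_rfl
  rw [← a.stable_univ.cnt_eq, cnt_isLeft_univ] at h1
  omega

variable {a}

theorem stable_cnt {u w : ℕ} (h : a.Stable u w) (huw : u ≤ w) (hw : w ≤ m) :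
    2 * cnt a.IsRight u w + cnt a.IsRay u w + u = w := by
  have := a.cnt_total huw hw
  rw [h.cnt_eq] at this
  omega

theorem IsLeft.length {v : Fin m} (h : a.IsLeft v) :
    v.val + 2 * cnt a.IsRight v.val ((a.σ v).val + 1) = (a.σ v).val + 1 := by
  have h1 : v.val < (a.σ v).val := h
  have h2 := stable_cnt h.stable (by omega) (by omega)
  have h3 : cnt a.IsRay v.val ((a.σ v).val + 1) = 0 := cnt_eq_zero fun z h3 h4 =>
    h.not_isRay_of_mem h3 (by omega)
  omega

end MarkedCupDiagram

/-! ### The subspaces at the rightmost ray -/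

section RaySpaces

open Module

variable {p k : ℕ}

theorem form_spanEF_of_eq {r s r' s' : ℕ} (hpk : p = k) (h1 : r + s' ≤ k) (h2 : s + r' ≤ k) :
    spanEF p k r s ≤ (form p k).orthogonal (spanEF p k r' s') := by
  refine spanEF_le (fun i hi hir _ => ?_) (fun i hi his _ => ?_) <;>
    rw [LinearMap.BilinForm.mem_orthogonal_iff] <;> intro u hu <;>
    induction hu using Submodule.span_induction with
    | zero => simp
    | add u v _ _ hu hv => simp [hu, hv]
    | smul c u _ hu => simp [hu]
    | mem u hu =>
      rcases hu with ⟨j, hj, hj', rfl⟩ | ⟨j, hj, hj', rfl⟩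
      all_goals
        first
        | rw [form_eVec_eVec, if_neg (by omega)]
        | rw [form_fVec_fVec, if_neg (by omega)]
        | rw [form_fVec_eVec, form_eVec_fVec, if_neg (by omega)]
        | rw [form_eVec_fVec, if_neg (by omega)]

theorem form_spanEF_of_ne {r s r' s' : ℕ} (hpk : p ≠ k) (h1 : r + r' ≤ p) (h2 : s + s' ≤ k) :
    spanEF p k r s ≤ (form p k).orthogonal (spanEF p k r' s') := by
  refine spanEF_le (fun i hi hir _ => ?_) (fun i hi his _ => ?_) <;>
    rw [LinearMap.BilinForm.mem_orthogonal_iff] <;> intro u hu <;>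
    induction hu using Submodule.span_induction with
    | zero => simp
    | add u v _ _ hu hv => simp [hu, hv]
    | smul c u _ hu => simp [hu]
    | mem u hu =>
      rcases hu with ⟨j, hj, hj', rfl⟩ | ⟨j, hj, hj', rfl⟩
      all_goals
        first
        | rw [form_eVec_eVec, if_neg (by omega)]
        | rw [form_fVec_fVec, if_neg (by omega)]
        | rw [form_fVec_eVec, form_eVec_fVec, if_neg (by omega)]
        | rw [form_eVec_fVec, if_neg (by omega)]

theorem orthogonal_spanEF (h : IsTypeD p k) (hpk : p = k) {r s : ℕ} (hr : r ≤ k) (hs : s ≤ k) :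
    (form p k).orthogonal (spanEF p k r s) = spanEF p k (k - s) (k - r) := by
  symm
  refine Submodule.eq_of_le_of_finrank_le (form_spanEF_of_eq hpk (by omega) (by omega)) ?_
  have h1 := (isSkewPair h).finrank_orthogonal (spanEF p k r s)
  rw [finrank_spanEF (by omega) hs] at h1
  rw [finrank_spanEF (by omega) (by omega)]
  have : finrank ℂ (Idx p k → ℂ) = p + k := by simp
  omega

theorem map_orthogonal_spanEF_le (h : IsTypeD p k) (hpk : p = k) {r s t : ℕ}
    (ht : r + s + t = k) :
    ((form p k).orthogonal (spanEF p k r s)).map (nilp p k ^ t) ≤ spanEF p k r s := by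
  rw [orthogonal_spanEF h hpk (by omega) (by omega)]
  exact map_pow_spanEF_le (by omega) (by omega)

/-- The vector `f_l + σ e_{l + d}`. -/
def diagVec (p k d : ℕ) (σ : ℂ) (l : ℕ) : Idx p k → ℂ := fVec p k l + σ • eVec p k (l + d)

/-- The subspace `⟨e₁, …, e_{c+d}, f₁, …, f_c, f_{c+1} + σ e_{c+d+1}⟩`. -/
def diagSpan (p k d : ℕ) (σ : ℂ) (c : ℕ) : Submodule ℂ (Idx p k → ℂ) :=
  spanEF p k (c + d) c ⊔ Submodule.span ℂ {diagVec p k d σ (c + 1)}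

variable {d : ℕ} {σ τ : ℂ}

theorem nilp_pow_diagVec (hd : p = k + 2 * d) {l s : ℕ} (hl : l ≤ k) :
    (nilp p k ^ s) (diagVec p k d σ l) = fVec p k (l - s) + σ • eVec p k (l + d - s) := by
  rw [diagVec, map_add, map_smul, nilp_pow_fVec p hl, nilp_pow_eVec k (by omega)]

theorem nilp_pow_diagVec_of_le (hd : p = k + 2 * d) {l s : ℕ} (hl : l ≤ k) (hs : s ≤ l) :
    (nilp p k ^ s) (diagVec p k d σ l) = diagVec p k d σ (l - s) := by
  rw [nilp_pow_diagVec hd hl, diagVec, show l + d - s = l - s + d by omega]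

theorem diagVec_mem_spanEF (p k : ℕ) {l r s : ℕ} (hr : l + d ≤ r) (hs : l ≤ s) :
    diagVec p k d σ l ∈ spanEF p k r s :=
  add_mem (fVec_mem_spanEF _ hs) (Submodule.smul_mem _ _ (eVec_mem_spanEF _ hr))

/-- With the sign `(-1)^m` of the Gram matrix and `k` odd, the contribution of the `e`-part is `-στ`
times that of the `f`-part. Hence diagonal vectors with the same sign `σ = ±1` pair to zero, and
only opposite signs can pair nontrivially. -/
theorem form_diagVec (hd : p = k + 2 * d) (hd0 : 0 < d) (hk : Odd k) {i l c : ℕ} (hi : i ≤ k)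
    (hl : l ≤ k) :
    form p k (diagVec p k d σ i) ((nilp p k ^ c) (diagVec p k d τ l)) =
      if i + l = k + 1 + c ∧ c < l then (1 - σ * τ) * ((-1) ^ (k + d) * (-1) ^ (i - 1)) else 0 := by
  have hm : (p + k) / 2 = k + d := by omega
  rw [nilp_pow_diagVec hd hl, diagVec]
  simp only [map_add, map_smul, LinearMap.add_apply, LinearMap.smul_apply, smul_eq_mul,
    form_fVec_fVec, form_eVec_eVec, form_eVec_fVec, form_fVec_eVec, hm]
  have hpk : p ≠ k := by omega
  simp only [hpk, ne_eq, not_false_eq_true, true_and, false_and, if_false, mul_zero, add_zero,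
    zero_add]
  by_cases hc : i + l = k + 1 + c ∧ c < l
  · rw [if_pos (by omega), if_pos (by omega), if_pos hc,
      neg_one_pow_eq_neg (a := i + d - 1) (b := k + d + (i - 1))]
    · rw [pow_add]
      ring
    · obtain ⟨b, rfl⟩ := hk
      exact ⟨b + d + i - 1, by omega⟩
  · rw [if_neg (by omega), if_neg (by omega), if_neg hc]
    ring

theorem finrank_diagSpan (hd : p = k + 2 * d) {c : ℕ} (hc : c < k) :
    finrank ℂ (diagSpan p k d σ c) = 2 * c + d + 1 := by
  have h1 : diagVec p k d σ (c + 1) ∉ spanEF p k (c + d) c := by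
    intro h
    have := (mem_spanEF.1 h).2 ⟨c, hc⟩ le_rfl
    simp [diagVec, fVec, eVec] at this
  rw [diagSpan, Submodule.finrank_sup_span_singleton h1, finrank_spanEF (by omega) hc.le]
  omega

theorem orthogonal_diagSpan (h : IsTypeD p k) (hd : p = k + 2 * d) (hd0 : 0 < d) (hk : Odd k)
    (hσ : σ * σ = 1) {c : ℕ} (hc : c < k) :
    (form p k).orthogonal (diagSpan p k d σ c) = diagSpan p k d σ (k - c - 1) := by
  have hsk := isSkewPair h
  symm
  refine Submodule.eq_of_le_of_finrank_le ?_ ?_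
  · have hE : ∀ c' : ℕ, c' < k → spanEF p k (c' + d) c' ≤
        (form p k).orthogonal (diagSpan p k d σ (k - c' - 1)) := fun c' hc' =>
      (form_spanEF_of_ne (by omega) (r' := k - c' - 1 + d + 1) (s' := k - c' - 1 + 1) (by omega)
        (by omega)).trans (LinearMap.BilinForm.orthogonal_le (sup_le
          (spanEF_mono (by omega) (by omega)) ((Submodule.span_singleton_le_iff_mem _ _).2
            (diagVec_mem_spanEF _ _ (by omega) (by omega)))))
    refine sup_le ?_ ((Submodule.span_singleton_le_iff_mem _ _).2 ?_)
    · have := hE (k - c - 1) (by omega)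
      rwa [show k - (k - c - 1) - 1 = c by omega] at this
    · rw [LinearMap.BilinForm.mem_orthogonal_iff]
      intro u hu
      obtain ⟨u1, hu1, u2, hu2, rfl⟩ := Submodule.mem_sup.1 hu
      obtain ⟨b, rfl⟩ := Submodule.mem_span_singleton.1 hu2
      have h1 : form p k u1 (diagVec p k d σ (k - c - 1 + 1)) = 0 := by
        have := hE c hc hu1
        rw [LinearMap.BilinForm.mem_orthogonal_iff] at this
        rw [hsk.symm]
        exact this _ (Submodule.mem_sup_right (Submodule.mem_span_singleton_self _))
      have h2 := form_diagVec (σ := σ) (τ := σ) (i := c + 1) (l := k - c - 1 + 1) (c := 0) hd hd0 hk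
        (by omega) (by omega)
      rw [pow_zero, Module.End.one_apply, hσ, sub_self, zero_mul, ite_self] at h2
      simp [h1, h2]
  · have h1 := hsk.finrank_orthogonal (diagSpan p k d σ c)
    rw [finrank_diagSpan hd hc] at h1
    rw [finrank_diagSpan hd (by omega)]
    have : finrank ℂ (Idx p k → ℂ) = p + k := by simp
    omega

theorem map_pow_diagSpan_le (hd : p = k + 2 * d) {c c' s : ℕ} (hc : c < k) (hs : s + c' = c) :
    (diagSpan p k d σ c).map (nilp p k ^ s) ≤ diagSpan p k d σ c' := by
  rw [diagSpan, Submodule.map_sup, Submodule.map_span, Set.image_singleton]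
  refine sup_le ((map_pow_spanEF_le (by omega) (by omega)).trans le_sup_left)
    ((Submodule.span_singleton_le_iff_mem _ _).2 ?_)
  rw [nilp_pow_diagVec_of_le hd (by omega) (by omega), show c + 1 - s = c' + 1 by omega]
  exact Submodule.mem_sup_right (Submodule.mem_span_singleton_self _)

theorem map_orthogonal_diagSpan_le (h : IsTypeD p k) (hd : p = k + 2 * d) (hd0 : 0 < d)
    (hk : Odd k) (hσ : σ * σ = 1) {c t : ℕ} (hc : 2 * c + 1 + t = k) :
    ((form p k).orthogonal (diagSpan p k d σ c)).map (nilp p k ^ t) ≤ diagSpan p k d σ c := by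
  rw [orthogonal_diagSpan h hd hd0 hk hσ (by omega)]
  exact map_pow_diagSpan_le hd (by omega) (by omega)

end RaySpaces

/-! ### The relations of a marked cup diagram -/

section Relations

open Module MarkedCupDiagram

variable {p k : ℕ} {F : CompleteFlag (Idx p k)}

theorem cupRelation_iff_of_not {v w s : ℕ} {M : Prop} (hM : ¬ M) (hs : v + 2 * s = w + 1) :
    CupRelation p k F (v + 1) (w + 1) M ↔ F.F (w + 1) = (F.F v).comap (nilp p k ^ s) := by
  rw [CupRelation, show (w + 1 - (v + 1) + 1) / 2 = s by omega, Nat.add_sub_cancel]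
  simp [hM]

theorem cupRelation_iff_of_marked {v w s q : ℕ} {M : Prop} (hM : M) (hs : v + 2 * s = w + 1)
    (hq : 2 * (w + 1 + q) = p + k) :
    CupRelation p k F (v + 1) (w + 1) M ↔
      F.F v ⊔ (F.F (w + 1)).map (nilp p k ^ s) = F.F (v + 1) ∧
      (form p k).orthogonal (F.F (w + 1)) = (F.F (w + 1)).comap (nilp p k ^ q) := by
  rw [CupRelation, show (w + 1 - (v + 1) + 1) / 2 = s by omega, Nat.add_sub_cancel,
    show (p + k - 2 * (w + 1)) / 2 = q by omega]
  simp [hM]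

/-- The right side is never larger than the left, so one inclusion suffices. Inclusions are what
shears transport, and they define closed sets. -/
theorem eq_comap_iff_map_le (h : IsTypeD p k) {v w s : ℕ} (hs : v + 2 * s = w) (hw : w ≤ p + k) :
    F.F w = (F.F v).comap (nilp p k ^ s) ↔ (F.F w).map (nilp p k ^ s) ≤ F.F v := by
  rw [Submodule.map_le_iff_le_comap]
  refine ⟨fun h => h.le, fun h1 => Submodule.eq_of_le_of_finrank_le h1 ?_⟩
  have := finrank_comap_pow_le (isSkewPair h).finrank_ker (F.F v) s
  rw [F.finrank_eq (by omega)] at this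
  rw [F.finrank_eq hw]
  omega

theorem orthogonal_eq_comap_iff (h : IsTypeD p k) (hF : IsIsotropicFlag F) {j q : ℕ}
    (hq : 2 * (j + q) = p + k) :
    (form p k).orthogonal (F.F j) = (F.F j).comap (nilp p k ^ q) ↔
      (F.F (p + k - j)).map (nilp p k ^ q) ≤ F.F j := by
  rw [hF j (by omega)]
  refine ⟨fun h1 => by rw [Submodule.map_le_iff_le_comap, h1], fun h1 => ?_⟩
  refine (isSkewPair h).orthogonal_eq_of_map_le ?_ h1
  rw [F.finrank_eq (by omega)]
  simpa using hq

/-- Flags of the Springer fiber satisfying the relations of the cups and rays of which all vertices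
are among the first `l`. -/
structure RelationsUpTo (p k : ℕ) (a : MarkedCupDiagram ((p + k) / 2)) (l : ℕ)
    (F : CompleteFlag (Idx p k)) : Prop where
  springer : F ∈ springerFiber p k
  cup : ∀ v, a.IsLeft v → (a.σ v).val < l →
    CupRelation p k F (v.val + 1) ((a.σ v).val + 1) (v ∈ a.marked)
  ray : ∀ v, a.IsRay v → v.val < l →
    RayRelation p k F (v.val + 1) (a.cupsLeft v) (v ∈ a.marked) (∀ r, a.σ r = r → r ≤ v)

variable {a : MarkedCupDiagram ((p + k) / 2)} {l : ℕ}

theorem RelationsUpTo.mono {l' : ℕ} (h : RelationsUpTo p k a l F) (hl : l' ≤ l) :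
    RelationsUpTo p k a l' F :=
  ⟨h.springer, fun v hv hl' => h.cup v hv (hl'.trans_le hl),
    fun v hv hl' => h.ray v hv (hl'.trans_le hl)⟩

theorem mem_K_iff : F ∈ K p k a ↔ RelationsUpTo p k a ((p + k) / 2) F :=
  ⟨fun h => ⟨h.1, fun v hv _ => h.2.1 v hv, fun v hv _ => h.2.2 v hv⟩,
    fun h => ⟨h.springer, fun v hv => h.cup v hv (a.σ v).2, fun v hv => h.ray v hv v.2⟩⟩

theorem cnt_isRay_of_diagramsD (ha : a ∈ diagramsD p k) :
    2 * (k / 2) + cnt a.IsRay 0 ((p + k) / 2) = (p + k) / 2 := by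
  have h1 := a.cnt_isRay_univ
  rwa [show a.cups.card = k / 2 from ha] at h1

/-- The position of the rightmost ray. -/
theorem rightmost_ray_eq {v : Fin ((p + k) / 2)} (ha : a ∈ diagramsD p k) (hv : a.IsRay v)
    (hr : ∀ r, a.IsRay r → r ≤ v) :
    v.val + 2 * (k / 2) + 1 = 2 * cnt a.IsRight 0 v.val + (p + k) / 2 := by
  have h1 := cnt_isRay_of_diagramsD ha
  have h2 := stable_cnt hv.stable (Nat.zero_le _) v.2.le
  have h3 : cnt a.IsRay (v.val + 1) ((p + k) / 2) = 0 := cnt_eq_zero fun z hz _ hz' => by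
    have : z.val ≤ v.val := hr z hz'
    omega
  rw [cnt_add _ (Nat.zero_le (v.val + 1)) v.2, h3, cnt_succ_of_pos (Nat.zero_le _) hv] at h1
  omega

/-- Since the number of cups is prescribed, the position of the rightmost ray fixes the indices in
the explicit subspace there. The exponent `m - (v + 1)` is then exactly the shift that carries its
orthogonal complement into it. -/
theorem ray_good (h : IsTypeD p k) (ha : a ∈ diagramsD p k) {v : Fin ((p + k) / 2)}
    (hv : a.IsRay v) (hr : ∀ r, a.IsRay r → r ≤ v)
    (hF : RayRelation p k F (v.val + 1) (a.cupsLeft v) (v ∈ a.marked) (∀ r, a.σ r = r → r ≤ v)) :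
    ((form p k).orthogonal (F.F (v.val + 1))).map
      (nilp p k ^ ((p + k) / 2 - (v.val + 1))) ≤ F.F (v.val + 1) := by
  have h1 := rightmost_ray_eq ha hv hr
  have hc := cupsLeft_eq hv
  have h2 := stable_cnt hv.stable (Nat.zero_le _) v.2.le
  have h3 := cnt_isRay_of_diagramsD ha
  have hv2 := v.2
  rw [hc] at hF
  obtain ⟨hk, hkp, hpk⟩ := h
  rcases hkp.eq_or_lt with rfl | hlt
  · have key : ∀ r s, r + s = v.val + 1 → F.F (v.val + 1) = spanEF k k r s →
        ((form k k).orthogonal (F.F (v.val + 1))).map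
          (nilp k k ^ ((k + k) / 2 - (v.val + 1))) ≤ F.F (v.val + 1) := fun r s hrs heq => by
      rw [heq]
      exact map_orthogonal_spanEF_le ⟨hk, hkp, hpk⟩ rfl (by omega)
    have h4 := hF.1 rfl
    by_cases hM : v ∈ a.marked
    · exact key _ _ (by omega) (h4.1 hM)
    · exact key _ _ (by omega) (h4.2 hM)
  · obtain ⟨hp', hk'⟩ := hpk.resolve_left (by omega)
    obtain ⟨d, hd⟩ : ∃ d, p = k + 2 * d := by
      obtain ⟨b, hb⟩ := hp'
      obtain ⟨b', hb'⟩ := hk'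
      exact ⟨b - b', by omega⟩
    have hk2 : 2 * (k / 2) + 1 = k := Nat.two_mul_div_two_add_one_of_odd hk'
    have key : ∀ σ : ℂ, σ * σ = 1 →
        F.F (v.val + 1) = diagSpan p k d σ (cnt a.IsRight 0 v.val) →
        ((form p k).orthogonal (F.F (v.val + 1))).map
          (nilp p k ^ ((p + k) / 2 - (v.val + 1))) ≤ F.F (v.val + 1) := fun σ hσ heq => by
      rw [heq]
      exact map_orthogonal_diagSpan_le ⟨hk, hkp, hpk⟩ hd (by omega) hk' hσ (by omega)
    have h4 := hF.2 hlt
    have e1 : v.val + 1 - cnt a.IsRight 0 v.val = cnt a.IsRight 0 v.val + 1 + d := by omega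
    have e2 : v.val + 1 - cnt a.IsRight 0 v.val - 1 = cnt a.IsRight 0 v.val + d := by omega
    by_cases hM : v ∈ a.marked
    · refine key 1 (one_mul _) ?_
      rw [h4.1 hM, e2, e1, diagSpan, diagVec, one_smul]
    · refine key (-1) (by norm_num) ?_
      rw [h4.2.1 hM hr, e2, e1, diagSpan, diagVec, neg_one_smul, sub_eq_add_neg]

/-- Induction over the vertex just before `l`. A rightmost ray is good by `ray_good`, a marked cup
is good by its own second relation, and an unmarked cup inherits goodness from the subspace in front
of it. -/
theorem RelationsUpTo.good (h : IsTypeD p k) (ha : a ∈ diagramsD p k)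
    (hF : RelationsUpTo p k a l F) (hl : l ≤ (p + k) / 2) (hst : a.Stable 0 l)
    (hr : ∀ r, a.IsRay r → r.val < l) :
    ((form p k).orthogonal (F.F l)).map (nilp p k ^ ((p + k) / 2 - l)) ≤ F.F l := by
  induction l using Nat.strong_induction_on with
  | _ l ih =>
  rcases Nat.eq_zero_or_pos l with rfl | hl0
  -- A diagram without rays occurs only for `p = k`; the claim is then that `x^k` vanishes on `V`.
  · have h1 := cnt_isRay_of_diagramsD ha
    rw [cnt_eq_zero (P := a.IsRay) fun z _ _ hz => by have := hr z hz; omega] at h1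
    obtain ⟨hk, hkp, hpk⟩ := h
    have hpk' : p = k := by
      rcases hpk with h | ⟨⟨b, hb⟩, ⟨b', hb'⟩⟩
      · exact h
      · omega
    have h2 := map_orthogonal_spanEF_le ⟨hk, hkp, hpk⟩ hpk' (r := 0) (s := 0)
      (t := (p + k) / 2 - 0) (by omega)
    have h3 : spanEF p k 0 0 = ⊥ := Submodule.finrank_eq_zero.1 (finrank_spanEF (by omega) (by omega))
    rwa [h3, ← F.zero] at h2
  have heven := even_sub hst hl hr
  have hm := h.even_add
  let z : Fin ((p + k) / 2) := ⟨l - 1, by omega⟩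
  have hzl : z.val + 1 = l := Nat.sub_add_cancel hl0
  have hzlt : z.val < l := by omega
  rcases a.left_or_right_or_ray z with hz | hz | hz
  · have h1 : z.val < (a.σ z).val := hz
    have := (hst z (Nat.zero_le _) hzlt).2
    omega
  · have hu := hz.isLeft
    have hlen := hu.length
    have hstu := hu.stable
    rw [a.invol] at hlen hstu
    rw [hzl] at hlen hstu
    have hcup := hF.cup _ hu (by rw [a.invol]; exact hzlt)
    rw [a.invol] at hcup
    have hult : (a.σ z).val < z.val := hz
    by_cases hM : a.σ z ∈ a.marked
    · rw [cupRelation_iff_of_marked hM (s := cnt a.IsRight (a.σ z).val l) (q := (p + k) / 2 - l)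
        (by omega) (by omega), hzl] at hcup
      rw [hcup.2]
      exact Submodule.map_comap_le _ _
    · rw [cupRelation_iff_of_not hM (s := cnt a.IsRight (a.σ z).val l) (by omega), hzl] at hcup
      rw [hcup]
      refine (isSkewPair h).map_orthogonal_comap_le ?_
      have h2 := ih (a.σ z).val (by omega) (hF.mono (by omega)) (by omega)
        (hst.of_right hstu (by omega)) fun r hr' => by
          by_contra hc
          refine hu.not_isRay_of_mem (z := r) (by omega) ?_ hr'
          rw [a.invol]
          have := hr r hr'
          omega
      rwa [show (p + k) / 2 - l + 2 * cnt a.IsRight (a.σ z).val l = (p + k) / 2 - (a.σ z).val by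
        omega]
  · have h1 := ray_good h ha hz (fun r hr' => by
      have := hr r hr'
      exact Fin.le_def.2 (by omega)) (hF.ray z hz hzlt)
    rwa [hzl] at h1

end Relations

/-! ### Shears -/

section Shear

open Module

variable {V : Type*} [AddCommGroup V] [Module ℂ V]

/-- The linear map `1 + c η`. -/
def shear (η : Module.End ℂ V) (c : ℂ) : Module.End ℂ V := 1 + c • η

theorem shear_apply (η : Module.End ℂ V) (c : ℂ) (v : V) : shear η c v = v + c • η v := rfl

theorem shear_neg_shear {η : Module.End ℂ V} (hη : ∀ v, η (η v) = 0) (c : ℂ) (v : V) :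
    shear η (-c) (shear η c v) = v := by
  simp [shear_apply, hη]

theorem shear_injective {η : Module.End ℂ V} (hη : ∀ v, η (η v) = 0) (c : ℂ) :
    Function.Injective (shear η c) :=
  Function.LeftInverse.injective (g := shear η (-c)) (shear_neg_shear hη c)

theorem map_shear_map_shear {η : Module.End ℂ V} (hη : ∀ v, η (η v) = 0) (c : ℂ)
    (S : Submodule ℂ V) : (S.map (shear η c)).map (shear η (-c)) = S := by
  rw [← Submodule.map_comp]
  convert Submodule.map_id S
  ext v
  exact shear_neg_shear hη c v

theorem map_shear_eq_self {η : Module.End ℂ V} (hη : ∀ v, η (η v) = 0) (c : ℂ)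
    {S : Submodule ℂ V} (hS : ∀ v ∈ S, η v ∈ S) : S.map (shear η c) = S := by
  have hle : ∀ c, S.map (shear η c) ≤ S := fun c => by
    rintro _ ⟨v, hv, rfl⟩
    exact add_mem hv (S.smul_mem c (hS v hv))
  refine le_antisymm (hle c) fun v hv => ⟨shear η (-c) v, hle _ ⟨v, hv, rfl⟩, ?_⟩
  simpa using shear_neg_shear hη (-c) v

/-- `η'` is the adjoint of `η`. It also squares to zero, so `1 - cη'` is the inverse adjoint of `1 +
cη`. -/
theorem exists_adjoint [FiniteDimensional ℂ V] {B : LinearMap.BilinForm ℂ V} (hB : B.Nondegenerate)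
    (hsymm : ∀ u v, B u v = B v u) {η : Module.End ℂ V} (hη : ∀ v, η (η v) = 0) :
    ∃ η' : Module.End ℂ V, (∀ v, η' (η' v) = 0) ∧
      ∀ c u v, B (shear η c u) (shear η' (-c) v) = B u v := by
  obtain ⟨η', h1⟩ : ∃ η' : Module.End ℂ V, ∀ u v, B (η u) v = B u (η' v) := by
    refine ⟨B.leftAdjointOfNondegenerate hB η, fun u v => ?_⟩
    rw [hsymm, hsymm u]
    exact (B.isAdjointPairLeftAdjointOfNondegenerate hB η v u).symm
  have h2 : ∀ u v, B u (η' (η' v)) = 0 := fun u v => by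
    rw [← h1, ← h1, hη, map_zero, LinearMap.zero_apply]
  refine ⟨η', fun v => ?_, fun c u v => ?_⟩
  · refine (B.toDual hB).injective (LinearMap.ext fun u => ?_)
    rw [LinearMap.BilinForm.toDual_def, hsymm, h2, map_zero, LinearMap.zero_apply]
  · simp [shear_apply, h1, h2]

namespace JordanPair.Transvections

variable {x : Module.End ℂ V} {U : Submodule ℂ V} {r : ℕ} {gen : Fin 2 → V}
  {η : Fin 2 → Module.End ℂ V} {α : Fin 2 → V →ₗ[ℂ] ℂ} (hT : Transvections x U r gen η α)
  (hJ : JordanPair x U r gen) (i : Fin 2) (c : ℂ)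

include hT

theorem map_shear_of_le {S : Submodule ℂ V} (hS : S ≤ U) : S.map (shear (η i) c) = S :=
  map_shear_eq_self (hT.sq i) c fun v hv => by
    rw [hT.eq_zero i v (hS hv)]
    exact zero_mem _

theorem map_shear_of_ge {S : Submodule ℂ V} (hS : U.comap (x ^ r) ≤ S) :
    S.map (shear (η i) c) = S :=
  map_shear_eq_self (hT.sq i) c fun v _ => hS (hT.mem i v)

variable [FiniteDimensional ℂ V]

include hJ

/-- `η i` commutes with `x` only modulo `U` and only on `x^{-r}U`. The induction works because `x`
preserves both subspaces. -/
theorem pow_comm (s : ℕ) {w : V} (hw : w ∈ U.comap (x ^ r)) :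
    (x ^ s) (η i w) - η i ((x ^ s) w) ∈ U := by
  induction s with
  | zero => simp
  | succ s ih =>
    have h1 : (x ^ s) w ∈ U.comap (x ^ r) := by
      rw [Submodule.mem_comap, ← Module.End.mul_apply, ← pow_add, add_comm, pow_add,
        Module.End.mul_apply]
      exact hJ.pow_mem_of_mem hw s
    have h2 := add_mem (hJ.map_mem _ ih) (hT.comm i _ h1)
    rw [pow_succ', Module.End.mul_apply, Module.End.mul_apply]
    rw [map_sub] at h2
    simpa using h2

theorem pow_shear_sub_mem (s : ℕ) {w : V} (hw : w ∈ U.comap (x ^ r)) :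
    (x ^ s) (shear (η i) c w) - shear (η i) c ((x ^ s) w) ∈ U := by
  have h1 := U.smul_mem c (hT.pow_comm hJ i s hw)
  rw [shear_apply, shear_apply, map_add, map_smul]
  rw [smul_sub] at h1
  convert h1 using 1
  abel

theorem map_pow_map_shear_le (s : ℕ) {S T : Submodule ℂ V} (hS : S ≤ U.comap (x ^ r))
    (hU : U ≤ T) (hST : S.map (x ^ s) ≤ T) :
    (S.map (shear (η i) c)).map (x ^ s) ≤ T.map (shear (η i) c) := by
  rintro _ ⟨_, ⟨w, hw, rfl⟩, rfl⟩
  have h1 : U ≤ T.map (shear (η i) c) := by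
    rw [← hT.map_shear_of_le i c le_rfl]
    exact Submodule.map_mono hU
  have h2 := h1 (hT.pow_shear_sub_mem hJ i c s (hS hw))
  have h3 : shear (η i) c ((x ^ s) w) ∈ T.map (shear (η i) c) := ⟨_, hST ⟨w, hw, rfl⟩, rfl⟩
  simpa using add_mem h2 h3

theorem sup_map_pow_map_shear (s : ℕ) {S T T' : Submodule ℂ V} (hS : S ≤ U.comap (x ^ r))
    (hU : U ≤ T) (hST : T ⊔ S.map (x ^ s) = T') :
    T.map (shear (η i) c) ⊔ (S.map (shear (η i) c)).map (x ^ s) = T'.map (shear (η i) c) := by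
  have h1 : U ≤ T.map (shear (η i) c) := by
    rw [← hT.map_shear_of_le i c le_rfl]
    exact Submodule.map_mono hU
  rw [← hST]
  refine le_antisymm (sup_le (Submodule.map_mono le_sup_left)
    (hT.map_pow_map_shear_le hJ i c s hS (hU.trans le_sup_left) le_sup_right)) ?_
  rw [Submodule.map_sup]
  refine sup_le le_sup_left ?_
  rintro _ ⟨_, ⟨w, hw, rfl⟩, rfl⟩
  have h2 := h1 (hT.pow_shear_sub_mem hJ i c s (hS hw))
  have h3 : (x ^ s) (shear (η i) c w) ∈ (S.map (shear (η i) c)).map (x ^ s) := ⟨_, ⟨w, hw, rfl⟩, rfl⟩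
  simpa using _root_.sub_mem (Submodule.mem_sup_right (S := T.map (shear (η i) c)) h3)
    (Submodule.mem_sup_left h2)

omit hJ [FiniteDimensional ℂ V] in
-- Skewness of `η i` removes the linear term in `c`; together with `η² = 0` it also removes the
-- quadratic one.
theorem form_shear {B : LinearMap.BilinForm ℂ V} (hB : IsSkewPair x B)
    (hU : U.comap (x ^ r) ≤ B.orthogonal U)
    (h1 : ∀ i c, Even c → B (gen i) ((x ^ c) (gen i)) = 0)
    (h2 : ∀ c, Even c → B (gen 0) ((x ^ c) (gen 1)) = 0) {v w : V} (hv : v ∈ U.comap (x ^ r))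
    (hw : w ∈ U.comap (x ^ r)) : B (shear (η i) c v) (shear (η i) c w) = B v w := by
  have h3 := hT.skew B hB hU h1 h2 i v hv w hw
  have h4 := hT.skew B hB hU h1 h2 i v hv (η i w) (hT.mem i w)
  rw [hT.sq, map_zero, add_zero] at h4
  simp only [shear_apply, map_add, map_smul, LinearMap.add_apply, LinearMap.smul_apply, smul_eq_mul,
    h4]
  linear_combination c * h3

end JordanPair.Transvections

end Shear

/-! ### Marked cups and the uniqueness of the next subspace -/

section Strata

open Module MarkedCupDiagram

variable {p k : ℕ} {a : MarkedCupDiagram ((p + k) / 2)} {F F' : CompleteFlag (Idx p k)}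

/-- The numerical and linear algebra conditions at a marked cup `u < σ u`. -/
structure MarkedCupData (p k : ℕ) (F : CompleteFlag (Idx p k)) (u w s q : ℕ) : Prop where
  even : Even q
  lt : u < p + k
  pos : 0 < s
  dim : 2 * (finrank ℂ (F.F u) + (q + 2 * s)) = finrank ℂ (Idx p k → ℂ)
  good : ((form p k).orthogonal (F.F u)).map (nilp p k ^ (q + 2 * s)) ≤ F.F u
  map_le : (F.F (u + 1)).map (nilp p k) ≤ F.F u
  succ : finrank ℂ (F.F (u + 1)) = finrank ℂ (F.F u) + 1
  right : finrank ℂ (F.F w) = finrank ℂ (F.F u) + 2 * s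

/-- A marked cup has no ray to its right and is not enclosed by a cup, so both `F_u` and the space
beyond the cup see only complete cups. This gives goodness of `F_u` and the parity of `q`. -/
theorem RelationsUpTo.markedCupData (h : IsTypeD p k) (ha : a ∈ diagramsD p k)
    {u : Fin ((p + k) / 2)} (hF : RelationsUpTo p k a u F) (hu : a.IsLeft u) (hM : u ∈ a.marked)
    {s q : ℕ} (hs : u.val + 2 * s = (a.σ u).val + 1) (hq : 2 * ((a.σ u).val + 1 + q) = p + k) :
    MarkedCupData p k F u ((a.σ u).val + 1) s q := by
  have hm := h.even_add
  have hlt : u.val < (a.σ u).val := hu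
  have hlt' := (a.σ u).2
  have hfin : finrank ℂ (Idx p k → ℂ) = p + k := by simp
  refine ⟨?_, by omega, by omega, ?_, ?_, hF.springer.2 _ (by omega), ?_, ?_⟩
  · have h1 := even_sub (stable_cup_of_marked hM hu) (by omega) fun r hr => by
      have := ray_lt_of_marked hM hu hr
      omega
    rwa [show (p + k) / 2 - ((a.σ u).val + 1) = q by omega] at h1
  · rw [F.finrank_eq (by omega)]
    omega
  · have h1 := hF.good h ha u.2.le (stable_of_marked hM) fun r hr => ray_lt_of_marked hM hu hr
    rwa [show (p + k) / 2 - u.val = q + 2 * s by omega] at h1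
  · rw [F.finrank_eq (by omega), F.finrank_eq (by omega)]
  · rw [F.finrank_eq (by omega), F.finrank_eq (by omega), hs]

theorem MarkedCupData.mem_range (h : IsTypeD p k) {u w s q : ℕ} (hd : MarkedCupData p k F u w s q)
    {f : Idx p k → ℂ} (hf : f ∈ F.F (u + 1)) : f ∈ LinearMap.range (nilp p k ^ (s + q)) :=
  (isSkewPair h).mem_range_of_good hd.dim hd.good (hd.map_le ⟨f, hf, rfl⟩) (by
    have := hd.pos
    omega)

theorem MarkedCupData.exists_mem (h : IsTypeD p k) {u w s q : ℕ}
    (hd : MarkedCupData p k F u w s q) :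
    ∃ f y, f ∈ F.F (u + 1) ∧ f ∉ F.F u ∧ (nilp p k ^ (s + q)) y = f := by
  obtain ⟨f, hf, hf'⟩ := SetLike.exists_of_lt (F.lt_succ u (by simpa using hd.lt))
  obtain ⟨y, hy⟩ := hd.mem_range h hf
  exact ⟨f, y, hf, hf', hy⟩

/-- An unmarked cup gives its last subspace as a preimage of an earlier one. For a marked cup both
subspaces equal the same `markedSpace`, formed from the common steps with the same `f` and `y`. -/
theorem isRight_eq (h : IsTypeD p k) (ha : a ∈ diagramsD p k) (hF : F ∈ K p k a)
    (hF' : F' ∈ K p k a) {v : Fin ((p + k) / 2)} (hv : a.IsLeft v)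
    (heq : ∀ l ≤ (a.σ v).val, F.F l = F'.F l) :
    F.F ((a.σ v).val + 1) = F'.F ((a.σ v).val + 1) := by
  have hm := h.even_add
  have hsk := isSkewPair h
  have hlt : v.val < (a.σ v).val := hv
  have hlt' := (a.σ v).2
  have h1 := hF.2.1 v hv
  have h1' := hF'.2.1 v hv
  have hlen := hv.length
  set s := cnt a.IsRight v.val ((a.σ v).val + 1)
  by_cases hM : v ∈ a.marked
  · have hq : 2 * ((a.σ v).val + 1 + ((p + k) / 2 - ((a.σ v).val + 1))) = p + k := by omega
    rw [cupRelation_iff_of_marked hM hlen hq] at h1 h1'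
    have hd := ((mem_K_iff.1 hF).mono v.2.le).markedCupData h ha hv hM hlen hq
    have hd' := ((mem_K_iff.1 hF').mono v.2.le).markedCupData h ha hv hM hlen hq
    obtain ⟨f, y, hf, hf', hy⟩ := hd.exists_mem h
    have e1 := heq v (by omega)
    have e2 := heq (v + 1) (by omega)
    have key : ∀ {F : CompleteFlag (Idx p k)} (hd : MarkedCupData p k F v ((a.σ v).val + 1) s
        ((p + k) / 2 - ((a.σ v).val + 1))), f ∈ F.F (v + 1) → f ∉ F.F v →
        F.F v ⊔ (F.F ((a.σ v).val + 1)).map (nilp p k ^ s) = F.F (v.val + 1) ∧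
          (form p k).orthogonal (F.F ((a.σ v).val + 1)) = (F.F ((a.σ v).val + 1)).comap
            (nilp p k ^ ((p + k) / 2 - ((a.σ v).val + 1))) →
        F.F ((a.σ v).val + 1) = IsSkewPair.markedSpace (nilp p k) (form p k) (F.F v) (F.F (v + 1)) s
          ((p + k) / 2 - ((a.σ v).val + 1)) f y := fun {F} hd hf hf' h1 =>
      hsk.eq_markedSpace hd.dim hd.good (F.mono (Nat.le_succ _)) hd.succ hf' hy hd.right
        (hsk.le_markedSpace hd.dim hd.even hd.good (F.mono (Nat.le_succ _)) hd.succ hf hf' hy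
          hd.right h1.1 h1.2)
    rw [key hd hf hf' h1, key hd' (e2 ▸ hf) (e1 ▸ hf') h1', e1, e2]
  · rw [cupRelation_iff_of_not hM hlen] at h1 h1'
    rw [h1, h1', heq v (by omega)]

theorem isRay_eq (h : IsTypeD p k) (hF : F ∈ K p k a) (hF' : F' ∈ K p k a)
    {v : Fin ((p + k) / 2)} (hv : a.IsRay v) : F.F (v.val + 1) = F'.F (v.val + 1) := by
  have h1 := hF.2.2 v hv
  have h2 := hF'.2.2 v hv
  rcases h.2.1.eq_or_lt with hpk | hpk
  · by_cases hM : v ∈ a.marked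
    · rw [(h1.1 hpk.symm).1 hM, (h2.1 hpk.symm).1 hM]
    · rw [(h1.1 hpk.symm).2 hM, (h2.1 hpk.symm).2 hM]
  · by_cases hM : v ∈ a.marked
    · rw [(h1.2 hpk).1 hM, (h2.2 hpk).1 hM]
    · by_cases hr : ∀ r, a.σ r = r → r ≤ v
      · rw [(h1.2 hpk).2.1 hM hr, (h2.2 hpk).2.1 hM hr]
      · rw [(h1.2 hpk).2.2 hM hr, (h2.2 hpk).2.2 hM hr]

/-- The flags in `K_a` that agree with `P` in the first `v` steps. -/
def stratum (a : MarkedCupDiagram ((p + k) / 2)) (P : CompleteFlag (Idx p k)) (v : ℕ) :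
    Set (CompleteFlag (Idx p k)) :=
  {F | F ∈ K p k a ∧ ∀ l ≤ v, F.F l = P.F l}

variable {P : CompleteFlag (Idx p k)}

theorem stratum_zero : stratum a P 0 = K p k a := by
  ext F
  refine ⟨fun hF => hF.1, fun hF => ⟨hF, fun l hl => ?_⟩⟩
  rw [Nat.le_zero.1 hl, F.zero, P.zero]

theorem stratum_eq_singleton (h : IsTypeD p k) (hP : P ∈ K p k a) :
    stratum a P ((p + k) / 2) = {P} := by
  ext F
  refine ⟨fun hF => ?_, fun hF => ?_⟩
  · exact IsIsotropicFlag.ext_half h.even_add hF.1.1.1 hP.1.1 hF.2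
  · rw [Set.mem_singleton_iff.1 hF]
    exact ⟨hP, fun _ _ => rfl⟩

theorem mem_stratum_succ {v : ℕ} : F ∈ stratum a P (v + 1) ↔
    F ∈ stratum a P v ∧ F.F (v + 1) = P.F (v + 1) := by
  refine ⟨fun hF => ⟨⟨hF.1, fun l hl => hF.2 l (by omega)⟩, hF.2 _ le_rfl⟩, fun hF =>
    ⟨hF.1.1, fun l hl => ?_⟩⟩
  rcases Nat.le_succ_iff.1 hl with hl | rfl
  · exact hF.1.2 l hl
  · exact hF.2

theorem stratum_succ_eq (h : IsTypeD p k) (ha : a ∈ diagramsD p k) (hP : P ∈ K p k a)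
    {v : Fin ((p + k) / 2)} (hv : ¬ a.IsLeft v) : stratum a P (v.val + 1) = stratum a P v.val := by
  ext F
  rw [mem_stratum_succ, and_iff_left_iff_imp]
  intro hF
  rcases (a.left_or_right_or_ray v).resolve_left hv with hv' | hv'
  · have h1 := isRight_eq h ha hF.1 hP hv'.isLeft
    rw [a.invol] at h1
    exact h1 hF.2
  · exact isRay_eq h hF.1 hP hv'

end Strata

/-! ### Shears of flags -/

section ShearFlags

open Module MarkedCupDiagram JordanPair

variable {p k : ℕ} {a : MarkedCupDiagram ((p + k) / 2)} {F F' P : CompleteFlag (Idx p k)}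

theorem CupRelation.congr {i j : ℕ} {M : Prop} (h : CupRelation p k F i j M)
    (h1 : F'.F (i - 1) = F.F (i - 1)) (h2 : F'.F i = F.F i) (h3 : F'.F j = F.F j) :
    CupRelation p k F' i j M := by
  rw [CupRelation] at h ⊢
  rw [h1, h2, h3]
  exact h

theorem RayRelation.congr {i c : ℕ} {M R : Prop} (h : RayRelation p k F i c M R)
    (h1 : F'.F i = F.F i) : RayRelation p k F' i c M R := by
  rw [RayRelation] at h ⊢
  rw [h1]
  exact h

/-- Generators of the Jordan blocks along which the flags in a stratum can be sheared at the left
endpoint `v` of a cup. -/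
structure ShearData (a : MarkedCupDiagram ((p + k) / 2)) (P : CompleteFlag (Idx p k))
    (v : Fin ((p + k) / 2)) (r : ℕ) (gen : Fin 2 → Idx p k → ℂ) : Prop where
  pair : JordanPair (nilp p k) (P.F v) r gen
  mem : (nilp p k ^ (r - 1)) (gen 0) ∈ P.F (v + 1)
  unmarked : v ∉ a.marked → v.val + 2 * r = (a.σ v).val + 1
  marked : v ∈ a.marked → v.val + r = (p + k) / 2
  form_self : v ∈ a.marked → ∀ i c, Even c → form p k (gen i) ((nilp p k ^ c) (gen i)) = 0
  form_cross : v ∈ a.marked → ∀ c, Even c → form p k (gen 0) ((nilp p k ^ c) (gen 1)) = 0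

/-- The relation of the cup says that `x^{-s}P_v` is a member of the flag, of the maximal dimension
`v + 2s`, so two Jordan blocks of length `s` exist above `P_v`. -/
theorem exists_shearData_of_not (h : IsTypeD p k) (hP : P ∈ K p k a) {v : Fin ((p + k) / 2)}
    (hv : a.IsLeft v) (hM : v ∉ a.marked) : ∃ r gen, ShearData a P v r gen := by
  have hm := h.even_add
  have hlt : v.val < (a.σ v).val := hv
  have hlt' := (a.σ v).2
  have hlen := hv.length
  set s := cnt a.IsRight v.val ((a.σ v).val + 1)
  have h1 := hP.2.1 v hv
  rw [cupRelation_iff_of_not hM hlen] at h1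
  obtain ⟨gen, h2, h3⟩ := JordanPair.exists_of_finrank (isSkewPair h).finrank_ker (s := s)
    (U := P.F v) (T := P.F (v + 1)) (by omega) (P.mono (Nat.le_succ _))
    (by rw [P.finrank_eq (by omega), P.finrank_eq (by omega)]) (hP.1.2 _ (by omega))
    (by rw [← h1, P.finrank_eq (by omega), P.finrank_eq (by omega), hlen])
  exact ⟨s, gen, h2, h3, fun _ => hlen, fun hM' => absurd hM' hM, fun hM' => absurd hM' hM,
    fun hM' => absurd hM' hM⟩

namespace ShearData

variable {v : Fin ((p + k) / 2)} {r : ℕ} {gen : Fin 2 → Idx p k → ℂ} (hd : ShearData a P v r gen)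
  (h : IsTypeD p k) (ha : a ∈ diagramsD p k) (hv : a.IsLeft v)

include hd hv

theorem eq_comap (hM : v ∉ a.marked) (hF : F ∈ stratum a P v) :
    F.F ((a.σ v).val + 1) = (P.F v).comap (nilp p k ^ r) := by
  have h1 := hF.1.2.1 v hv
  rw [cupRelation_iff_of_not hM (hd.unmarked hM)] at h1
  rw [h1, hF.2 _ le_rfl]

include h ha

theorem orthogonal_eq (hM : v ∈ a.marked) (hF : F ∈ stratum a P v) :
    (form p k).orthogonal (P.F v) = (P.F v).comap (nilp p k ^ r) := by
  have hm := h.even_add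
  have h2 := hd.marked hM
  have hlt := v.2
  rw [← hF.2 _ le_rfl]
  refine (isSkewPair h).orthogonal_eq_of_map_le ?_ ?_
  · rw [F.finrank_eq (by omega), h2, hm]
    simp
  · have h1 := ((mem_K_iff.1 hF.1).mono v.2.le).good h ha v.2.le (stable_of_marked hM) fun r hr =>
      ray_lt_of_marked hM hv hr
    rwa [show (p + k) / 2 - v.val = r by omega] at h1

/-- The range of steps in which the shear is under control: there it commutes with `x` modulo `P_v`,
and at a marked cup it is also an isometry. -/
theorem le_comap (hF : F ∈ stratum a P v) {l : ℕ} (hl : l ≤ (p + k) / 2)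
    (hl' : v ∉ a.marked → l ≤ (a.σ v).val + 1) : F.F l ≤ (P.F v).comap (nilp p k ^ r) := by
  by_cases hM : v ∈ a.marked
  · rw [← hd.orthogonal_eq h ha hv hM hF, ← hF.2 _ le_rfl]
    exact IsIsotropicFlag.le_orthogonal hF.1.1.1 (by
      have := v.2
      omega)
  · rw [← hd.eq_comap hv hM hF]
    exact F.mono (hl' hM)

variable {η : Fin 2 → Module.End ℂ (Idx p k → ℂ)} {α : Fin 2 → (Idx p k → ℂ) →ₗ[ℂ] ℂ}
  (hT : Transvections (nilp p k) (P.F v) r gen η α) (i : Fin 2) (c : ℂ)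

include hT

/-- At a marked cup the middle subspace lies in `P_v^⊥`, where the shear is an isometry. At an
unmarked cup it contains `x^{-r}P_v`, hence the image of `η`, and is not moved at all. -/
theorem form_shear_eq_zero (hF : F ∈ stratum a P v) {u w : Idx p k → ℂ}
    (hu : u ∈ F.F ((p + k) / 2)) (hw : w ∈ F.F ((p + k) / 2)) :
    form p k (shear (η i) c u) (shear (η i) c w) = 0 := by
  by_cases hM : v ∈ a.marked
  · have h1 := hd.le_comap h ha hv hF le_rfl fun h' => absurd hM h'
    rw [hT.form_shear i c (isSkewPair h) (hd.orthogonal_eq h ha hv hM hF).ge (hd.form_self hM)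
      (hd.form_cross hM) (h1 hu) (h1 hw)]
    exact IsIsotropicFlag.apply_eq_zero hF.1.1.1 (by omega) hu hw
  · have h1 : (P.F v).comap (nilp p k ^ r) ≤ F.F ((p + k) / 2) := by
      rw [← hd.eq_comap hv hM hF]
      exact F.mono (a.σ v).2
    have h2 : (F.F ((p + k) / 2)).map (shear (η i) c) = F.F ((p + k) / 2) :=
      hT.map_shear_of_ge i c h1
    refine IsIsotropicFlag.apply_eq_zero hF.1.1.1 (i := (p + k) / 2) (j := (p + k) / 2) (by omega)
      ?_ ?_
    · rw [← h2]
      exact ⟨u, hu, rfl⟩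
    · rw [← h2]
      exact ⟨w, hw, rfl⟩

/-- Steps up to `v` are fixed because `η` kills `P_v`. For an unmarked cup the steps from its right
end on, up to the middle, are fixed because they contain the image of `η`. In between, `x` commutes
with the shear modulo `P_v`, and `P_v` lies in all subspaces involved, so inclusions and sums are
carried along. -/
theorem mem_stratum_of_eq_map (hF : F ∈ stratum a P v) (hiso : IsIsotropicFlag F')
    (hF' : ∀ l ≤ (p + k) / 2, F'.F l = (F.F l).map (shear (η i) c)) : F' ∈ stratum a P v := by
  have hm := h.even_add
  have hsk := isSkewPair h
  have hU : F.F v = P.F v := hF.2 _ le_rfl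
  have hvlt : v.val < (a.σ v).val := hv
  have hlow : ∀ l ≤ v.val, F'.F l = F.F l := fun l hl => by
    rw [hF' l (hl.trans v.2.le)]
    refine hT.map_shear_of_le i c ?_
    rw [← hU]
    exact F.mono hl
  have hhigh : v ∉ a.marked → ∀ l, (a.σ v).val + 1 ≤ l → l ≤ (p + k) / 2 → F'.F l = F.F l :=
    fun hM l hl hl' => by
      rw [hF' l hl']
      refine hT.map_shear_of_ge i c ?_
      rw [← hd.eq_comap hv hM hF]
      exact F.mono hl
  have hwin : ∀ l ≤ (p + k) / 2, (v ∉ a.marked → l ≤ (a.σ v).val + 1) →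
      F.F l ≤ (P.F v).comap (nilp p k ^ r) := fun l hl hl' => hd.le_comap h ha hv hF hl hl'
  have hUle : ∀ l, v.val ≤ l → P.F v ≤ F.F l := fun l hl => by
    rw [← hU]
    exact F.mono hl
  have hspr : F' ∈ springerFiber p k := by
    refine hiso.map_nilp_le h.even_add fun l hl => ?_
    have hF1 := hF.1.1.2 l (by omega)
    rcases lt_or_ge l v.val with hlv | hlv
    · rwa [hlow l hlv.le, hlow _ hlv]
    by_cases hw : v ∉ a.marked → l + 1 ≤ (a.σ v).val + 1
    · have h1 := hT.map_pow_map_shear_le hd.pair i c 1 (hwin (l + 1) hl hw) (hUle l hlv)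
        (by rwa [pow_one])
      rwa [pow_one, ← hF' l hl.le, ← hF' _ hl] at h1
    · push Not at hw
      rwa [hhigh hw.1 l (by omega) hl.le, hhigh hw.1 (l + 1) (by omega) hl]
  refine ⟨⟨hspr, fun u hu => ?_, fun u hu => ?_⟩, fun l hl => by rw [hlow l hl, hF.2 l hl]⟩
  · have hcup := hF.1.2.1 u hu
    have hult : u.val < (a.σ u).val := hu
    have hu' := (a.σ u).2
    -- Cups lying in the range moved by the shear, the cup at `v` included.
    have hinside : v.val ≤ u.val → (v ∉ a.marked → (a.σ u).val + 1 ≤ (a.σ v).val + 1) →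
        CupRelation p k F' (u.val + 1) ((a.σ u).val + 1) (u ∈ a.marked) := by
      intro hvu hw
      have hD := hwin _ hu' hw
      have hlen := IsLeft.length (a := a) hu
      set s := cnt a.IsRight u.val ((a.σ u).val + 1)
      by_cases hMu : u ∈ a.marked
      · have hMv : v ∈ a.marked := by
          by_contra hMv
          have h1 := hw hMv
          rcases hvu.eq_or_lt with h2 | h2
          · exact hMv ((Fin.ext h2 : v = u) ▸ hMu)
          · refine (a.accessible u hMu).2 v ⟨h2, lt_of_le_of_ne (Fin.le_def.2 (by omega)) fun h3 => ?_⟩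
            have := a.σ_injective h3
            omega
        have hq : 2 * ((a.σ u).val + 1 + ((p + k) / 2 - ((a.σ u).val + 1))) = p + k := by omega
        rw [cupRelation_iff_of_marked hMu hlen hq, orthogonal_eq_comap_iff h hiso hq]
        rw [cupRelation_iff_of_marked hMu hlen hq, orthogonal_eq_comap_iff h hF.1.1.1 hq] at hcup
        constructor
        · rw [hF' _ u.2.le, hF' _ hu', hF' _ u.2]
          exact hT.sup_map_pow_map_shear hd.pair i c s hD (hUle _ hvu) hcup.1
        · have hDo := hd.orthogonal_eq h ha hv hMv hF
          have hle : F.F (p + k - ((a.σ u).val + 1)) ≤ (P.F v).comap (nilp p k ^ r) := by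
            rw [← hDo, ← hU]
            exact IsIsotropicFlag.le_orthogonal hF.1.1.1 (by omega)
          -- The second relation involves `F_{n-j}`, which lies above the middle but inside `P_v^⊥`.
          -- There the shear is an isometry, so its image is the orthogonal complement of the
          -- sheared `F_j`.
          have h1 : (F.F (p + k - ((a.σ u).val + 1))).map (shear (η i) c) =
              F'.F (p + k - ((a.σ u).val + 1)) := by
            refine map_eq_of_forall_mem (shear_injective (hT.sq i) c) ?_ ?_
            · rintro _ ⟨w, hw, rfl⟩
              rw [hiso _ (by omega), LinearMap.BilinForm.mem_orthogonal_iff, hF' _ hu']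
              rintro _ ⟨z, hz, rfl⟩
              rw [hT.form_shear i c hsk hDo.ge (hd.form_self hMv) (hd.form_cross hMv) (hD hz)
                (hle hw)]
              exact IsIsotropicFlag.apply_eq_zero hF.1.1.1 (by omega) hz hw
            · rw [F.finrank_eq (by omega), F'.finrank_eq (by omega)]
          rw [← h1, hF' _ hu']
          exact hT.map_pow_map_shear_le hd.pair i c _ hle (hUle _ (by omega)) hcup.2
      · rw [cupRelation_iff_of_not hMu hlen, eq_comap_iff_map_le h hlen (by omega)] at hcup ⊢
        rw [hF' _ u.2.le, hF' _ hu']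
        exact hT.map_pow_map_shear_le hd.pair i c s hD (hUle _ hvu) hcup
    rcases lt_or_ge (a.σ u).val v.val with h1 | h1
    · exact hcup.congr (hlow _ (by omega)) (hlow _ (by omega)) (hlow _ (by omega))
    rcases lt_or_ge u.val v.val with h2 | h2
    · have h3 : v ≠ a.σ u := fun h' => (IsLeft.isRight (a := a) hu : a.IsRight (a.σ u)) |>.not_isLeft (h' ▸ hv)
      have h4 : v < a.σ u := lt_of_le_of_ne h1 h3
      have h5 := a.noncrossing u v h2 h4
      have h6 : a.σ v ≠ a.σ u := fun h' => by
        have := a.σ_injective h'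
        omega
      have hM : v ∉ a.marked := fun hM => (a.accessible v hM).2 u ⟨h2, lt_of_le_of_ne h5 h6⟩
      have h7 : (a.σ v).val ≤ (a.σ u).val := h5
      exact hcup.congr (hlow _ (by omega)) (hlow _ (by omega)) (hhigh hM _ (by omega) hu')
    · by_cases hw : v ∉ a.marked → (a.σ u).val + 1 ≤ (a.σ v).val + 1
      · exact hinside h2 hw
      · push Not at hw
        obtain ⟨hM, hw⟩ := hw
        have h3 : (a.σ v).val < u.val := by
          by_contra hc
          have := (hv.stable u h2 (by omega)).2
          omega
        exact hcup.congr (hhigh hM _ (by omega) (by omega)) (hhigh hM _ (by omega) (by omega))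
          (hhigh hM _ (by omega) (by omega))
  · have hray := hF.1.2.2 u hu
    rcases lt_or_ge u.val v.val with h1 | h1
    · exact hray.congr (hlow _ h1)
    · have hM : v ∉ a.marked := fun hM => by
        have := ray_lt_of_marked hM hv hu
        omega
      have h2 : (a.σ v).val < u.val := by
        by_contra hc
        exact hv.not_isRay_of_mem h1 (by omega) hu
      exact hray.congr (hhigh hM _ (by omega) u.2)

end ShearData

end ShearFlags

/-! ### The fibration of a stratum over the projective line -/

section StratumBundle

open Module MarkedCupDiagram JordanPair FunSpace

variable {p k : ℕ} {a : MarkedCupDiagram ((p + k) / 2)} {F F' P : CompleteFlag (Idx p k)}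

/-- A stratum as a subvariety of the flag variety. -/
def stratumSpace (a : MarkedCupDiagram ((p + k) / 2)) (P : CompleteFlag (Idx p k)) (v : ℕ) :
    FunSpace (stratum a P v) :=
  (flagVariety (Idx p k)).induced ((↑) : stratum a P v → CompleteFlag (Idx p k))

namespace JordanPair.Transvections

variable {V : Type*} [AddCommGroup V] [Module ℂ V] [FiniteDimensional ℂ V] {x : Module.End ℂ V}
  {U T : Submodule ℂ V} {r : ℕ} {gen : Fin 2 → V} {η : Fin 2 → Module.End ℂ V}
  {α : Fin 2 → V →ₗ[ℂ] ℂ} (hT : Transvections x U r gen η α)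

include hT

omit [FiniteDimensional ℂ V] in
theorem coord_ne_zero {w : V} (hw : x w ∈ U) (hwU : w ∉ U) : (fun j => α j w) ≠ 0 := by
  intro h0
  have h1 := hT.sub_mem w hw
  have h2 : ∀ j, α j w = 0 := fun j => congrFun h0 j
  simp only [h2, zero_smul, Finset.sum_const_zero, sub_zero] at h1
  exact hwU h1

theorem mk_coord_eq (hUT : U ≤ T) (hfin : finrank ℂ T = finrank ℂ U + 1) {w w' : V} (hw : w ∈ T)
    (hw' : w' ∈ T) (hwU : w ∉ U) (h : (fun j => α j w) ≠ 0) (h' : (fun j => α j w') ≠ 0) :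
    Projectivization.mk ℂ _ h = Projectivization.mk ℂ _ h' := by
  rw [eq_comm, Projectivization.mk_eq_mk_iff']
  rw [← IsSkewPair.eq_sup_span hUT hfin hw hwU] at hw'
  obtain ⟨u, hu, z, hz, rfl⟩ := Submodule.mem_sup.1 hw'
  obtain ⟨b, rfl⟩ := Submodule.mem_span_singleton.1 hz
  refine ⟨b, funext fun j => ?_⟩
  simp [hT.coord_zero j u hu]

end JordanPair.Transvections

namespace ShearData

variable {v : Fin ((p + k) / 2)} {r : ℕ} {gen : Fin 2 → Idx p k → ℂ} (hd : ShearData a P v r gen)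
  (h : IsTypeD p k) (ha : a ∈ diagramsD p k) (hv : a.IsLeft v)

variable {η η' : Fin 2 → Module.End ℂ (Idx p k → ℂ)} {α : Fin 2 → (Idx p k → ℂ) →ₗ[ℂ] ℂ}
  (hT : Transvections (nilp p k) (P.F v) r gen η α) (i : Fin 2) (c : ℂ)

include hd h ha hv hT in
theorem exists_map_shear (hη' : ∀ i w, η' i (η' i w) = 0)
    (hadj : ∀ i c u w, form p k (shear (η i) c u) (shear (η' i) (-c) w) = form p k u w)
    (x : stratum a P v.val) : ∃ y : stratum a P v.val,
      (∀ l ≤ (p + k) / 2, y.1.F l = (x.1.F l).map (shear (η i) c)) ∧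
      ∀ l, (p + k) / 2 ≤ l → l ≤ p + k → y.1.F l = (x.1.F l).map (shear (η' i) (-c)) := by
  obtain ⟨F', h1, h2, h3⟩ := exists_isotropicFlag_map h h.even_add x.2.1.1.1
    (shear_injective (hT.sq i) c) (shear_injective (hη' i) (-c)) (hadj i c)
    fun u hu w hw => hd.form_shear_eq_zero h ha hv hT i c x.2 hu hw
  exact ⟨⟨F', hd.mem_stratum_of_eq_map h ha hv hT i c x.2 h1 h2⟩, h2, h3⟩

theorem isFrameOf_shear {m : ℕ} {g g' : Module.End ℂ (Idx p k → ℂ)} (hg : Function.Injective g)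
    (hg' : Function.Injective g') (h1 : ∀ l ≤ m, F'.F l = (F.F l).map g)
    (h2 : ∀ l, m ≤ l → l ≤ p + k → F'.F l = (F.F l).map g')
    {w : Fin (Fintype.card (Idx p k)) → Idx p k → ℂ} (hw : IsFrameOf w F) :
    IsFrameOf (fun j => if j.val < m then g (w j) else g' (w j)) F' := by
  intro j
  have hj : j.val < p + k := by simpa using j.2
  dsimp only
  split_ifs with hjm
  · rw [h1 _ hjm.le, h1 _ hjm]
    refine ⟨⟨_, (hw j).1, rfl⟩, fun h' => (hw j).2 ?_⟩
    obtain ⟨z, hz, hz'⟩ := h'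
    exact hg hz' ▸ hz
  · rw [h2 _ (by omega) hj.le, h2 _ (by omega) hj]
    refine ⟨⟨_, (hw j).1, rfl⟩, fun h' => (hw j).2 ?_⟩
    obtain ⟨z, hz, hz'⟩ := h'
    exact hg' hz' ▸ hz

theorem _root_.FunSpace.RegVec.shear {X : Type*} {ι : Type} [Fintype ι] {S : FunSpace X} {U : Set X}
    {w : X → ι → ℂ} {c : X → ℂ} (hU : IsOpen[S.top] U) (hc : S.reg U c) (hw : S.RegVec U w)
    (η : Module.End ℂ (ι → ℂ)) : S.RegVec U fun x => shear η (c x) (w x) :=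
  hw.add ((hw.linearMap hU η).smul hc)

include hd h ha hv in
-- The projection sends a flag to the line `F_{v+1}/P_v` in the coordinates `α`. The shears act on
-- the stratum as algebraic automorphisms and on these coordinates as transvections, so
-- `isFiberBundle_of_transvections` applies.
theorem exists_isFiberBundle :
    ∃ π : stratum a P v.val → ℙ ℂ (Fin 2 → ℂ),
      IsFiberBundle (stratumSpace a P v.val) projLine (stratumSpace a P (v.val + 1)) π := by
  have hsk := isSkewPair h
  have hm := h.even_add
  have hvlt := v.2
  obtain ⟨η, α, hT⟩ := hd.pair.exists_transvections hsk.finrank_ker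
  choose η' hη' hadj using fun i => exists_adjoint hsk.nondeg hsk.symm (hT.sq i)
  choose T hT1 hT2 using hd.exists_map_shear h ha hv hT (hη' := hη') (hadj := hadj)
  have hPx : ∀ x : stratum a P v.val, x.1.F v.val = P.F v.val := fun x => x.2.2 _ le_rfl
  have hxle : ∀ x : stratum a P v.val, ∀ w ∈ x.1.F (v.val + 1), nilp p k w ∈ P.F v.val :=
    fun x w hw => by
      rw [← hPx x]
      exact x.2.1.1.2 _ (by omega) ⟨w, hw, rfl⟩
  have hle : ∀ x : stratum a P v.val, P.F v.val ≤ x.1.F (v.val + 1) := fun x => by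
    rw [← hPx x]
    exact x.1.mono (Nat.le_succ _)
  have hfin : ∀ x : stratum a P v.val,
      finrank ℂ (x.1.F (v.val + 1)) = finrank ℂ (P.F v.val) + 1 := fun x => by
    rw [x.1.finrank_eq (by omega), P.finrank_eq (by omega)]
  have hex : ∀ x : stratum a P v.val, ∃ w ∈ x.1.F (v.val + 1), w ∉ P.F v.val := fun x => by
    rw [← hPx x]
    exact SetLike.exists_of_lt (x.1.lt_succ v (by simp; omega))
  choose w hw hw' using hex
  let π : stratum a P v.val → ℙ ℂ (Fin 2 → ℂ) := fun x =>
    Projectivization.mk ℂ (fun j => α j (w x)) (hT.coord_ne_zero (hxle x _ (hw x)) (hw' x))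
  have hπ : ∀ x, ∀ z ∈ x.1.F (v.val + 1), z ∉ P.F v.val → ∃ h0 : (fun j => α j z) ≠ 0,
      π x = Projectivization.mk ℂ (fun j => α j z) h0 := fun x z hz hz' =>
    ⟨hT.coord_ne_zero (hxle x z hz) hz',
      hT.mk_coord_eq (hle x) (hfin x) (hw x) hz (hw' x) _ _⟩
  have hsub : stratum a P (v.val + 1) ⊆ stratum a P v.val := fun F hF => (mem_stratum_succ.1 hF).1
  refine ⟨π, isFiberBundle_of_transvections ?_ T ?_ ?_ ?_
    (Set.inclusion hsub) ?_ (Set.inclusion_injective _) ?_ ?_⟩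
  · refine isMorphism_projLine fun x => ?_
    obtain ⟨W, hW, hx, s, hs, hs'⟩ := exists_local_lift (isMorphism_induced (flagVariety (Idx p k))
      ((↑) : stratum a P v.val → CompleteFlag (Idx p k))) x
    let j : Fin (Fintype.card (Idx p k)) := ⟨v.val, by simp; omega⟩
    refine ⟨W, hW, hx, fun y i => α i (s y j), fun i => (hs j).linear hW (α i), fun y hy => ?_⟩
    have h1 := hs' y hy j
    exact hπ y _ h1.1 (by
      rw [← hPx y]
      exact h1.2)
  · intro i Z R c f hc hf
    -- On a local frame the shear acts vector by vector, through `η` in the lower half and through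
    -- the adjoint `η'` in the upper half, with coefficients regular in `c`.
    refine IsMorphism.induced_lift (isMorphism_flagVariety fun z => ?_)
    obtain ⟨W, hW, hz, s, hs, hs'⟩ := exists_local_lift
      ((isMorphism_induced (flagVariety (Idx p k)) _).comp hf) z
    have hcW := R.restrict hc hW (Set.subset_univ _)
    refine ⟨W, hW, hz, fun z j => if j.val < (p + k) / 2 then shear (η i) (c z) (s z j)
      else shear (η' i) (-c z) (s z j), fun j => ?_, fun z hz => ?_⟩
    · by_cases hj : j.val < (p + k) / 2
      · simp only [if_pos hj]
        exact (hs j).shear hW hcW (η i)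
      · simp only [if_neg hj]
        exact (hs j).shear hW (reg_neg hcW) (η' i)
    · exact isFrameOf_shear (shear_injective (hT.sq i) _) (shear_injective (hη' i) _)
        (hT1 i (c z) (f z)) (hT2 i (c z) (f z)) (hs' z hz)
  · intro i c x
    refine Subtype.ext (IsIsotropicFlag.ext_half hm (T i (-c) (T i c x)).2.1.1.1 x.2.1.1.1
      fun l hl => ?_)
    rw [hT1 i (-c) _ l hl, hT1 i c x l hl, map_shear_map_shear (hT.sq i)]
  · intro i t c x hx
    have h1 : shear (η i) c (w x) ∈ (T i c x).1.F (v.val + 1) := by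
      rw [hT1 i c x _ hvlt]
      exact ⟨_, hw x, rfl⟩
    have h2 : shear (η i) c (w x) ∉ P.F v.val := by
      rw [← hPx (T i c x), hT1 i c x _ hvlt.le, hPx x]
      rintro ⟨z, hz, hz'⟩
      exact hw' x (shear_injective (hT.sq i) c hz' ▸ hz)
    obtain ⟨h0, h3⟩ := hπ _ _ h1 h2
    rw [h3, projPoint, Projectivization.mk_eq_mk_iff']
    obtain ⟨b, hb⟩ := (Projectivization.mk_eq_mk_iff' _ _ _ _ _).1 hx
    refine ⟨b, funext fun j => ?_⟩
    have hbj : ∀ j, b * chartVec i t j = α j (w x) := fun j => congrFun hb j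
    have hbi := hbj i
    simp only [chartVec, if_true, mul_one] at hbi
    rw [shear_apply, map_add, map_smul, hT.coord_apply, ← hbj j, ← hbi]
    simp only [chartVec, Pi.smul_apply, smul_eq_mul]
    split_ifs <;> ring
  · exact (IsMorphism.induced_lift (isMorphism_induced (flagVariety (Idx p k)) _))
  -- The line of `P` has coordinates `[1 : 0]`, since `P_{v+1}` is spanned by `P_v` and the socle
  -- vector `x^{r-1} (gen 0)`.
  · have hg0 : (nilp p k ^ (r - 1)) (gen 0) ∉ P.F v.val := fun h' => by
      have := congrFun (hd.pair.indep ![1, 0] (by simpa using h')) 0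
      simp at this
    rw [Set.range_inclusion]
    ext x
    show x.1 ∈ stratum a P (v.val + 1) ↔ π x = projPoint 0 0
    rw [mem_stratum_succ, and_iff_right x.2]
    constructor
    · intro hx
      obtain ⟨h0, h1⟩ := hπ x _ (hx ▸ hd.mem) hg0
      rw [h1, projPoint]
      congr 1
      funext j
      rw [hT.coord_gen]
      rfl
    · intro hx
      obtain ⟨b, hb⟩ := (Projectivization.mk_eq_mk_iff' _ _ _ _ _).1 hx
      have h1 : α 1 (w x) = 0 := by
        rw [← congrFun hb 1]
        simp [chartVec]
      have h2 := hT.sub_mem (w x) (hxle x _ (hw x))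
      rw [Fin.sum_univ_two, h1, zero_smul, add_zero] at h2
      have h3 : w x ∈ P.F (v.val + 1) := by
        have := add_mem (P.mono (Nat.le_succ _) h2) (Submodule.smul_mem _ (α 0 (w x)) hd.mem)
        rwa [sub_add_cancel] at this
      refine Submodule.eq_of_le_of_finrank_le ?_ ?_
      · rw [← IsSkewPair.eq_sup_span (hle x) (hfin x) (hw x) (hw' x)]
        exact sup_le (P.mono (Nat.le_succ _)) ((Submodule.span_singleton_le_iff_mem _ _).2 h3)
      · rw [x.1.finrank_eq (by omega), P.finrank_eq (by omega)]
  · intro Z R f hf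
    exact IsMorphism.induced_lift ((isMorphism_induced (flagVariety (Idx p k))
      ((↑) : stratum a P v.val → CompleteFlag (Idx p k))).comp hf)

end ShearData

/-- Descending induction on `v`: a left end adds one bundle step, any other vertex changes nothing.
Generators at unmarked cups always exist; at marked cups the isotropy conditions depend on the
choice of `P`, hence the hypothesis `hshear`. -/
theorem isIteratedBundle_stratum (h : IsTypeD p k) (ha : a ∈ diagramsD p k) (hP : P ∈ K p k a)
    (hshear : ∀ v : Fin ((p + k) / 2), a.IsLeft v → v ∈ a.marked → ∃ r gen, ShearData a P v r gen)
    {v d : ℕ} (hv : v + d = (p + k) / 2) :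
    IsIteratedBundle (cnt a.IsLeft v ((p + k) / 2)) (stratumSpace a P v) := by
  induction d generalizing v with
  | zero =>
    obtain rfl : v = (p + k) / 2 := hv
    rw [cnt_self]
    have h1 := stratum_eq_singleton h hP
    exact ⟨⟨⟨P, by rw [h1]; rfl⟩, fun x => Subtype.ext (h1.le x.2)⟩⟩
  | succ d ih =>
    replace ih := ih (v := v + 1) (by omega)
    have hc := cnt_add a.IsLeft (Nat.le_succ v) (show v + 1 ≤ (p + k) / 2 by omega)
    let z : Fin ((p + k) / 2) := ⟨v, by omega⟩
    by_cases hz : a.IsLeft z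
    · have h1 : cnt a.IsLeft v (v + 1) = 1 := by
        have := cnt_succ_of_pos (P := a.IsLeft) (u := v) (v := z) le_rfl hz
        rwa [cnt_self] at this
      rw [hc, h1, add_comm]
      obtain ⟨r, gen, hd⟩ : ∃ r gen, ShearData a P z r gen := by
        by_cases hM : z ∈ a.marked
        · exact hshear z hz hM
        · exact exists_shearData_of_not h hP hz hM
      obtain ⟨π, hπ⟩ := hd.exists_isFiberBundle h ha hz
      exact ⟨_, _, π, hπ, ih⟩
    · have h1 : cnt a.IsLeft v (v + 1) = 0 := by
        have := cnt_succ_of_neg (P := a.IsLeft) (u := v) (v := z) le_rfl hz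
        rwa [cnt_self] at this
      rw [hc, h1, zero_add]
      have h2 := stratum_succ_eq h ha hP hz
      have h3 : ∀ S : Set (CompleteFlag (Idx p k)), stratum a P (v + 1) = S →
          IsIteratedBundle (cnt a.IsLeft (v + 1) ((p + k) / 2))
            ((flagVariety (Idx p k)).induced ((↑) : S → CompleteFlag (Idx p k))) := by
        rintro S rfl
        exact ih
      exact h3 _ h2

end StratumBundle

/-! ### Subspaces spanned by two Jordan chains -/

section ChainSpan

open Module

variable {V : Type*} [AddCommGroup V] [Module ℂ V]

/-- The subspace spanned by `U` and by the images of `gen 0` and `gen 1` under the powers of `x`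
with exponent at least `t - a` and `t - b`, respectively. -/
def chainSpan (x : Module.End ℂ V) (U : Submodule ℂ V) (t : ℕ) (gen : Fin 2 → V) (a b : ℕ) :
    Submodule ℂ V :=
  U ⊔ Submodule.span ℂ ({w | ∃ c, t ≤ c + a ∧ w = (x ^ c) (gen 0)} ∪
    {w | ∃ c, t ≤ c + b ∧ w = (x ^ c) (gen 1)})

/-- Generators of two Jordan blocks of length `t` modulo `U` that are isotropic up to the pairing
of each block with the other one. -/
structure IsotropicPair (x : Module.End ℂ V) (B : LinearMap.BilinForm ℂ V) (U : Submodule ℂ V)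
    (t : ℕ) (gen : Fin 2 → V) : Prop where
  map_mem : ∀ u ∈ U, x u ∈ U
  pow_mem : ∀ i, (x ^ t) (gen i) ∈ U
  indep : 0 < t → ∀ c : Fin 2 → ℂ, ∑ i, c i • (x ^ (t - 1)) (gen i) ∈ U → c = 0
  orthogonal_eq : B.orthogonal U = U.comap (x ^ t)
  form_self : ∀ i c, Even c → B (gen i) ((x ^ c) (gen i)) = 0
  form_cross : ∀ c, Even c → B (gen 0) ((x ^ c) (gen 1)) = 0

variable {x : Module.End ℂ V} {B : LinearMap.BilinForm ℂ V} {U : Submodule ℂ V} {t : ℕ}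
  {gen : Fin 2 → V}

theorem le_chainSpan {a b : ℕ} : U ≤ chainSpan x U t gen a b := le_sup_left

theorem gen_zero_mem_chainSpan {a b c : ℕ} (hc : t ≤ c + a) :
    (x ^ c) (gen 0) ∈ chainSpan x U t gen a b :=
  Submodule.mem_sup_right (Submodule.subset_span (Or.inl ⟨c, hc, rfl⟩))

theorem gen_one_mem_chainSpan {a b c : ℕ} (hc : t ≤ c + b) :
    (x ^ c) (gen 1) ∈ chainSpan x U t gen a b :=
  Submodule.mem_sup_right (Submodule.subset_span (Or.inr ⟨c, hc, rfl⟩))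

theorem chainSpan_le {a b : ℕ} {S : Submodule ℂ V} (hU : U ≤ S)
    (h0 : ∀ c, t ≤ c + a → (x ^ c) (gen 0) ∈ S) (h1 : ∀ c, t ≤ c + b → (x ^ c) (gen 1) ∈ S) :
    chainSpan x U t gen a b ≤ S := by
  refine sup_le hU (Submodule.span_le.2 ?_)
  rintro _ (⟨c, hc, rfl⟩ | ⟨c, hc, rfl⟩)
  · exact h0 c hc
  · exact h1 c hc

theorem chainSpan_mono {a b a' b' : ℕ} (ha : a ≤ a') (hb : b ≤ b') :
    chainSpan x U t gen a b ≤ chainSpan x U t gen a' b' :=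
  chainSpan_le le_chainSpan (fun _ hc => gen_zero_mem_chainSpan (by omega))
    fun _ hc => gen_one_mem_chainSpan (by omega)

namespace IsotropicPair

variable (h : IsotropicPair x B U t gen)

include h

theorem pow_mem_of_mem {u : V} (hu : u ∈ U) (a : ℕ) : (x ^ a) u ∈ U := by
  induction a with
  | zero => simpa using hu
  | succ a ih =>
    rw [pow_succ', Module.End.mul_apply]
    exact h.map_mem _ ih

theorem pow_mem_of_le {c : ℕ} (hc : t ≤ c) (i : Fin 2) : (x ^ c) (gen i) ∈ U := by
  rw [← Nat.sub_add_cancel hc, pow_add, Module.End.mul_apply]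
  exact h.pow_mem_of_mem (h.pow_mem i) _

theorem chainSpan_zero : chainSpan x U t gen 0 0 = U :=
  le_antisymm (chainSpan_le le_rfl (fun _ hc => h.pow_mem_of_le hc 0)
    fun _ hc => h.pow_mem_of_le hc 1) le_chainSpan

theorem map_pow_chainSpan_le {a b a' b' s : ℕ} (ha : a ≤ a' + s) (hb : b ≤ b' + s) :
    (chainSpan x U t gen a b).map (x ^ s) ≤ chainSpan x U t gen a' b' := by
  rw [Submodule.map_le_iff_le_comap]
  refine chainSpan_le (fun u hu => le_chainSpan (h.pow_mem_of_mem hu s)) (fun c hc => ?_)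
    fun c hc => ?_ <;> rw [Submodule.mem_comap, ← Module.End.mul_apply, ← pow_add]
  · exact gen_zero_mem_chainSpan (by omega)
  · exact gen_one_mem_chainSpan (by omega)

theorem jordanPair (ht : 0 < t) : JordanPair x U t gen := ⟨ht, h.map_mem, h.pow_mem, h.indep ht⟩

variable [FiniteDimensional ℂ V] (hB : IsSkewPair x B)

include hB

theorem exists_coord_zero {a : ℕ} (ha : a < t) (b : ℕ) : ∃ A : V →ₗ[ℂ] ℂ,
    chainSpan x U t gen a b ≤ LinearMap.ker A ∧ A ((x ^ (t - 1 - a)) (gen 0)) = 1 ∧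
      ∀ c, A ((x ^ c) (gen 1)) = 0 := by
  obtain ⟨A, hA0, hA, -⟩ := (h.jordanPair (by omega)).exists_coords hB.finrank_ker
  have h1 : ∀ c, A 0 (t - 1 - a) ((x ^ c) (gen 1)) = 0 := fun c => by
    rcases lt_or_ge c t with hct | hct
    · rw [hA 0 1 _ c (by omega) hct, if_neg (by simp)]
    · exact hA0 _ _ _ (h.pow_mem_of_le hct 1)
  refine ⟨A 0 (t - 1 - a), chainSpan_le (fun u hu => hA0 _ _ u hu) (fun c hc => ?_)
    (fun c _ => h1 c), ?_, h1⟩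
  · rw [LinearMap.mem_ker]
    rcases lt_or_ge c t with hct | hct
    · rw [hA 0 0 _ c (by omega) hct, if_neg (by omega)]
    · exact hA0 _ _ _ (h.pow_mem_of_le hct 0)
  · rw [hA 0 0 _ _ (by omega) (by omega), if_pos ⟨rfl, rfl⟩]

theorem exists_coord_one (a : ℕ) {b : ℕ} (hb : b < t) : ∃ A : V →ₗ[ℂ] ℂ,
    chainSpan x U t gen a b ≤ LinearMap.ker A ∧ A ((x ^ (t - 1 - b)) (gen 1)) = 1 ∧
      ∀ c, A ((x ^ c) (gen 0)) = 0 := by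
  obtain ⟨A, hA0, hA, -⟩ := (h.jordanPair (by omega)).exists_coords hB.finrank_ker
  have h1 : ∀ c, A 1 (t - 1 - b) ((x ^ c) (gen 0)) = 0 := fun c => by
    rcases lt_or_ge c t with hct | hct
    · rw [hA 1 0 _ c (by omega) hct, if_neg (by simp)]
    · exact hA0 _ _ _ (h.pow_mem_of_le hct 0)
  refine ⟨A 1 (t - 1 - b), chainSpan_le (fun u hu => hA0 _ _ u hu) (fun c _ => h1 c)
    (fun c hc => ?_), ?_, h1⟩
  · rw [LinearMap.mem_ker]
    rcases lt_or_ge c t with hct | hct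
    · rw [hA 1 1 _ c (by omega) hct, if_neg (by omega)]
    · exact hA0 _ _ _ (h.pow_mem_of_le hct 1)
  · rw [hA 1 1 _ _ (by omega) (by omega), if_pos ⟨rfl, rfl⟩]

theorem finrank_chainSpan {a b : ℕ} (ha : a ≤ t) (hb : b ≤ t) :
    finrank ℂ (chainSpan x U t gen a b) = finrank ℂ U + a + b := by
  induction a with
  | zero =>
    induction b with
    | zero => rw [h.chainSpan_zero, add_zero, add_zero]
    | succ b ih =>
      obtain ⟨A, h1, h2, -⟩ := h.exists_coord_one hB 0 (b := b) (by omega)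
      have h3 : (x ^ (t - 1 - b)) (gen 1) ∉ chainSpan x U t gen 0 b := fun h3 =>
        one_ne_zero (h2.symm.trans (h1 h3))
      rw [← add_assoc, ← ih (by omega), ← Submodule.finrank_sup_span_singleton h3]
      refine congrArg (fun S : Submodule ℂ V => finrank ℂ S) ?_
      refine le_antisymm (chainSpan_le (le_chainSpan.trans le_sup_left)
        (fun c hc => Submodule.mem_sup_left (gen_zero_mem_chainSpan hc)) fun c hc => ?_)
        (sup_le (chainSpan_mono le_rfl (by omega)) ((Submodule.span_singleton_le_iff_mem _ _).2
          (gen_one_mem_chainSpan (by omega))))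
      rcases (show t - 1 - b ≤ c by omega).eq_or_lt with rfl | hc'
      · exact Submodule.mem_sup_right (Submodule.mem_span_singleton_self _)
      · exact Submodule.mem_sup_left (gen_one_mem_chainSpan (by omega))
  | succ a ih =>
    obtain ⟨A, h1, h2, -⟩ := h.exists_coord_zero hB (a := a) (by omega) b
    have h3 : (x ^ (t - 1 - a)) (gen 0) ∉ chainSpan x U t gen a b := fun h3 =>
      one_ne_zero (h2.symm.trans (h1 h3))
    rw [show finrank ℂ U + (a + 1) + b = finrank ℂ U + a + b + 1 by ring, ← ih (by omega),
      ← Submodule.finrank_sup_span_singleton h3]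
    refine congrArg (fun S : Submodule ℂ V => finrank ℂ S) ?_
    refine le_antisymm (chainSpan_le (le_chainSpan.trans le_sup_left) (fun c hc => ?_)
      fun c hc => Submodule.mem_sup_left (gen_one_mem_chainSpan hc))
      (sup_le (chainSpan_mono (by omega) le_rfl) ((Submodule.span_singleton_le_iff_mem _ _).2
        (gen_zero_mem_chainSpan (by omega))))
    rcases (show t - 1 - a ≤ c by omega).eq_or_lt with rfl | hc'
    · exact Submodule.mem_sup_right (Submodule.mem_span_singleton_self _)
    · exact Submodule.mem_sup_left (gen_zero_mem_chainSpan (by omega))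

/-- Modulo the chain span the two blocks have lengths `t - a` and `t - b`. Multiplying the
generators by `x^b` and `x^a` cuts both down to `t - a - b`. -/
theorem jordanPair_chainSpan {a b : ℕ} (hab : a + b < t) :
    JordanPair x (chainSpan x U t gen a b) (t - a - b)
      ![(x ^ b) (gen 0), (x ^ a) (gen 1)] := by
  have e0 : ∀ c, (x ^ c) ((x ^ b) (gen 0)) = (x ^ (c + b)) (gen 0) := fun c => by
    rw [pow_add, Module.End.mul_apply]
  have e1 : ∀ c, (x ^ c) ((x ^ a) (gen 1)) = (x ^ (c + a)) (gen 1) := fun c => by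
    rw [pow_add, Module.End.mul_apply]
  refine ⟨by omega, fun u hu => ?_, fun i => ?_, fun c hc => ?_⟩
  · have := h.map_pow_chainSpan_le (s := 1) (a := a) (b := b) (a' := a) (b' := b) (by omega)
      (by omega) ⟨u, hu, rfl⟩
    simpa using this
  · fin_cases i
    · exact e0 _ ▸ gen_zero_mem_chainSpan (by omega)
    · exact e1 _ ▸ gen_one_mem_chainSpan (by omega)
  · simp only [Fin.sum_univ_two, Matrix.cons_val_zero, Matrix.cons_val_one, e0, e1] at hc
    rw [show t - a - b - 1 + b = t - 1 - a by omega, show t - a - b - 1 + a = t - 1 - b by omega]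
      at hc
    obtain ⟨A, h1, h2, h3⟩ := h.exists_coord_zero hB (a := a) (by omega) b
    obtain ⟨A', h1', h2', h3'⟩ := h.exists_coord_one hB a (b := b) (by omega)
    have h4 := h1 hc
    have h5 := h1' hc
    rw [LinearMap.mem_ker, map_add, map_smul, map_smul, h2, h3, smul_zero, add_zero, smul_eq_mul,
      mul_one] at h4
    rw [LinearMap.mem_ker, map_add, map_smul, map_smul, h2', h3', smul_zero, zero_add, smul_eq_mul,
      mul_one] at h5
    ext i
    fin_cases i
    · exact h4
    · exact h5

theorem form_pow_self (i : Fin 2) (c c' : ℕ) : B ((x ^ c) (gen i)) ((x ^ c') (gen i)) = 0 := by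
  rw [hB.pow_apply, ← Module.End.mul_apply, ← pow_add]
  rcases Nat.even_or_odd (c + c') with he | ho
  · rw [h.form_self i _ he, mul_zero]
  · rw [hB.odd_pow_self ho, mul_zero]

/-- If `c + c' ≥ t`, then `x^{c+c'} (gen 1)` lies in `U`, while `gen 0` lies in `x^{-t}U = U^⊥`. -/
theorem form_pow_cross {c c' : ℕ} (hc : t ≤ c + c' ∨ Even (c + c')) :
    B ((x ^ c) (gen 0)) ((x ^ c') (gen 1)) = 0 := by
  rw [hB.pow_apply, ← Module.End.mul_apply, ← pow_add]
  rcases hc with hc | hc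
  · have h1 : gen 0 ∈ B.orthogonal U := by
      rw [h.orthogonal_eq]
      exact h.pow_mem 0
    rw [hB.symm, LinearMap.BilinForm.mem_orthogonal_iff.1 h1 _ (h.pow_mem_of_le hc 1), mul_zero]
  · rw [h.form_cross _ hc, mul_zero]

/-- Only vectors of different chains can pair, and the inequalities push the sum of their exponents
to at least `t`. -/
theorem chainSpan_le_orthogonal {a b a' b' : ℕ} (h1 : a + b' ≤ t) (h2 : b + a' ≤ t) :
    chainSpan x U t gen a b ≤ B.orthogonal (chainSpan x U t gen a' b') := by
  have hU : ∀ a b, chainSpan x U t gen a b ≤ B.orthogonal U := fun a b => by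
    rw [h.orthogonal_eq]
    refine chainSpan_le (fun u hu => h.pow_mem_of_mem hu t) (fun c _ => ?_) fun c _ => ?_ <;>
      rw [Submodule.mem_comap, ← Module.End.mul_apply, ← pow_add] <;>
      exact h.pow_mem_of_le (by omega) _
  have key : ∀ w ∈ chainSpan x U t gen a b, (∀ c, t ≤ c + a' → B w ((x ^ c) (gen 0)) = 0) →
      (∀ c, t ≤ c + b' → B w ((x ^ c) (gen 1)) = 0) →
      w ∈ B.orthogonal (chainSpan x U t gen a' b') := by
    intro w hw h0 h1
    rw [LinearMap.BilinForm.mem_orthogonal_iff]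
    intro u hu
    rw [hB.symm]
    have h3 : chainSpan x U t gen a' b' ≤ LinearMap.ker (B w) :=
      chainSpan_le (fun u hu => by
        rw [LinearMap.mem_ker, hB.symm]
        exact LinearMap.BilinForm.mem_orthogonal_iff.1 (hU a b hw) u hu) h0 h1
    exact h3 hu
  refine chainSpan_le (fun u hu => key u (le_chainSpan hu) (fun c hc => ?_) fun c hc => ?_)
    (fun c hc => key _ (gen_zero_mem_chainSpan hc) (fun c' _ => h.form_pow_self hB 0 c c')
      fun c' hc' => h.form_pow_cross hB (Or.inl (by omega)))
    fun c hc => key _ (gen_one_mem_chainSpan hc) (fun c' hc' => ?_)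
      fun c' _ => h.form_pow_self hB 1 c c'
  · exact LinearMap.BilinForm.mem_orthogonal_iff.1 (hU a' b' (gen_zero_mem_chainSpan hc)) u hu
  · exact LinearMap.BilinForm.mem_orthogonal_iff.1 (hU a' b' (gen_one_mem_chainSpan hc)) u hu
  · rw [hB.symm]
    exact h.form_pow_cross hB (Or.inl (by omega))

theorem orthogonal_chainSpan (hdim : 2 * (finrank ℂ U + t) = finrank ℂ V) {a b : ℕ} (ha : a ≤ t)
    (hb : b ≤ t) :
    B.orthogonal (chainSpan x U t gen a b) = chainSpan x U t gen (t - b) (t - a) := by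
  symm
  refine Submodule.eq_of_le_of_finrank_le (h.chainSpan_le_orthogonal hB (by omega) (by omega)) ?_
  have h1 := hB.finrank_orthogonal (chainSpan x U t gen a b)
  rw [h.finrank_chainSpan hB ha hb] at h1
  rw [h.finrank_chainSpan hB (by omega) (by omega)]
  omega

end IsotropicPair

end ChainSpan

/-! ### The Jordan blocks beyond the rightmost ray -/

section ConcretePairs

open Module MarkedCupDiagram

variable {p k : ℕ}

/-- The chains ending at `e_r` and `f_s` pair nontrivially only through `x^{t-1}`, and `t - 1` is
odd. -/
theorem isotropicPair_spanEF (h : IsTypeD p k) (hpk : p = k) {r s t : ℕ} (ht : r + s + t = k)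
    (he : Even t) : IsotropicPair (nilp p k) (form p k) (spanEF p k r s) t
      ![eVec p k (k - s), fVec p k (k - r)] where
  map_mem u hu := by
    have h1 : (spanEF p k r s).map (nilp p k ^ 1) ≤ spanEF p k r s :=
      map_pow_spanEF_le (by omega) (by omega)
    rw [pow_one] at h1
    exact h1 ⟨u, hu, rfl⟩
  pow_mem i := by
    fin_cases i
    · simp only [Fin.zero_eta, Matrix.cons_val_zero]
      rw [nilp_pow_eVec k (by omega)]
      exact eVec_mem_spanEF _ (by omega)
    · simp only [Fin.mk_one, Matrix.cons_val_one, Matrix.cons_val_zero]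
      rw [nilp_pow_fVec p (by omega)]
      exact fVec_mem_spanEF _ (by omega)
  indep ht0 c hc := by
    simp only [Fin.sum_univ_two, Matrix.cons_val_zero, Matrix.cons_val_one] at hc
    rw [nilp_pow_eVec k (by omega), nilp_pow_fVec p (by omega), mem_spanEF] at hc
    have h0 := hc.1 ⟨r, by omega⟩ le_rfl
    have h1 := hc.2 ⟨s, by omega⟩ le_rfl
    simp only [Pi.add_apply, Pi.smul_apply, eVec, fVec, smul_eq_mul] at h0 h1
    rw [if_pos (by omega)] at h0 h1
    ext i
    fin_cases i
    · simpa using h0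
    · simpa using h1
  orthogonal_eq := by
    refine (isSkewPair h).orthogonal_eq_of_map_le ?_ (map_orthogonal_spanEF_le h hpk ht)
    rw [finrank_spanEF (by omega) (by omega)]
    simp
    omega
  form_self i c _ := by
    fin_cases i
    · simp only [Fin.zero_eta, Matrix.cons_val_zero]
      rw [nilp_pow_eVec k (by omega), form_eVec_eVec, if_neg (by omega)]
    · simp only [Fin.mk_one, Matrix.cons_val_one, Matrix.cons_val_zero]
      rw [nilp_pow_fVec p (by omega), form_fVec_fVec, if_neg (by omega)]
  form_cross c hc := by
    simp only [Matrix.cons_val_one, Matrix.cons_val_zero]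
    rw [nilp_pow_fVec p (by omega), form_eVec_fVec, if_neg]
    obtain ⟨b, rfl⟩ := hc
    obtain ⟨b', rfl⟩ := he
    omega

variable {d : ℕ} {σ : ℂ}

theorem map_diagSpan_le (hd : p = k + 2 * d) {c : ℕ} (hc : c < k) :
    (diagSpan p k d σ c).map (nilp p k) ≤ spanEF p k (c + d) c := by
  rw [diagSpan, Submodule.map_sup, Submodule.map_span, Set.image_singleton]
  have h1 : (spanEF p k (c + d) c).map (nilp p k ^ 1) ≤ spanEF p k (c + d) c :=
    map_pow_spanEF_le (by omega) (by omega)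
  rw [pow_one] at h1
  refine sup_le h1 ((Submodule.span_singleton_le_iff_mem _ _).2 ?_)
  have h2 := nilp_pow_diagVec_of_le (σ := σ) hd (l := c + 1) (s := 1) (by omega) (by omega)
  rw [pow_one] at h2
  rw [h2]
  exact diagVec_mem_spanEF _ _ (by omega) (by omega)

theorem diagSpan_inr_eq_zero {c : ℕ} {w : Idx p k → ℂ} (hw : w ∈ diagSpan p k d σ c) (j : Fin k)
    (hj : c < j.val) : w (Sum.inr j) = 0 := by
  have h1 : diagSpan p k d σ c ≤ spanEF p k (c + 1 + d) (c + 1) :=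
    sup_le (spanEF_mono (by omega) (by omega)) ((Submodule.span_singleton_le_iff_mem _ _).2
      (diagVec_mem_spanEF _ _ (by omega) (by omega)))
  exact (mem_spanEF.1 (h1 hw)).2 j hj

theorem diagSpan_relation {c : ℕ} {w : Idx p k → ℂ} (hw : w ∈ diagSpan p k d σ c) (i : Fin p)
    (j : Fin k) (hi : i.val = c + d) (hj : j.val = c) : w (Sum.inl i) = σ * w (Sum.inr j) := by
  obtain ⟨u, hu, v, hv, rfl⟩ := Submodule.mem_sup.1 hw
  obtain ⟨b, rfl⟩ := Submodule.mem_span_singleton.1 hv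
  simp only [Pi.add_apply, (mem_spanEF.1 hu).1 i hi.ge, (mem_spanEF.1 hu).2 j hj.ge, diagVec,
    Pi.smul_apply, eVec, fVec, smul_eq_mul]
  rw [if_pos (by omega), if_pos (by omega)]
  ring

/-- The chains consist of diagonal vectors of opposite signs. Each is isotropic because `1 - σ² =
0`, and they pair only through `x^{k-2c-2}`, an odd power as `k` is odd. -/
theorem isotropicPair_diagSpan (h : IsTypeD p k) (hd : p = k + 2 * d) (hd0 : 0 < d) (hk : Odd k)
    (hσ : σ * σ = 1) {c t : ℕ} (hc : 2 * c + 1 + t = k) :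
    IsotropicPair (nilp p k) (form p k) (diagSpan p k d σ c) t
      ![diagVec p k d σ (k - c), diagVec p k d (-σ) (k - c - 1)] where
  map_mem u hu := le_sup_left (a := spanEF p k (c + d) c)
    (map_diagSpan_le hd (by omega) ⟨u, hu, rfl⟩)
  pow_mem i := by
    fin_cases i
    · simp only [Fin.zero_eta, Matrix.cons_val_zero]
      rw [nilp_pow_diagVec_of_le hd (by omega) (by omega), show k - c - t = c + 1 by omega]
      exact Submodule.mem_sup_right (Submodule.mem_span_singleton_self _)
    · simp only [Fin.mk_one, Matrix.cons_val_one, Matrix.cons_val_zero]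
      rw [nilp_pow_diagVec_of_le hd (by omega) (by omega), show k - c - 1 - t = c by omega]
      exact Submodule.mem_sup_left (diagVec_mem_spanEF _ _ (by omega) le_rfl)
  indep ht0 b hb := by
    simp only [Fin.sum_univ_two, Matrix.cons_val_zero, Matrix.cons_val_one] at hb
    rw [nilp_pow_diagVec_of_le hd (by omega) (by omega),
      nilp_pow_diagVec_of_le hd (by omega) (by omega), show k - c - (t - 1) = c + 2 by omega,
      show k - c - 1 - (t - 1) = c + 1 by omega] at hb
    have h0 : b 0 = 0 := by
      have := diagSpan_inr_eq_zero hb ⟨c + 1, by omega⟩ (Nat.lt_succ_self c)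
      simpa [diagVec, eVec, fVec] using this
    have h1 : b 1 = 0 := by
      have h2 := diagSpan_relation hb ⟨c + d, by omega⟩ ⟨c, by omega⟩ rfl rfl
      rw [h0] at h2
      simp only [zero_smul, zero_add, Pi.smul_apply, diagVec, Pi.add_apply, Pi.zero_apply, eVec,
        fVec, smul_eq_mul] at h2
      rw [if_pos (by omega), if_pos (by trivial)] at h2
      have h3 : σ * b 1 = 0 := by linear_combination (-1 / 2 : ℂ) * h2
      refine (mul_eq_zero.1 h3).resolve_left fun h4 => ?_
      rw [h4, zero_mul] at hσ
      exact zero_ne_one hσ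
    ext i
    fin_cases i
    · exact h0
    · exact h1
  orthogonal_eq := by
    refine (isSkewPair h).orthogonal_eq_of_map_le ?_
      (map_orthogonal_diagSpan_le h hd hd0 hk hσ hc)
    rw [finrank_diagSpan hd (by omega)]
    simp
    omega
  form_self i b _ := by
    fin_cases i
    · simp only [Fin.zero_eta, Matrix.cons_val_zero]
      rw [form_diagVec hd hd0 hk (by omega) (by omega), hσ, sub_self, zero_mul, ite_self]
    · simp only [Fin.mk_one, Matrix.cons_val_one, Matrix.cons_val_zero]
      rw [form_diagVec hd hd0 hk (by omega) (by omega), neg_mul_neg, hσ, sub_self, zero_mul,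
        ite_self]
  form_cross b hb := by
    simp only [Matrix.cons_val_one, Matrix.cons_val_zero]
    rw [form_diagVec hd hd0 hk (by omega) (by omega), if_neg]
    obtain ⟨b', rfl⟩ := hb
    obtain ⟨k', rfl⟩ := hk
    omega

variable {a : MarkedCupDiagram ((p + k) / 2)}

/-- The junction of the two halves of the base point: `U` is the prescribed subspace at the
rightmost ray. The last clauses fit it onto the coordinate subspace in front of the ray. -/
theorem exists_isotropicPair_of_ray (h : IsTypeD p k) (ha : a ∈ diagramsD p k)
    {v : Fin ((p + k) / 2)} (hv : a.IsRay v) (hr : ∀ r, a.IsRay r → r ≤ v) :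
    ∃ U gen, IsotropicPair (nilp p k) (form p k) U ((p + k) / 2 - (v.val + 1)) gen ∧
      finrank ℂ U = v.val + 1 ∧
      (∀ F : CompleteFlag (Idx p k), F.F (v.val + 1) = U → RayRelation p k F (v.val + 1)
        (a.cupsLeft v) (v ∈ a.marked) (∀ r, a.σ r = r → r ≤ v)) ∧
      spanEF p k (cnt a.IsRay 0 v.val + cnt a.IsLeft 0 v.val) (cnt a.IsRight 0 v.val) ≤ U ∧
      U.map (nilp p k) ≤
        spanEF p k (cnt a.IsRay 0 v.val + cnt a.IsLeft 0 v.val) (cnt a.IsRight 0 v.val) := by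
  have h1 := rightmost_ray_eq ha hv hr
  have hc := cupsLeft_eq hv
  have h2 := stable_cnt hv.stable (Nat.zero_le _) v.2.le
  have h3 := cnt_isRay_of_diagramsD ha
  have hLR := hv.stable.cnt_eq
  have hv2 := v.2
  have heven := even_sub hv.stable_succ hv2 fun r hr' => by
    have : r.val ≤ v.val := hr r hr'
    omega
  have h' := h
  rw [hc]
  rw [hLR]
  generalize hcdef : cnt a.IsRight 0 v.val = c at *
  obtain ⟨hk, hkp, hpk⟩ := h
  rcases hkp.eq_or_lt with hkp | hlt
  · have hpk := hkp.symm
    have hY : cnt a.IsRay 0 v.val = 0 := by omega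
    have key : ∀ r s, r + s = v.val + 1 → c ≤ r → c ≤ s → r ≤ c + 1 → s ≤ c + 1 →
        (∀ F : CompleteFlag (Idx p k), F.F (v.val + 1) = spanEF p k r s →
          RayRelation p k F (v.val + 1) c (v ∈ a.marked) (∀ r, a.σ r = r → r ≤ v)) → _ :=
      fun r s hrs hr hs hr' hs' hF =>
      (⟨spanEF p k r s, _, isotropicPair_spanEF h' hpk (by omega) heven,
        (finrank_spanEF (by omega) (by omega)).trans hrs, hF,
        spanEF_mono (by omega) (by omega), by
          rw [← pow_one (nilp p k)]
          exact map_pow_spanEF_le (by omega) (by omega)⟩ : ∃ U gen, IsotropicPair (nilp p k) (form p k) U ((p + k) / 2 - (v.val + 1)) gen ∧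
      finrank ℂ U = v.val + 1 ∧
      (∀ F : CompleteFlag (Idx p k), F.F (v.val + 1) = U → RayRelation p k F (v.val + 1)
        c (v ∈ a.marked) (∀ r, a.σ r = r → r ≤ v)) ∧
      spanEF p k (cnt a.IsRay 0 v.val + c) c ≤ U ∧
      U.map (nilp p k) ≤ spanEF p k (cnt a.IsRay 0 v.val + c) c)
    by_cases hM : v ∈ a.marked
    · refine key c (c + 1) (by omega) (by omega) (by omega) (by omega) (by omega) fun F hF =>
        ⟨fun _ => ⟨fun _ => ?_, fun h => absurd hM h⟩, fun h => by omega⟩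
      rw [hF]
      congr 1 <;> omega
    · refine key (c + 1) c (by omega) (by omega) (by omega) (by omega) (by omega) fun F hF =>
        ⟨fun _ => ⟨fun h => absurd h hM, fun _ => ?_⟩, fun h => by omega⟩
      rw [hF]
      congr 1 <;> omega
  · obtain ⟨hp', hk'⟩ := hpk.resolve_left (by omega)
    obtain ⟨d, hd⟩ : ∃ d, p = k + 2 * d := by
      obtain ⟨b, hb⟩ := hp'
      obtain ⟨b', hb'⟩ := hk'
      exact ⟨b - b', by omega⟩
    have hk2 : 2 * (k / 2) + 1 = k := Nat.two_mul_div_two_add_one_of_odd hk'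
    have hY : cnt a.IsRay 0 v.val + c = c + d := by omega
    rw [hY]
    have key : ∀ σ : ℂ, σ * σ = 1 →
        (∀ F : CompleteFlag (Idx p k), F.F (v.val + 1) = diagSpan p k d σ c →
          RayRelation p k F (v.val + 1) c (v ∈ a.marked) (∀ r, a.σ r = r → r ≤ v)) → _ :=
      fun σ hσ hF =>
      (⟨diagSpan p k d σ c, _, isotropicPair_diagSpan h' hd (by omega) hk' hσ (by omega),
        (finrank_diagSpan hd (by omega)).trans (by omega), hF, le_sup_left,
        map_diagSpan_le hd (by omega)⟩ : ∃ U gen, IsotropicPair (nilp p k) (form p k) U ((p + k) / 2 - (v.val + 1)) gen ∧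
      finrank ℂ U = v.val + 1 ∧
      (∀ F : CompleteFlag (Idx p k), F.F (v.val + 1) = U → RayRelation p k F (v.val + 1)
        c (v ∈ a.marked) (∀ r, a.σ r = r → r ≤ v)) ∧
      spanEF p k (c + d) c ≤ U ∧
      U.map (nilp p k) ≤ spanEF p k (c + d) c)
    have e1 : v.val + 1 - c = c + 1 + d := by omega
    have e2 : v.val + 1 - c - 1 = c + d := by omega
    by_cases hM : v ∈ a.marked
    · refine key 1 (one_mul _) fun F hF => ⟨fun h => by omega, fun _ => ⟨fun _ => ?_,
        fun h => absurd hM h, fun h => absurd hM h⟩⟩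
      rw [hF, e2, e1, diagSpan, diagVec, one_smul]
    · refine key (-1) (by norm_num) fun F hF => ⟨fun h => by omega, fun _ => ⟨fun h => absurd h hM,
        fun _ _ => ?_, fun _ h => absurd hr h⟩⟩
      rw [hF, e2, e1, diagSpan, diagVec, neg_one_smul, sub_eq_add_neg]

end ConcretePairs

/-! ### Existence of a base point of `K_a` -/

namespace MarkedCupDiagram

variable {m : ℕ}

theorem cnt_congr {P P' : Fin m → Prop} {u w : ℕ}
    (h : ∀ z : Fin m, u ≤ z.val → z.val < w → (P z ↔ P' z)) : cnt P u w = cnt P' u w := by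
  classical
  rw [cnt, cnt]
  congr 1
  ext z
  simp only [Finset.mem_filter, Finset.mem_univ, true_and]
  exact and_congr_right fun h1 => and_congr_right fun h2 => h z h1 h2

theorem cnt_add_not (P : Fin m → Prop) {u w : ℕ} (h1 : u ≤ w) (h2 : w ≤ m) :
    cnt P u w + cnt (fun z => ¬ P z) u w + u = w := by
  induction w, h1 using Nat.le_induction with
  | base => simp [cnt_self]
  | succ w hw ih =>
    have h3 := ih (by omega)
    let z : Fin m := ⟨w, h2⟩
    have hz : u ≤ z.val := hw
    have hz' : w = z.val := rfl
    rw [hz'] at h3 ⊢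
    by_cases h : P z
    · rw [cnt_succ_of_pos hz h, cnt_succ_of_neg hz (not_not.2 h)]
      omega
    · rw [cnt_succ_of_neg hz h, cnt_succ_of_pos (P := fun z => ¬ P z) hz h]
      omega

variable (a : MarkedCupDiagram m)

/-- The vertices at which the first Jordan chain is extended. -/
def IsForward (z : Fin m) : Prop := a.IsLeft z ∨ a.σ z ∈ a.marked

variable {a}

/-- Marked cups do not lie under other cups, so within the cup of `u` only its own right end can
count as forward without being a left end. -/
theorem isForward_iff {u z : Fin m} (hu : a.IsLeft u) (h1 : u.val ≤ z.val)
    (h2 : z.val < (a.σ u).val + 1) (h3 : a.σ z ∈ a.marked → a.σ z ≠ u) :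
    a.IsForward z ↔ a.IsLeft z := by
  refine or_iff_left fun h4 => ?_
  have h5 := hu.stable z h1 h2
  have h6 : u.val ≠ (a.σ z).val := fun h => h3 h4 (Fin.ext h.symm)
  have h7 : a.σ (a.σ z) ≠ a.σ u := fun h => h3 h4 (a.σ_injective h)
  refine (a.accessible _ h4).2 u ⟨lt_of_le_of_ne h5.1 fun h => h6 (Fin.val_eq_of_eq h),
    lt_of_le_of_ne ?_ h7⟩
  rw [a.invol]
  exact Nat.lt_succ_iff.1 h2

theorem cnt_isForward_of_not {u : Fin m} (hu : a.IsLeft u) (hM : u ∉ a.marked) :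
    cnt a.IsForward u.val ((a.σ u).val + 1) = cnt a.IsRight u.val ((a.σ u).val + 1) := by
  rw [← hu.stable.cnt_eq]
  exact cnt_congr fun z h1 h2 => isForward_iff hu h1 h2 fun h h' => hM (h' ▸ h)

/-- The right end of a marked cup extends the first chain too. This surplus step is what makes
`F_{i-1} + x^s F_j` grow to `F_i`. -/
theorem cnt_isForward_of_marked {u : Fin m} (hu : a.IsLeft u) (hM : u ∈ a.marked) :
    cnt a.IsForward u.val ((a.σ u).val + 1) = cnt a.IsRight u.val ((a.σ u).val + 1) + 1 := by
  have hlt : u.val < (a.σ u).val := hu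
  rw [← hu.stable.cnt_eq, cnt_succ_of_pos hlt.le (Or.inr (by rwa [a.invol])),
    cnt_succ_of_neg hlt.le hu.isRight.not_isLeft]
  congr 1
  refine cnt_congr fun z h1 h2 => isForward_iff hu h1 (by omega) fun _ h' => ?_
  have h3 : z = a.σ u := by rw [← h', a.invol]
  rw [h3] at h2
  exact lt_irrefl _ h2

end MarkedCupDiagram

section BasePoint

open Module MarkedCupDiagram

variable {p k : ℕ} {a : MarkedCupDiagram ((p + k) / 2)}

/-- The subspace of a base point at the end `v₀` of the rightmost ray, with generators of the
Jordan blocks beyond it. -/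
structure RayBase (a : MarkedCupDiagram ((p + k) / 2)) (v₀ : ℕ) (U : Submodule ℂ (Idx p k → ℂ))
    (gen : Fin 2 → Idx p k → ℂ) : Prop where
  le : v₀ ≤ (p + k) / 2
  ray_lt : ∀ r, a.IsRay r → r.val < v₀
  stable : a.Stable 0 v₀
  pair : IsotropicPair (nilp p k) (form p k) U ((p + k) / 2 - v₀) gen
  finrank_eq : finrank ℂ U = v₀
  isRay : ∀ v : Fin ((p + k) / 2), v.val + 1 = v₀ → a.IsRay v
  relation : ∀ v : Fin ((p + k) / 2), v.val + 1 = v₀ → ∀ F : CompleteFlag (Idx p k), F.F v₀ = U →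
    RayRelation p k F (v.val + 1) (a.cupsLeft v) (v ∈ a.marked) (∀ r, a.σ r = r → r ≤ v)
  ge : ∀ v, v + 1 = v₀ → spanEF p k (cnt a.IsRay 0 v + cnt a.IsLeft 0 v) (cnt a.IsRight 0 v) ≤ U
  map_le : ∀ v, v + 1 = v₀ → U.map (nilp p k) ≤
    spanEF p k (cnt a.IsRay 0 v + cnt a.IsLeft 0 v) (cnt a.IsRight 0 v)

/-- Without rays the construction starts at `U = 0`; this happens only for `p = k`. -/
theorem exists_rayBase (h : IsTypeD p k) (ha : a ∈ diagramsD p k) : ∃ v₀ U gen, RayBase a v₀ U gen := by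
  classical
  by_cases hr : ∃ r, a.IsRay r
  · obtain ⟨v, hv, hmax⟩ := (Finset.univ.filter a.IsRay).exists_max_image id
      (by obtain ⟨r, hr⟩ := hr; exact ⟨r, by simpa using hr⟩)
    simp only [Finset.mem_filter, Finset.mem_univ, true_and, id_eq] at hv hmax
    obtain ⟨U, gen, h1, h2, h3, h4, h5⟩ := exists_isotropicPair_of_ray h ha hv hmax
    have e : ∀ w : Fin ((p + k) / 2), w.val + 1 = v.val + 1 → w = v := fun w hw =>
      Fin.ext (by omega)
    have e' : ∀ w : ℕ, w + 1 = v.val + 1 → w = v.val := fun w hw => by omega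
    exact ⟨v.val + 1, U, gen, v.2, fun r hr => Nat.lt_succ_of_le (hmax r hr), hv.stable_succ, h1,
      h2, fun w hw => (e w hw) ▸ hv, fun w hw => by rw [e w hw]; exact h3,
      fun w hw => by rw [e' w hw]; exact h4, fun w hw => by rw [e' w hw]; exact h5⟩
  · push Not at hr
    have h1 := cnt_isRay_of_diagramsD ha
    rw [cnt_eq_zero fun z _ _ => hr z] at h1
    have hpk : p = k := by
      rcases h.2.2 with h2 | ⟨⟨b, hb⟩, ⟨b', hb'⟩⟩
      · exact h2
      · have := h.2.1
        omega
    have hst : a.Stable 0 0 := fun z _ hz => absurd hz (Nat.not_lt_zero _)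
    have heven := even_sub hst (Nat.zero_le _) fun r hr' => absurd hr' (hr r)
    exact ⟨0, _, _, Nat.zero_le _, fun r hr' => absurd hr' (hr r), hst,
      isotropicPair_spanEF h hpk (r := 0) (s := 0) (by omega) heven,
      finrank_spanEF (Nat.zero_le _) (Nat.zero_le _), fun v hv => by omega, fun v hv => by omega,
      fun v hv => by omega, fun v hv => by omega⟩

/-- The subspaces of a base point. -/
noncomputable def baseSpace (a : MarkedCupDiagram ((p + k) / 2)) (v₀ : ℕ)
    (U : Submodule ℂ (Idx p k → ℂ)) (gen : Fin 2 → Idx p k → ℂ) (l : ℕ) :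
    Submodule ℂ (Idx p k → ℂ) :=
  if l < v₀ then spanEF p k (cnt a.IsRay 0 l + cnt a.IsLeft 0 l) (cnt a.IsRight 0 l)
  else chainSpan (nilp p k) U ((p + k) / 2 - v₀) gen (cnt a.IsForward v₀ l)
    (cnt (fun z => ¬ a.IsForward z) v₀ l)

namespace RayBase

variable {v₀ : ℕ} {U : Submodule ℂ (Idx p k → ℂ)} {gen : Fin 2 → Idx p k → ℂ}
  (hb : RayBase a v₀ U gen) (h : IsTypeD p k) (ha : a ∈ diagramsD p k)

theorem baseSpace_of_lt {l : ℕ} (hl : l < v₀) : baseSpace a v₀ U gen l =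
    spanEF p k (cnt a.IsRay 0 l + cnt a.IsLeft 0 l) (cnt a.IsRight 0 l) := if_pos hl

theorem baseSpace_of_ge {l : ℕ} (hl : v₀ ≤ l) : baseSpace a v₀ U gen l =
    chainSpan (nilp p k) U ((p + k) / 2 - v₀) gen (cnt a.IsForward v₀ l)
      (cnt (fun z => ¬ a.IsForward z) v₀ l) := if_neg (by omega)

include hb in
theorem baseSpace_self : baseSpace a v₀ U gen v₀ = U := by
  rw [baseSpace_of_ge le_rfl, cnt_self, cnt_self, hb.pair.chainSpan_zero]

include ha in
theorem cnt_le (h : IsTypeD p k) {l : ℕ} (hl : l ≤ (p + k) / 2) :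
    cnt a.IsRay 0 l + cnt a.IsLeft 0 l ≤ p ∧ cnt a.IsRight 0 l ≤ k := by
  have h1 := cnt_isRay_of_diagramsD ha
  have h2 := a.cnt_isLeft_univ
  have h3 := a.stable_univ.cnt_eq
  rw [show a.cups.card = k / 2 from ha] at h2
  have h4 := cnt_mono a.IsRay (Nat.zero_le l) hl
  have h5 := cnt_mono a.IsLeft (Nat.zero_le l) hl
  have h6 := cnt_mono a.IsRight (Nat.zero_le l) hl
  have h7 := h.1
  have h8 := h.2.1
  constructor <;> omega

include hb h ha in
theorem finrank_baseSpace {l : ℕ} (hl : l ≤ (p + k) / 2) :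
    finrank ℂ (baseSpace a v₀ U gen l) = l := by
  rcases lt_or_ge l v₀ with hl' | hl'
  · obtain ⟨h1, h2⟩ := cnt_le ha h hl
    have h3 := a.cnt_total (Nat.zero_le l) hl
    rw [baseSpace_of_lt hl', finrank_spanEF h1 h2]
    omega
  · have h1 := cnt_add_not a.IsForward hl' hl
    rw [baseSpace_of_ge hl', hb.pair.finrank_chainSpan (isSkewPair h) (by omega) (by omega),
      hb.finrank_eq]
    omega

include hb in
theorem baseSpace_le_succ {l : ℕ} : baseSpace a v₀ U gen l ≤ baseSpace a v₀ U gen (l + 1) := by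
  rcases lt_or_ge (l + 1) v₀ with h1 | h1
  · rw [baseSpace_of_lt h1, baseSpace_of_lt (by omega)]
    have h4 := cnt_mono a.IsRay (Nat.zero_le l) (Nat.le_add_right l 1)
    have h5 := cnt_mono a.IsLeft (Nat.zero_le l) (Nat.le_add_right l 1)
    have h6 := cnt_mono a.IsRight (Nat.zero_le l) (Nat.le_add_right l 1)
    exact spanEF_mono (add_le_add h4 h5) h6
  rcases h1.eq_or_lt with h1 | h1
  · rw [baseSpace_of_lt (by omega), ← h1, hb.baseSpace_self]
    exact hb.ge l h1.symm
  · rw [baseSpace_of_ge (by omega), baseSpace_of_ge (by omega)]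
    exact chainSpan_mono (cnt_mono _ (by omega) (Nat.le_add_right l 1))
      (cnt_mono _ (by omega) (Nat.le_add_right l 1))

include hb in
theorem map_baseSpace_le {l : ℕ} (hl : l < (p + k) / 2) :
    (baseSpace a v₀ U gen (l + 1)).map (nilp p k) ≤ baseSpace a v₀ U gen l := by
  rcases lt_or_ge (l + 1) v₀ with h1 | h1
  · rw [baseSpace_of_lt h1, baseSpace_of_lt (by omega)]
    have h2 := a.cnt_total (Nat.zero_le l) hl.le
    have h3 := a.cnt_total (Nat.zero_le (l + 1)) hl
    have h4 := cnt_mono a.IsRay (Nat.zero_le l) (Nat.le_add_right l 1)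
    have h5 := cnt_mono a.IsLeft (Nat.zero_le l) (Nat.le_add_right l 1)
    have h6 := cnt_mono a.IsRight (Nat.zero_le l) (Nat.le_add_right l 1)
    rw [← pow_one (nilp p k)]
    exact map_pow_spanEF_le (by omega) (by omega)
  rcases h1.eq_or_lt with h1 | h1
  · rw [baseSpace_of_lt (l := l) (by omega), ← h1, hb.baseSpace_self]
    exact hb.map_le l h1.symm
  · have h2 := cnt_add_not a.IsForward (show v₀ ≤ l by omega) hl.le
    have h3 := cnt_add_not a.IsForward (show v₀ ≤ l + 1 by omega) hl
    have h4 := cnt_mono a.IsForward (show v₀ ≤ l by omega) (Nat.le_add_right l 1)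
    have h5 := cnt_mono (fun z => ¬ a.IsForward z) (show v₀ ≤ l by omega) (Nat.le_add_right l 1)
    rw [baseSpace_of_ge (by omega), baseSpace_of_ge (by omega), ← pow_one (nilp p k)]
    exact hb.pair.map_pow_chainSpan_le (by omega) (by omega)

include hb h in
theorem baseSpace_isotropic : baseSpace a v₀ U gen ((p + k) / 2) ≤
    (form p k).orthogonal (baseSpace a v₀ U gen ((p + k) / 2)) := by
  have h1 := cnt_add_not a.IsForward hb.le le_rfl
  rw [baseSpace_of_ge hb.le]
  exact hb.pair.chainSpan_le_orthogonal (isSkewPair h) (by omega) (by omega)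

variable {P : CompleteFlag (Idx p k)}

include hb h ha in
-- For chain spans every relation is an inequality between the lengths of the two chains. An
-- unmarked cup extends both chains by `s`; a marked one extends them by `s + 1` and `s - 1`. Left
-- of the rightmost ray the same count applies to coordinate subspaces.
theorem mem_K (hP : IsIsotropicFlag P) (hQ : ∀ l ≤ (p + k) / 2, P.F l = baseSpace a v₀ U gen l) :
    P ∈ K p k a := by
  have hm := h.even_add
  have hle := hb.le
  refine ⟨hP.map_nilp_le hm fun l hl => ?_, fun u hu => ?_, fun v hv => ?_⟩
  · rw [hQ _ hl, hQ _ hl.le]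
    exact hb.map_baseSpace_le hl
  · have hult : u.val < (a.σ u).val := hu
    have hu2 := (a.σ u).2
    have hlen := IsLeft.length (a := a) hu
    have hst := IsLeft.stable (a := a) hu
    set s := cnt a.IsRight u.val ((a.σ u).val + 1) with hs
    rcases lt_or_ge u.val v₀ with huv | huv
    · have h1 := (hb.stable u (Nat.zero_le _) huv).2
      let v : Fin ((p + k) / 2) := ⟨v₀ - 1, by omega⟩
      have hv : a.IsRay v := hb.isRay v (show v₀ - 1 + 1 = v₀ by omega)
      have h2 : (a.σ u).val ≠ v₀ - 1 := fun h2 => by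
        have h3 : a.σ u = v := Fin.ext h2
        exact (IsLeft.isRight (a := a) hu).not_isRay (h3 ▸ hv)
      have hM : u ∉ a.marked := fun hM => by
        have h3 : v₀ - 1 < u.val := ray_lt_of_marked hM hu hv
        omega
      rw [cupRelation_iff_of_not hM hlen, eq_comap_iff_map_le h hlen (by omega), hQ ((a.σ u).val + 1) hu2,
        hQ _ u.2.le, baseSpace_of_lt (by omega), baseSpace_of_lt huv]
      have h4 := cnt_add a.IsRay (Nat.zero_le u.val) (show u.val ≤ (a.σ u).val + 1 by omega)
      have h5 := cnt_add a.IsLeft (Nat.zero_le u.val) (show u.val ≤ (a.σ u).val + 1 by omega)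
      have h6 := cnt_add a.IsRight (Nat.zero_le u.val) (show u.val ≤ (a.σ u).val + 1 by omega)
      have h7 := hst.cnt_eq
      have h8 := stable_cnt hst (by omega) hu2
      exact map_pow_spanEF_le (by omega) (by omega)
    · have h1 := cnt_add a.IsForward huv (show u.val ≤ (a.σ u).val + 1 by omega)
      have h2 := cnt_add_not a.IsForward huv u.2.le
      have h3 := cnt_add_not a.IsForward (show v₀ ≤ (a.σ u).val + 1 by omega) hu2
      by_cases hM : u ∈ a.marked
      · have hq : 2 * ((a.σ u).val + 1 + ((p + k) / 2 - ((a.σ u).val + 1))) = p + k := by omega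
        have h4 := cnt_isForward_of_marked hu hM
        have h5 := cnt_add_not a.IsForward (show v₀ ≤ u.val + 1 by omega) u.2
        have h6 : cnt a.IsForward v₀ (u.val + 1) = cnt a.IsForward v₀ u.val + 1 :=
          cnt_succ_of_pos huv (Or.inl hu)
        rw [cupRelation_iff_of_marked hM hlen hq, orthogonal_eq_comap_iff h hP hq,
          hP _ (by omega), hQ ((a.σ u).val + 1) hu2, hQ _ u.2.le, hQ (u.val + 1) u.2, baseSpace_of_ge huv,
          baseSpace_of_ge (show v₀ ≤ u.val + 1 by omega), baseSpace_of_ge (show v₀ ≤ (a.σ u).val + 1 by omega)]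
        refine ⟨le_antisymm (sup_le (chainSpan_mono (by omega) (by omega))
          (hb.pair.map_pow_chainSpan_le (by omega) (by omega))) (chainSpan_le
            (le_chainSpan.trans le_sup_left) (fun c hc => ?_) fun c hc =>
              Submodule.mem_sup_left (gen_one_mem_chainSpan (by omega))), ?_⟩
        · by_cases hc' : (p + k) / 2 - v₀ ≤ c + cnt a.IsForward v₀ u.val
          · exact Submodule.mem_sup_left (gen_zero_mem_chainSpan hc')
          · refine Submodule.mem_sup_right ⟨(nilp p k ^ (c - s)) (gen 0),
              gen_zero_mem_chainSpan (by omega), ?_⟩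
            rw [← Module.End.mul_apply, ← pow_add, show s + (c - s) = c by omega]
        · rw [hb.pair.orthogonal_chainSpan (isSkewPair h) (by
            rw [hb.finrank_eq]
            simp
            omega) (by omega) (by omega)]
          exact hb.pair.map_pow_chainSpan_le (by omega) (by omega)
      · have h4 := cnt_isForward_of_not hu hM
        rw [cupRelation_iff_of_not hM hlen, eq_comap_iff_map_le h hlen (by omega), hQ ((a.σ u).val + 1) hu2,
          hQ _ u.2.le, baseSpace_of_ge (by omega), baseSpace_of_ge huv]
        exact hb.pair.map_pow_chainSpan_le (by omega) (by omega)
  · have hvlt := hb.ray_lt v hv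
    by_cases hv0 : v.val + 1 = v₀
    · refine hb.relation v hv0 P ?_
      rw [hQ _ hle, hb.baseSpace_self]
    · let w : Fin ((p + k) / 2) := ⟨v₀ - 1, by omega⟩
      have hw : a.IsRay w := hb.isRay w (show v₀ - 1 + 1 = v₀ by omega)
      have hvw : v < w := show v.val < v₀ - 1 by omega
      have hM : v ∉ a.marked := fun hM => (a.accessible v hM).1 w hw (by rwa [hv])
      have hnr : ¬ ∀ r, a.σ r = r → r ≤ v := fun hr => absurd (hr w hw) (not_le.2 hvw)
      -- A ray that is not rightmost means at least two rays. For `p = k` there is at most one,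
      -- which excludes that case.
      have h1 := cnt_isRay_of_diagramsD ha
      have h2 : cnt a.IsRay 0 (v.val + 1) = cnt a.IsRay 0 v.val + 1 :=
        cnt_succ_of_pos (Nat.zero_le _) hv
      have h3 : cnt a.IsRay 0 (w.val + 1) = cnt a.IsRay 0 w.val + 1 :=
        cnt_succ_of_pos (Nat.zero_le _) hw
      have h4 := cnt_mono a.IsRay (Nat.zero_le (v.val + 1)) (show v.val + 1 ≤ w.val from hvw)
      have h5 := cnt_mono a.IsRay (Nat.zero_le (w.val + 1)) w.2
      refine ⟨fun hpk => by omega, fun _ => ⟨fun h => absurd h hM, fun _ h => absurd h hnr,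
        fun _ _ => ?_⟩⟩
      have h6 := a.cnt_total (Nat.zero_le (v.val + 1)) v.2
      have h7 : cnt a.IsRight 0 (v.val + 1) = cnt a.IsRight 0 v.val :=
        cnt_succ_of_neg (Nat.zero_le _) fun h' => h'.not_isRay hv
      rw [hQ (v.val + 1) v.2, baseSpace_of_lt (by omega), cupsLeft_eq hv, h7]
      congr 1
      omega

include hb h in
-- The same two chains, cut down to equal length, serve as generators. Cutting shifts the exponents
-- in their pairing by `A + B = u - v₀`, which is even.
theorem exists_shearData (hQ : ∀ l ≤ (p + k) / 2, P.F l = baseSpace a v₀ U gen l)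
    {u : Fin ((p + k) / 2)} (hu : a.IsLeft u) (hM : u ∈ a.marked) :
    ∃ r gen, ShearData a P u r gen := by
  have hsk := isSkewPair h
  have hult : u.val < (a.σ u).val := hu
  have hu2 := u.2
  have hle := hb.le
  have huv : v₀ ≤ u.val := by
    by_contra hc
    have h1 := hb.isRay ⟨v₀ - 1, by omega⟩ (show v₀ - 1 + 1 = v₀ by omega)
    have h2 : v₀ - 1 < u.val := ray_lt_of_marked hM hu h1
    omega
  have h2 := cnt_add_not a.IsForward huv u.2.le
  have h6 : cnt a.IsForward v₀ (u.val + 1) = cnt a.IsForward v₀ u.val + 1 :=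
    cnt_succ_of_pos huv (Or.inl hu)
  have h3 := even_sub hb.stable hle hb.ray_lt
  have h4 := even_sub (stable_of_marked hM) hu2.le fun r hr => ray_lt_of_marked hM hu hr
  have hQu := (hQ u hu2.le).trans (baseSpace_of_ge huv)
  have hQu' := (hQ (u.val + 1) hu2).trans (baseSpace_of_ge (by omega))
  generalize cnt a.IsForward v₀ u.val = A at *
  generalize cnt (fun z => ¬ a.IsForward z) v₀ u.val = B at *
  have hj := hb.pair.jordanPair_chainSpan hsk (a := A) (b := B) (by omega)
  rw [← hQu] at hj
  refine ⟨_, _, hj, ?_, fun h' => absurd hM h', fun _ => by omega, fun _ i c hc => ?_,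
    fun _ c hc => ?_⟩
  · rw [hQu', Matrix.cons_val_zero, ← Module.End.mul_apply, ← pow_add]
    exact gen_zero_mem_chainSpan (by omega)
  · fin_cases i
    · simp only [Fin.zero_eta, Matrix.cons_val_zero]
      rw [← Module.End.mul_apply, ← pow_add]
      exact hb.pair.form_pow_self hsk 0 _ _
    · simp only [Fin.mk_one, Matrix.cons_val_one, Matrix.cons_val_zero]
      rw [← Module.End.mul_apply, ← pow_add]
      exact hb.pair.form_pow_self hsk 1 _ _
  · simp only [Matrix.cons_val_one, Matrix.cons_val_zero]
    rw [← Module.End.mul_apply, ← pow_add]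
    refine hb.pair.form_pow_cross hsk (Or.inr ?_)
    obtain ⟨b, hb1⟩ := h3
    obtain ⟨b', hb2⟩ := h4
    obtain ⟨c', rfl⟩ := hc
    exact ⟨b - b' + c', by omega⟩

end RayBase

theorem exists_mem_K (h : IsTypeD p k) (ha : a ∈ diagramsD p k) : ∃ P ∈ K p k a,
    ∀ v : Fin ((p + k) / 2), a.IsLeft v → v ∈ a.marked → ∃ r gen, ShearData a P v r gen := by
  obtain ⟨v₀, U, gen, hb⟩ := exists_rayBase h ha
  obtain ⟨P, hP, hQ⟩ := exists_isotropicFlag h h.even_add (baseSpace a v₀ U gen)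
    (fun l hl => hb.finrank_baseSpace h ha hl) (fun l _ => hb.baseSpace_le_succ)
    (hb.baseSpace_isotropic h)
  exact ⟨P, hb.mem_K h ha hP hQ, fun v hv hM => hb.exists_shearData h hQ hv hM⟩

end BasePoint

/-! ### Closedness -/

section Closed

open Module FunSpace MarkedCupDiagram

theorem isClosed_forall {X : Type*} {κ : Sort*} (t : TopologicalSpace X) {Q : κ → X → Prop}
    (h : ∀ i, IsClosed[t] {x | Q i x}) : IsClosed[t] {x | ∀ i, Q i x} := by
  have h1 : {x | ∀ i, Q i x} = ⋂ i, {x | Q i x} := by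
    ext
    simp
  rw [h1]
  exact @isClosed_iInter _ _ t _ h

theorem isClosed_and {X : Type*} (t : TopologicalSpace X) {Q R : X → Prop}
    (h : IsClosed[t] {x | Q x}) (h' : IsClosed[t] {x | R x}) : IsClosed[t] {x | Q x ∧ R x} :=
  @IsClosed.inter _ _ _ t h h'

variable {ι : Type} [Fintype ι]

/-- The `l`-th vector of a frame. -/
def Frame.vec (g : Frame ι) (l : Fin (Fintype.card ι)) : ι → ℂ := fun i => g.1 (l, i)

theorem regVec_frame (l : Fin (Fintype.card ι)) :
    (frameSpace ι).RegVec Set.univ fun g => g.vec l := fun i => frameSpace_reg l i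

theorem Frame.flag_le_iff {g : Frame ι} {j : ℕ} {S : Submodule ℂ (ι → ℂ)} :
    g.flag.F j ≤ S ↔ ∀ l : Fin (Fintype.card ι), l.val < j → g.vec l ∈ S := by
  change Submodule.span ℂ _ ≤ S ↔ _
  rw [Submodule.span_le, Set.image_subset_iff]
  rfl

theorem isClosed_map_flag_le (A : Module.End ℂ (ι → ℂ)) (i j : ℕ) :
    IsClosed[(frameSpace ι).top] {g | (g.flag.F j).map A ≤ g.flag.F i} := by
  simp only [Submodule.map_le_iff_le_comap, Frame.flag_le_iff, Submodule.mem_comap]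
  exact isClosed_forall _ fun l => isClosed_forall _ fun _ =>
    isClosed_mem_flag ((regVec_frame l).linearMap (frameSpace ι).top.isOpen_univ A) i

theorem isClosed_flag_le (S : Submodule ℂ (ι → ℂ)) (j : ℕ) :
    IsClosed[(frameSpace ι).top] {g | g.flag.F j ≤ S} := by
  simp only [Frame.flag_le_iff, ← Subspace.forall_mem_dualAnnihilator_apply_eq_zero_iff S]
  exact isClosed_forall _ fun l => isClosed_forall _ fun _ => isClosed_forall _ fun φ =>
    isClosed_forall _ fun _ => isClosed_eq_zero
      ((regVec_frame l).linear (frameSpace ι).top.isOpen_univ φ)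

/-- Dimensions in a flag are constant, so equality is an inclusion plus a condition independent of
the flag. -/
theorem isClosed_flag_eq (S : Submodule ℂ (ι → ℂ)) {j : ℕ} (hj : j ≤ Fintype.card ι) :
    IsClosed[(frameSpace ι).top] {g | g.flag.F j = S} := by
  have h : ∀ g : Frame ι, g.flag.F j = S ↔ g.flag.F j ≤ S ∧ finrank ℂ S = j := fun g => by
    have hg := g.flag.finrank_F hj
    refine ⟨fun h => ⟨h.le, by rw [← h, hg]⟩, fun h => ?_⟩
    exact Submodule.eq_of_le_of_finrank_le h.1 (by rw [h.2, hg])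
  simp only [h]
  refine isClosed_and _ (isClosed_flag_le S j) ?_
  by_cases hS : finrank ℂ S = j
  · simp only [hS]
    exact @isClosed_univ _ (frameSpace ι).top
  · simp only [hS]
    exact @isClosed_empty _ (frameSpace ι).top

variable {p k : ℕ}

theorem isIsotropicFlag_iff (h : IsTypeD p k) {F : CompleteFlag (Idx p k)} :
    IsIsotropicFlag F ↔ ∀ i ≤ p + k, F.F (p + k - i) ≤ (form p k).orthogonal (F.F i) := by
  refine ⟨fun hF i hi => (hF i hi).le, fun hF i hi => ?_⟩
  refine Submodule.eq_of_le_of_finrank_le (hF i hi) ?_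
  have h1 := (isSkewPair h).finrank_orthogonal (F.F i)
  have hfin : finrank ℂ (Idx p k → ℂ) = p + k := by simp
  rw [F.finrank_eq hi] at h1
  rw [F.finrank_eq (Nat.sub_le _ _)]
  omega

theorem isClosed_springerFiber (h : IsTypeD p k) :
    IsClosed[(frameSpace (Idx p k)).top] {g | g.flag ∈ springerFiber p k} := by
  refine isClosed_and _ ?_ (isClosed_forall _ fun i => isClosed_forall _ fun _ =>
    isClosed_map_flag_le _ _ _)
  have h1 : ∀ g : Frame (Idx p k), IsIsotropicFlag g.flag ↔ ∀ i ≤ p + k,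
      ∀ l : Fin (Fintype.card (Idx p k)), l.val < p + k - i →
      ∀ l' : Fin (Fintype.card (Idx p k)), l'.val < i → form p k (g.vec l') (g.vec l) = 0 := by
    intro g
    rw [isIsotropicFlag_iff h]
    refine forall₂_congr fun i _ => Frame.flag_le_iff.trans (forall₂_congr fun l _ => ?_)
    have h2 : g.vec l ∈ (form p k).orthogonal (g.flag.F i) ↔
        g.flag.F i ≤ LinearMap.ker ((form p k).flip (g.vec l)) := by
      rw [LinearMap.BilinForm.mem_orthogonal_iff]
      rfl
    rw [h2, Frame.flag_le_iff]
    rfl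
  change IsClosed[(frameSpace (Idx p k)).top] {g | IsIsotropicFlag g.flag}
  simp only [h1]
  exact isClosed_forall _ fun i => isClosed_forall _ fun _ => isClosed_forall _ fun l =>
    isClosed_forall _ fun _ => isClosed_forall _ fun l' => isClosed_forall _ fun _ =>
    isClosed_eq_zero ((regVec_frame l').bilin (frameSpace _).top.isOpen_univ (regVec_frame l) _)

theorem isClosed_rayRelation {i : ℕ} (hi : i ≤ p + k) (c : ℕ) (M R : Prop) :
    IsClosed[(frameSpace (Idx p k)).top] {g | RayRelation p k g.flag i c M R} := by
  have h1 : ∀ S, IsClosed[(frameSpace (Idx p k)).top] {g | g.flag.F i = S} := fun S =>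
    isClosed_flag_eq S (by simpa using hi)
  exact isClosed_and _ (isClosed_forall _ fun _ => isClosed_and _
      (isClosed_forall _ fun _ => h1 _) (isClosed_forall _ fun _ => h1 _))
    (isClosed_forall _ fun _ => isClosed_and _ (isClosed_forall _ fun _ => h1 _)
      (isClosed_and _ (isClosed_forall _ fun _ => isClosed_forall _ fun _ => h1 _)
        (isClosed_forall _ fun _ => isClosed_forall _ fun _ => h1 _)))

variable {a : MarkedCupDiagram ((p + k) / 2)}

/-- For flags satisfying the relations to the left of a marked cup `u < σ u`, the relation of the
cup in closed form. -/
theorem cupRelation_iff_le_markedSpace (h : IsTypeD p k) (ha : a ∈ diagramsD p k)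
    {F : CompleteFlag (Idx p k)} {u : Fin ((p + k) / 2)} (hF : RelationsUpTo p k a u F)
    (hu : a.IsLeft u) (hM : u ∈ a.marked) {s q : ℕ} (hs : u.val + 2 * s = (a.σ u).val + 1)
    (hq : 2 * ((a.σ u).val + 1 + q) = p + k) {f y : Idx p k → ℂ} (hf : f ∈ F.F (u + 1))
    (hf' : f ∉ F.F u) (hy : f ∈ LinearMap.range (nilp p k ^ (s + q)) →
      (nilp p k ^ (s + q)) y = f) :
    CupRelation p k F (u.val + 1) ((a.σ u).val + 1) (u ∈ a.marked) ↔
      F.F ((a.σ u).val + 1) ≤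
        IsSkewPair.markedSpace (nilp p k) (form p k) (F.F u) (F.F (u + 1)) s q f y ∧
      (F.F (p + k - ((a.σ u).val + 1))).map (nilp p k ^ q) ≤ F.F ((a.σ u).val + 1) := by
  have hsk := isSkewPair h
  have hd := hF.markedCupData h ha hu hM hs hq
  replace hy := hy (hd.mem_range h hf)
  have hle : F.F u ≤ F.F (u + 1) := F.mono (Nat.le_succ _)
  rw [cupRelation_iff_of_marked hM hs hq, ← orthogonal_eq_comap_iff h hF.springer.1 hq]
  refine and_congr_left fun h2 => ⟨fun h1 => ?_, fun h1 => ?_⟩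
  · exact hsk.le_markedSpace hd.dim hd.even hd.good hle hd.succ hf hf' hy hd.right h1 h2
  · exact hsk.sup_map_eq_of_le_markedSpace hd.dim hd.good hle hd.succ hf' hy hd.right h1

theorem exists_rightInverse_on_range {V : Type*} [AddCommGroup V] [Module ℂ V]
    (A : Module.End ℂ V) : ∃ R : Module.End ℂ V, ∀ f ∈ LinearMap.range A, A (R f) = f := by
  obtain ⟨R₀, hR₀⟩ := A.rangeRestrict.exists_rightInverse_of_surjective A.range_rangeRestrict
  obtain ⟨R, hR⟩ := LinearMap.exists_extend R₀
  refine ⟨R, fun f hf => ?_⟩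
  have h1 := LinearMap.congr_fun hR ⟨f, hf⟩
  have h2 := congrArg Subtype.val (LinearMap.congr_fun hR₀ ⟨f, hf⟩)
  simp only [LinearMap.comp_apply, Submodule.subtype_apply] at h1
  rw [h1]
  exact h2

theorem isClosed_le_markedSpace (A : Module.End ℂ (Idx p k → ℂ)) (w s q : ℕ) {u : ℕ}
    (hu : u < Fintype.card (Idx p k)) :
    IsClosed[(frameSpace (Idx p k)).top] {g | g.flag.F w ≤
      IsSkewPair.markedSpace (nilp p k) (form p k) (g.flag.F u) (g.flag.F (u + 1)) s q
        (g.vec ⟨u, hu⟩) (A (g.vec ⟨u, hu⟩))} := by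
  have ho := (frameSpace (Idx p k)).top.isOpen_univ
  have hf := regVec_frame (ι := Idx p k) ⟨u, hu⟩
  have hy := hf.linearMap ho A
  simp only [Frame.flag_le_iff, IsSkewPair.mem_markedSpace]
  refine isClosed_forall _ fun l => isClosed_forall _ fun _ => ?_
  have hl := regVec_frame (ι := Idx p k) l
  have hxl := hl.linearMap ho (nilp p k ^ s)
  exact isClosed_and _ (isClosed_mem_flag hxl _) (isClosed_mem_flag
    (((RegVec.smul (reg_const_mul 2 (hy.bilin ho hl (form p k))) hf)).sub
      (RegVec.smul (hy.bilin ho (hy.linearMap ho (nilp p k ^ q)) (form p k)) hxl)) _)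

/-- The sum condition of a marked cup is not visibly closed. It is replaced by the inclusion into
`markedSpace`, a closed condition. The two are equivalent once the relations left of the cup hold,
so the relations are exchanged from left to right. -/
theorem isClosed_K (h : IsTypeD p k) (ha : a ∈ diagramsD p k) :
    IsClosed[(flagVariety (Idx p k)).top] (K p k a) := by
  rw [isClosed_flagVariety_iff]
  have hm := h.even_add
  have hcard : Fintype.card (Idx p k) = p + k := by simp
  have hlt : ∀ u : Fin ((p + k) / 2), u.val < Fintype.card (Idx p k) := fun u => by
    have := u.2
    omega
  let s : Fin ((p + k) / 2) → ℕ := fun u => cnt a.IsRight u ((a.σ u).val + 1)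
  let q : Fin ((p + k) / 2) → ℕ := fun u => (p + k) / 2 - ((a.σ u).val + 1)
  have hs : ∀ u, a.IsLeft u → u.val + 2 * s u = (a.σ u).val + 1 := fun u hu => hu.length
  have hq : ∀ u, 2 * ((a.σ u).val + 1 + q u) = p + k := fun u => by
    have := (a.σ u).2
    simp only [q]
    omega
  -- A fixed linear section of `x^{s+q}` over its image makes the preimage `y` a regular function of
  -- the frame vector `f`.
  choose A hA using fun u => exists_rightInverse_on_range (nilp p k ^ (s u + q u))
  let C : Fin ((p + k) / 2) → Frame (Idx p k) → Prop := fun u g =>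
    (u ∉ a.marked → (g.flag.F ((a.σ u).val + 1)).map (nilp p k ^ s u) ≤ g.flag.F u) ∧
    (u ∈ a.marked → g.flag.F ((a.σ u).val + 1) ≤
      IsSkewPair.markedSpace (nilp p k) (form p k) (g.flag.F u) (g.flag.F (u + 1)) (s u) (q u)
        (g.vec ⟨u, hlt u⟩) (A u (g.vec ⟨u, hlt u⟩)) ∧
      (g.flag.F (p + k - ((a.σ u).val + 1))).map (nilp p k ^ q u) ≤ g.flag.F ((a.σ u).val + 1))
  have hC : ∀ u g, a.IsLeft u → RelationsUpTo p k a u g.flag →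
      (CupRelation p k g.flag (u.val + 1) ((a.σ u).val + 1) (u ∈ a.marked) ↔ C u g) := by
    intro u g hu hg
    by_cases hM : u ∈ a.marked
    · rw [cupRelation_iff_le_markedSpace h ha hg hu hM (hs u hu) (hq u)
        (g.isFrameOf ⟨u, hlt u⟩).1 (g.isFrameOf ⟨u, hlt u⟩).2 (hA u _)]
      exact ⟨fun h1 => ⟨fun h2 => absurd hM h2, fun _ => h1⟩, fun h1 => h1.2 hM⟩
    · rw [cupRelation_iff_of_not hM (hs u hu), eq_comap_iff_map_le h (hs u hu) (by
        have := (a.σ u).2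
        omega)]
      exact ⟨fun h1 => ⟨fun _ => h1, fun h2 => absurd h2 hM⟩, fun h1 => h1.1 hM⟩
  have hK : ∀ g : Frame (Idx p k), g.flag ∈ K p k a ↔ g.flag ∈ springerFiber p k ∧
      (∀ u, a.IsLeft u → C u g) ∧ ∀ v, a.IsRay v → RayRelation p k g.flag (v.val + 1)
        (a.cupsLeft v) (v ∈ a.marked) (∀ r, a.σ r = r → r ≤ v) := by
    intro g
    refine ⟨fun hg => ⟨hg.1, fun u hu => ?_, hg.2.2⟩, fun hg => ?_⟩
    · exact (hC u g hu ((mem_K_iff.1 hg).mono u.2.le)).1 (hg.2.1 u hu)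
    -- The equivalence `hC` at `u` requires the relations among the first `u` vertices, which the
    -- induction on `l` supplies.
    · have key : ∀ l, RelationsUpTo p k a l g.flag := by
        intro l
        induction l with
        | zero => exact ⟨hg.1, fun v _ hv => absurd hv (Nat.not_lt_zero _),
            fun v hv _ => hg.2.2 v hv⟩
        | succ l ih =>
          refine ⟨hg.1, fun u hu hul => ?_, fun v hv _ => hg.2.2 v hv⟩
          have hu' : u.val < (a.σ u).val := hu
          exact (hC u g hu (ih.mono (by omega))).2 (hg.2.1 u hu)
      exact mem_K_iff.2 (key _)
  have hset : (Frame.flag ⁻¹' K p k a : Set (Frame (Idx p k))) = {g | g.flag ∈ springerFiber p k ∧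
      (∀ u, a.IsLeft u → C u g) ∧ ∀ v, a.IsRay v → RayRelation p k g.flag (v.val + 1)
        (a.cupsLeft v) (v ∈ a.marked) (∀ r, a.σ r = r → r ≤ v)} := Set.ext hK
  rw [hset]
  refine isClosed_and _ (isClosed_springerFiber h) (isClosed_and _ ?_ ?_)
  · exact isClosed_forall _ fun u => isClosed_forall _ fun _ => isClosed_and _
      (isClosed_forall _ fun _ => isClosed_map_flag_le _ _ _)
      (isClosed_forall _ fun _ => isClosed_and _ (isClosed_le_markedSpace _ _ _ _ _)
        (isClosed_map_flag_le _ _ _))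
  · exact isClosed_forall _ fun v => isClosed_forall _ fun _ => isClosed_rayRelation (by
      have := v.2
      omega) _ _ _

end Closed

/-! ### The theorem -/

theorem isIteratedBundle_KSpace {p k : ℕ} (h : IsTypeD p k) {a : MarkedCupDiagram ((p + k) / 2)}
    (ha : a ∈ diagramsD p k) : FunSpace.IsIteratedBundle a.cups.card (KSpace p k a) := by
  obtain ⟨P, hP, hshear⟩ := exists_mem_K h ha
  have h1 := isIteratedBundle_stratum h ha hP hshear (zero_add ((p + k) / 2))
  rw [MarkedCupDiagram.cnt_isLeft_univ] at h1
  have h2 : ∀ S : Set (CompleteFlag (Idx p k)), stratum a P 0 = S →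
      FunSpace.IsIteratedBundle a.cups.card
        ((flagVariety (Idx p k)).induced ((↑) : S → CompleteFlag (Idx p k))) := by
    rintro S rfl
    exact h1
  exact h2 _ stratum_zero

theorem theorem3p2 (p k : ℕ) (hpk : IsTypeD p k) (a : MarkedCupDiagram ((p + k) / 2))
    (ha : a ∈ diagramsD p k) (ℓ : ℕ) (hℓ : a.cups.card = ℓ) :
    IsClosed[(flagVariety (Idx p k)).top] (K p k a) ∧
    FunSpace.IsIteratedBundle ℓ (KSpace p k a) ∧
    @IrreducibleSpace (K p k a) (KSpace p k a).top ∧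
    FunSpace.IsSmooth (KSpace p k a) := by
  subst hℓ
  have h := isIteratedBundle_KSpace hpk ha
  exact ⟨isClosed_K hpk ha, h, h.irred.irreducibleSpace, h.locallyAffine.isSmooth⟩
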